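/- **Proposition 3.11.** Let $D$ be a non-zero integer, let $M_1=M_2=\mathbb Z^3$ with $\mathbb Z$-bases $(x_1,x_2,x_3)$ resp. $(y_1,y_2,y_3)$, and let $f_1,f_2,f_3:M_1\to M_2$ be the $\mathbb Z$-linear maps with $$\bigl(f_j(x_i)\bigr)_{1\le i,j\le 3}=\begin{pmatrix} Dy_3&y_1&y_2\\ y_1&y_3&0\\ y_2&0&y_1\end{pmatrix}.$$ Let $V=((M_1,M_2),(f_1,f_2,f_3))$ be the resulting $\mathbb Z$-representation of the Kronecker quiver $\mathsf K_3$ (the determinant of the matrix defines, up to $X\mapsto -X$, the elliptic curve $E: Y^2=X^3-DX$). For a compact discrete valuation ring $\mathfrak o$ put $V(\mathfrak o)=V\otimes_{\mathbb Z}\mathfrak o$, let $a_m(V(\mathfrak o))$ be the number of pairs $(\Lambda_1,\Lambda_2)$ of finite-index $\mathfrak o$-submodules $\Lambda_1\le M_1\otimes\mathfrak o$, $\Lambda_2\le M_2\otimes\mathfrak o$ with $f_j(\Lambda_1)\le\Lambda_2$ for $j=1,2,3$ and $|M_1\otimes\mathfrak o:\Lambda_1|\,|M_2\otimes\mathfrak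 o:\Lambda_2|=m$, and let $\zeta_{V(\mathfrak o)}(s)=\sum_{m\ge1}a_m(V(\mathfrak o))m^{-s}$. Let $\mathfrak o$ be a compact discrete valuation ring with residue field of cardinality $q$, where $(q,2D)=1$. Then all the numbers $a_m(V(\mathfrak o))$ are finite and, for $\mathrm{Re}(s)>6$, where the series converges absolutely, $$\zeta_{V(\mathfrak o)}(s)=W_1(q,q^{-s})+|E(\mathbb F_q)|\,W_2(q,q^{-s}),$$ where $E(\mathbb F_q)$ includes the point at infinity and $$W_1(q,t)=\frac{1+(q+1)(t^4+t^5)+qt^9}{(1-t)(1-qt)(1-q^2t)(1-q^2t^4)(1-q^2t^5)(1-t^6)},$$ $$W_2(q,t)=\frac{(1-t)\,t^3\,(1+qt^5)}{(1-t)(1-qt)(1-q^2t)(1-q^2t^4)(1-q^2t^5)(1-qt^3)(1-t^6)}.$$ In particular, for these rings $\mathfrak o$, the following functional equation holds: $$\zeta_{V(\mathfrak o)}(s)\big|_{q\to q^{-1}}=q^{\binom32+\binom32-(6+3)s}\,\zeta_{V(\mathfrak o)}(s)=q^{6-9s}\,\zeta_{V(\mathfrak o)}(s).$$ Here the operation $q\to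 q^{-1}$ is defined as follows. Consider any formula $\sum_{i} N_i(f)\,W_i(q^f,t)$ with finitely many rational functions $W_i\in\mathbb Q(X,Y)$, whose denominators do not vanish identically in $Y$ at $X=q^f$ for $f\ge1$ and $f=-1$, and with $N_i(f)=\sum_\lambda m_{i,\lambda}\lambda^f$ finite integral linear combinations of powers of non-zero complex numbers (as are the numbers of $\mathbb F_{q^f}$-rational points of varieties over $\mathbb F_q$, the $\lambda$ being Frobenius eigenvalues), such that for all $f\ge1$ and all compact discrete valuation rings $\mathfrak O$ with residue field of cardinality $q^f$ one has $\zeta_{V(\mathfrak O)}(s)=\sum_i N_i(f)W_i(q^f,q^{-fs})$. Then $\zeta_{V(\mathfrak o)}(s)|_{q\to q^{-1}}:=\sum_i N_i(-1)\,W_i(q^{-1},t^{-1})$ with $t=q^{-s}$. Part of the claim is that such a formula exists and that the result does not depend on its choice. -/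

import Mathlib

universe u v w x y

noncomputable section

/-- An `R`-representation of a quiver with vertex set `Q`: a family of `R`-modules indexed by
the vertices and a family of `R`-linear maps indexed by the arrows. -/
structure QuiverRep (R : Type u) [CommRing R] (Q : Type v) [Quiver.{w} Q] where
  L : Q → Type x
  [addCommGroup : ∀ i, AddCommGroup (L i)]
  [module : ∀ i, Module R (L i)]
  f : ∀ {i j : Q}, (i ⟶ j) → (L i →ₗ[R] L j)

attribute [instance] QuiverRep.addCommGroup QuiverRep.module

namespace QuiverRep

/-- Extension of scalars `V(S) = V ⊗_R S`. -/
def baseChange {R : Type u} [CommRing R] {Q : Type v} [Quiver.{w} Q]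
    (V : QuiverRep.{u, v, w, x} R Q) (S : Type y) [CommRing S] [Algebra R S] :
    QuiverRep.{y, v, w, max x y} S Q where
  L i := TensorProduct R S (V.L i)
  f φ := (V.f φ).baseChange S

/-- A subrepresentation: a family of submodules that is mapped into itself by the arrows. -/
structure Subrep {R : Type u} [CommRing R] {Q : Type v} [Quiver.{w} Q]
    (V : QuiverRep.{u, v, w, x} R Q) where
  carrier : ∀ i, Submodule R (V.L i)
  map_le : ∀ {i j : Q} (φ : i ⟶ j), (carrier i).map (V.f φ) ≤ carrier j

/-- A subrepresentation has finite index if it has so at every vertex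
(`AddSubgroup.index` is `0` for subgroups of infinite index). -/
def Subrep.FiniteIndex {R : Type u} [CommRing R] {Q : Type v} [Quiver.{w} Q]
    {V : QuiverRep.{u, v, w, x} R Q} (V' : V.Subrep) : Prop :=
  ∀ i, (V'.carrier i).toAddSubgroup.index ≠ 0

/-- The index `|V : V'|`, the product of the indices at all vertices. -/
def Subrep.index {R : Type u} [CommRing R] {Q : Type v} [Quiver.{w} Q] [Fintype Q]
    {V : QuiverRep.{u, v, w, x} R Q} (V' : V.Subrep) : ℕ :=
  ∏ i, (V'.carrier i).toAddSubgroup.index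

/-- The set of finite-index subrepresentations of index `m`. -/
def subrepsOfIndex {R : Type u} [CommRing R] {Q : Type v} [Quiver.{w} Q] [Fintype Q]
    (V : QuiverRep.{u, v, w, x} R Q) (m : ℕ) : Set V.Subrep :=
  {V' | V'.FiniteIndex ∧ V'.index = m}

/-- `a_m(V)`, the number of subrepresentations of index `m`, as a complex number. The univariate
zeta function of `V` is the Dirichlet series `∑ a_m(V) m^{-s}`. -/
def zetaCoeff {R : Type u} [CommRing R] {Q : Type v} [Quiver.{w} Q] [Fintype Q]
    (V : QuiverRep.{u, v, w, x} R Q) (m : ℕ) : ℂ :=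
  ((V.subrepsOfIndex m).ncard : ℂ)

/-- `ζ_V(s) = Z(q^{-s})` on some right half-plane, for a rational function `Z` in one variable.
Denominators are cleared, so that the equation involves no division; as `q^{-s}` takes infinitely
many values (for `q ≥ 2`), it determines `Z`. -/
def ZetaEqRational {R : Type u} [CommRing R] {Q : Type v} [Quiver.{w} Q] [Fintype Q]
    (V : QuiverRep.{u, v, w, x} R Q) (q : ℕ) (Z : RatFunc ℂ) : Prop :=
  ∃ r : ℝ, ∀ s : ℂ, r < s.re →
    LSeriesSummable V.zetaCoeff s ∧
      LSeries V.zetaCoeff s * Z.denom.eval ((q : ℂ) ^ (-s)) = Z.num.eval ((q : ℂ) ^ (-s))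

end QuiverRep

/-! ### Denef-type formulae and the operation `q → q⁻¹` -/

/-- The value at `f ∈ ℤ` of the exponential sum `f ↦ ∑_λ m_λ λ^f`, a finite sum with integer
multiplicities `m_λ` over nonzero complex numbers `λ`. For `f ≥ 1` the numbers of
`𝔽_{q^f}`-rational points of a variety over `𝔽_q` are of this form, the `λ` being the Frobenius
eigenvalues; the value at `f = -1` is what one gets from the value at `f = 1` when all
eigenvalues are inverted. -/
def powerSum (m : ℂˣ →₀ ℤ) (f : ℤ) : ℂ :=
  m.sum fun l c => (c : ℂ) * ((l ^ f : ℂˣ) : ℂ)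

/-- The value of a polynomial `P ∈ ℚ[X][Y]` at `X = a ∈ ℂ` and `Y = b`, a rational function in
one variable. -/
def evalXY (P : Polynomial (Polynomial ℚ)) (a : ℂ) (b : RatFunc ℂ) : RatFunc ℂ :=
  P.eval₂ ((RatFunc.C : ℂ →+* RatFunc ℂ).comp
    (Polynomial.aeval a : Polynomial ℚ →ₐ[ℚ] ℂ).toRingHom) b

/-- A Denef-type formula: a finite sum `∑ᵢ Nᵢ · Wᵢ(X, Y)`, with rational functions
`Wᵢ = numᵢ / denᵢ ∈ ℚ(X, Y)` and with numbers `Nᵢ` that are alternating sums of (powers of)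
Frobenius eigenvalues. -/
structure DenefFormula where
  n : ℕ
  eig : Fin n → (ℂˣ →₀ ℤ)
  num : Fin n → Polynomial (Polynomial ℚ)
  den : Fin n → Polynomial (Polynomial ℚ)

namespace DenefFormula

/-- The value of the formula over the extension of degree `f` of `𝔽_q`: eigenvalues are raised to
the `f`-th power and `X = q^f`. The case `f = -1` is the inversion of `q` and of the eigenvalues. -/
def value (𝓓 : DenefFormula) (q : ℕ) (f : ℤ) (b : RatFunc ℂ) : RatFunc ℂ :=
  ∑ i, RatFunc.C (powerSum (𝓓.eig i) f) *
    (evalXY (𝓓.num i) ((q : ℂ) ^ f) b / evalXY (𝓓.den i) ((q : ℂ) ^ f) b)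

/-- All the denominators survive the substitutions `X = q^f`, for `f ≥ 1` and for `f = -1`. -/
def Regular (𝓓 : DenefFormula) (q : ℕ) : Prop :=
  ∀ i, ∀ f : ℤ, (1 ≤ f ∨ f = -1) → evalXY (𝓓.den i) ((q : ℂ) ^ f) RatFunc.X ≠ 0

end DenefFormula

/-- `Z'`, a rational function of `t = q^{-s}`, is the result of the operation `q → q⁻¹`
(which includes `t → t⁻¹`) on the local zeta functions of the `ℤ`-representation `V` at residue
field cardinality `q`: there is a Denef-type formula that computes `ζ_{V(𝔒)}` for all complete
discrete valuation rings `𝔒` with residue field of cardinality `q^f`, for all `f ≥ 1`, and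
inverting `q`, the Frobenius eigenvalues and `t` in it yields `Z'`. -/
def IsInversionOfZeta {Q : Type v} [Quiver.{w} Q] [Fintype Q]
    (V : QuiverRep.{0, v, w, x} ℤ Q) (q : ℕ) (Z' : RatFunc ℂ) : Prop :=
  ∃ 𝓓 : DenefFormula, 𝓓.Regular q ∧
    (∀ f : ℕ, 1 ≤ f → ∀ (O : Type y) [CommRing O] [IsDomain O] [IsDiscreteValuationRing O]
      [IsAdicComplete (IsLocalRing.maximalIdeal O) O],
      Nat.card (IsLocalRing.ResidueField O) = q ^ f →
        (V.baseChange O).ZetaEqRational (q ^ f) (𝓓.value q f RatFunc.X)) ∧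
    Z' = 𝓓.value q (-1) RatFunc.X⁻¹

/-! ### The representation of the Kronecker quiver -/

/-- The vertices of the Kronecker quiver with `n` arrows. -/
inductive KroneckerQuiver (n : ℕ) : Type
  | src
  | tgt
  deriving DecidableEq, Fintype

namespace KroneckerQuiver

/-- There are `n` arrows from `src` to `tgt` and no other arrows. -/
instance (n : ℕ) : Quiver.{0} (KroneckerQuiver n) where
  Hom i j := match i, j with
    | src, tgt => Fin n
    | _, _ => Empty

end KroneckerQuiver

/-- The matrix `𝓜(y)`, with entries in `ℤ³ = ⟨y₁, y₂, y₃⟩`; its `(i, j)`-entry is `f_j(x_i)`. -/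
def ellMatrix (D : ℤ) : Matrix (Fin 3) (Fin 3) (Fin 3 → ℤ) :=
  let y₁ : Fin 3 → ℤ := Pi.single 0 1
  let y₂ : Fin 3 → ℤ := Pi.single 1 1
  let y₃ : Fin 3 → ℤ := Pi.single 2 1
  !![D • y₃, y₁, y₂;
     y₁, y₃, 0;
     y₂, 0, y₁]

/-- The representation `((ℤ³, ℤ³), (f₁, f₂, f₃))` of the Kronecker quiver with three arrows,
where `f_j` maps the basis vector `x_i` to `𝓜(y)_{ij}`. -/
def ellRep (D : ℤ) : QuiverRep.{0, 0, 0, 0} ℤ (KroneckerQuiver 3) where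
  L _ := Fin 3 → ℤ
  f {i j} φ := match i, j, φ with
    | .src, .tgt, k => Fintype.linearCombination ℤ fun i => ellMatrix D i (show Fin 3 from k)
    | .src, .src, k => k.elim
    | .tgt, .src, k => k.elim
    | .tgt, .tgt, k => k.elim

/-- The curve `Y² = X³ - D X` over a commutative ring `k`. -/
def ellCurve (D : ℤ) (k : Type u) [CommRing k] : WeierstrassCurve k where
  a₁ := 0
  a₂ := 0
  a₃ := 0
  a₄ := -(D : k)
  a₆ := 0

/-- The number `|E(k)|` of `k`-rational points of `Y² = X³ - D X`, including the point at infinity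
(all points are nonsingular if `2D` is invertible in `k`). -/
def ellCard (D : ℤ) (k : Type u) [Field k] : ℕ :=
  Nat.card (ellCurve D k).toAffine.Point

/-- The rational function `W₁(q, t)`. -/
def W₁ {K : Type u} [Field K] (q t : K) : K :=
  (1 + (q + 1) * (t ^ 4 + t ^ 5) + q * t ^ 9) /
    ((1 - t) * (1 - q * t) * (1 - q ^ 2 * t) * (1 - q ^ 2 * t ^ 4) * (1 - q ^ 2 * t ^ 5) *
      (1 - t ^ 6))

/-- The rational function `W₂(q, t)`. -/
def W₂ {K : Type u} [Field K] (q t : K) : K :=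
  ((1 - t) * t ^ 3 * (1 + q * t ^ 5)) /
    ((1 - t) * (1 - q * t) * (1 - q ^ 2 * t) * (1 - q ^ 2 * t ^ 4) * (1 - q ^ 2 * t ^ 5) *
      (1 - q * t ^ 3) * (1 - t ^ 6))

end

open IsLocalRing Module

set_option linter.unusedSectionVars false

noncomputable section

/-! ### Lattices in `O³` and the fibres of `Λ ↦ (Λ : ϖ)` -/

section Lattices

variable {O : Type*} [CommRing O] [IsDomain O] [IsDiscreteValuationRing O]

/-! Write `t = q⁻ˢ` and `k` for the residue field. A finite-index subrepresentation is a pair of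
lattices `Λ₁, Λ₂` in `O³` with `Λ₁` inside `ellPre D Λ₂`, the largest lattice that the three arrows
map into `Λ₂`. That lattice is again free of rank 3. So the zeta function is the product of the zeta
function of `O³`, namely `1 / ((1 - t)(1 - qt)(1 - q²t))`, and the sum of `t ^ ellLen D Λ` over all
lattices `Λ`, where `ellLen` adds the lengths of `O³/Λ` and `O³/ellPre D Λ`.

Both sums are computed by recursion along `Λ ↦ (Λ : ϖ)`, which commutes with `ellPre`. If `(Λ : ϖ)`
is the image of an injective `g`, then `Λ` corresponds to a subspace `U` of `k³` that meets the
kernel of `g` mod `ϖ` trivially, and `dim U` is the rank of `Λ` mod `ϖ`. Rank 3 means `Λ = O³`. In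
ranks 0 and 1 the weight is multiplied by a constant at each step, so that first-order linear
recursions reduce everything to rank 2 (`hasSum_latLevel`).

Lattices of rank 2 are the sets `φ · y ≡ 0 mod ϖⁿ` with `φ` primitive, unique up to units
(`resSum_dotLat`). Membership in `ellPre` of such a lattice is a symmetric linear system modulo
`ϖⁿ`, of determinant the cubic form `ellForm D φ` and of rank at least two mod `ϖ`. Hence the
exponent grows by 3 if `ϖⁿ` divides `ellForm D φ` and by 4 otherwise (`ellLen_dotLat_succ`). The
cubic is smooth because `2D` is a unit, so the solutions are counted by Hensel lifting
(`natCard_hensel`) from the `|E(k)|` projective points over `k`.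

The functional equation is an identity of rational functions once inversion turns `N = |E(k)|` into
`N / q`. This holds because the numbers of points over the extensions are `q^f + 1 - α^f - β^f` with
`αβ = q` (`exists_ellCard_eq`). The proof is elementary: the sums of the quadratic character at `x³
- Dx` are the coefficients of the logarithmic derivative of the `L`-series of a multiplicative
function on monic polynomials, and orthogonality shows that this series is `1 + L₁T + qT²`.

Independence of the formula rests on the linear independence of characters: an exponential sum is
determined by its values at `f ≥ 1`, hence so is its value at `f = -1`. Power series rings over
finite fields show that every `f ≥ 1` occurs. -/

instance ringHomSurjective_residue (R : Type*) [CommRing R] [IsLocalRing R] :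
    RingHomSurjective (residue R) := ⟨residue_surjective⟩

/-- Coordinatewise reduction `O³ → k³` to the residue field. -/
def redVec (O : Type*) [CommRing O] [IsLocalRing O] :
    (Fin 3 → O) →ₛₗ[residue O] (Fin 3 → ResidueField O) where
  toFun x i := residue O (x i)
  map_add' x y := by ext; simp
  map_smul' c x := by ext; simp

@[simp] lemma redVec_apply {O : Type*} [CommRing O] [IsLocalRing O] (x : Fin 3 → O) (i : Fin 3) :
    redVec O x i = residue O (x i) := rfl

lemma redVec_surjective : Function.Surjective (redVec O) := by
  intro y
  choose f hf using fun i => residue_surjective (y i)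
  exact ⟨f, funext hf⟩

lemma residue_eq_zero_iff_dvd {ϖ : O} (hϖ : Irreducible ϖ) (x : O) :
    residue O x = 0 ↔ ϖ ∣ x := by
  rw [residue_eq_zero_iff, hϖ.maximalIdeal_eq, Ideal.mem_span_singleton]

lemma isUnit_iff_residue_ne_zero (x : O) : IsUnit x ↔ residue O x ≠ 0 :=
  (residue_ne_zero_iff_isUnit x).symm

lemma redVec_eq_zero_iff {ϖ : O} (hϖ : Irreducible ϖ) (x : Fin 3 → O) :
    redVec O x = 0 ↔ ∃ y, x = ϖ • y := by
  constructor
  · intro h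
    choose y hy using fun i => (residue_eq_zero_iff_dvd hϖ (x i)).1 (congrFun h i)
    exact ⟨y, funext hy⟩
  · rintro ⟨y, rfl⟩
    ext i
    simp [residue_eq_zero_iff_dvd hϖ]

/-- `{y : ϖ y ∈ Λ}`. -/
def latColon (ϖ : O) (Λ : Submodule O (Fin 3 → O)) : Submodule O (Fin 3 → O) :=
  Λ.comap (LinearMap.lsmul O (Fin 3 → O) ϖ)

@[simp] lemma mem_latColon {ϖ : O} {Λ : Submodule O (Fin 3 → O)} {y : Fin 3 → O} :
    y ∈ latColon ϖ Λ ↔ ϖ • y ∈ Λ := Iff.rfl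

/-- `Λ` contains `ϖⁿ O³` for some `n`. -/
def IsLat (ϖ : O) (Λ : Submodule O (Fin 3 → O)) : Prop := ∃ n : ℕ, ∀ y, ϖ ^ n • y ∈ Λ

lemma IsLat.colon {ϖ : O} {Λ : Submodule O (Fin 3 → O)} (h : IsLat ϖ Λ) :
    IsLat ϖ (latColon ϖ Λ) := by
  obtain ⟨n, hn⟩ := h
  exact ⟨n, fun y => Λ.smul_mem ϖ (hn y)⟩

lemma isLat_of_latColon {ϖ : O} {Λ : Submodule O (Fin 3 → O)} (h : IsLat ϖ (latColon ϖ Λ)) :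
    IsLat ϖ Λ := by
  obtain ⟨n, hn⟩ := h
  refine ⟨n + 1, fun y => ?_⟩
  rw [pow_succ', mul_smul]
  exact hn y

/-- Submodules of `O³` are free over the principal ideal domain `O`, and containing `ϖⁿO³` forces
rank 3. Every lattice can thus be treated as a copy of `O³`. -/
lemma IsLat.exists_injective_range {ϖ : O} (hϖ : Irreducible ϖ) {Λ : Submodule O (Fin 3 → O)}
    (h : IsLat ϖ Λ) :
    ∃ g : (Fin 3 → O) →ₗ[O] (Fin 3 → O), Function.Injective g ∧ LinearMap.range g = Λ := by
  obtain ⟨n, hn⟩ := h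
  have hfin : finrank O Λ = 3 := by
    apply le_antisymm
    · simpa using Submodule.finrank_le Λ
    · let j : (Fin 3 → O) →ₗ[O] Λ :=
        LinearMap.codRestrict Λ (LinearMap.lsmul O (Fin 3 → O) (ϖ ^ n)) hn
      have hj : Function.Injective j := by
        intro a b hab
        have : ϖ ^ n • a = ϖ ^ n • b := congrArg Subtype.val hab
        exact smul_right_injective _ (pow_ne_zero n hϖ.ne_zero) this
      simpa using LinearMap.finrank_le_finrank_of_injective hj
  let b : Basis (Fin 3) O Λ := Module.finBasisOfFinrankEq O Λ hfin
  refine ⟨Λ.subtype ∘ₗ b.equivFun.symm.toLinearMap, ?_, ?_⟩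
  · exact Subtype.val_injective.comp b.equivFun.symm.injective
  · rw [LinearMap.range_comp, LinearEquiv.range, Submodule.map_top, Submodule.range_subtype]

/-- The reduction of an endomorphism of `O³`. -/
def redMap (g : (Fin 3 → O) →ₗ[O] (Fin 3 → O)) :
    (Fin 3 → ResidueField O) →ₗ[ResidueField O] (Fin 3 → ResidueField O) :=
  Matrix.toLin' ((LinearMap.toMatrix' g).map (residue O))

lemma redMap_redVec (g : (Fin 3 → O) →ₗ[O] (Fin 3 → O)) (x : Fin 3 → O) :
    redMap g (redVec O x) = redVec O (g x) := by
  ext i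
  rw [redVec_apply, LinearMap.pi_apply_eq_sum_univ g x]
  simp [redMap, Matrix.toLin'_apply, Matrix.mulVec, dotProduct, LinearMap.toMatrix'_apply, mul_comm]
  refine Finset.sum_congr rfl fun j _ => ?_
  have h1 : (Pi.single j 1 : Fin 3 → O) = fun l => if j = l then 1 else 0 := by
    ext l
    simp [Pi.single_apply, eq_comm]
  rw [h1]

lemma map_redVec_range (g : (Fin 3 → O) →ₗ[O] (Fin 3 → O)) :
    (LinearMap.range g).map (redVec O) = LinearMap.range (redMap g) := by
  ext y
  constructor
  · rintro ⟨_, ⟨x, rfl⟩, rfl⟩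
    exact ⟨redVec O x, redMap_redVec g x⟩
  · rintro ⟨z, rfl⟩
    obtain ⟨x, rfl⟩ := redVec_surjective z
    exact ⟨g x, ⟨x, rfl⟩, (redMap_redVec g x).symm⟩

/-- The sublattice of the image of `g` given by a subspace of `k³`. -/
def latOfSubspace (g : (Fin 3 → O) →ₗ[O] (Fin 3 → O))
    (U : Submodule (ResidueField O) (Fin 3 → ResidueField O)) : Submodule O (Fin 3 → O) :=
  (U.comap (redVec O)).map g

lemma map_latOfSubspace (g : (Fin 3 → O) →ₗ[O] (Fin 3 → O))
    (U : Submodule (ResidueField O) (Fin 3 → ResidueField O)) :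
    (latOfSubspace g U).map (redVec O) = U.map (redMap g) := by
  ext y
  constructor
  · rintro ⟨_, ⟨x, hx, rfl⟩, rfl⟩
    exact ⟨redVec O x, hx, redMap_redVec g x⟩
  · rintro ⟨z, hz, rfl⟩
    obtain ⟨x, rfl⟩ := redVec_surjective z
    exact ⟨g x, ⟨x, hz, rfl⟩, (redMap_redVec g x).symm⟩

/-- If `ϖ y = g x` with `x` reducing into `U`, then the reduction of `x` lies in `U ∩ ker = 0`; so
`x = ϖ z` and `y = g z`. -/
lemma latColon_latOfSubspace {ϖ : O} (hϖ : Irreducible ϖ) {g : (Fin 3 → O) →ₗ[O] (Fin 3 → O)}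
    {U : Submodule (ResidueField O) (Fin 3 → ResidueField O)}
    (hU : Disjoint U (LinearMap.ker (redMap g))) :
    latColon ϖ (latOfSubspace g U) = LinearMap.range g := by
  ext y
  rw [mem_latColon]
  constructor
  · rintro ⟨x, hx, hxy⟩
    have h0 : redVec O x = 0 := by
      refine (Submodule.disjoint_def.1 hU) _ hx ?_
      rw [LinearMap.mem_ker, redMap_redVec, redVec_eq_zero_iff hϖ]
      exact ⟨y, hxy⟩
    obtain ⟨z, rfl⟩ := (redVec_eq_zero_iff hϖ x).1 h0
    rw [map_smul] at hxy
    exact ⟨z, smul_right_injective _ hϖ.ne_zero hxy⟩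
  · rintro ⟨z, rfl⟩
    refine ⟨ϖ • z, ?_, map_smul g ϖ z⟩
    have : redVec O (ϖ • z) = 0 := (redVec_eq_zero_iff hϖ _).2 ⟨z, rfl⟩
    simp [this]

/-- As `ϖ · range g ⊆ Λ ⊆ range g`, the lattice is determined by its image in `range g / ϖ range g ≅
k³`. -/
lemma eq_latOfSubspace {ϖ : O} (hϖ : Irreducible ϖ) {g : (Fin 3 → O) →ₗ[O] (Fin 3 → O)}
    (hg : Function.Injective g) {Λ : Submodule O (Fin 3 → O)}
    (hΛ : latColon ϖ Λ = LinearMap.range g) :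
    ∃ U, Disjoint U (LinearMap.ker (redMap g)) ∧ latOfSubspace g U = Λ := by
  refine ⟨(Λ.comap g).map (redVec O), ?_, ?_⟩
  · rw [Submodule.disjoint_def]
    rintro _ ⟨x, hx, rfl⟩ h0
    rw [LinearMap.mem_ker, redMap_redVec, redVec_eq_zero_iff hϖ] at h0
    obtain ⟨y, hy⟩ := h0
    have hy' : y ∈ latColon ϖ Λ := by
      rw [mem_latColon, ← hy]; exact hx
    rw [hΛ] at hy'
    obtain ⟨z, rfl⟩ := hy'
    rw [← map_smul] at hy
    rw [hg hy, redVec_eq_zero_iff hϖ]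
    exact ⟨z, rfl⟩
  · ext y
    constructor
    · rintro ⟨x, ⟨x', hx', hxx'⟩, rfl⟩
      have : redVec O (x - x') = 0 := by rw [map_sub, hxx', sub_self]
      obtain ⟨z, hz⟩ := (redVec_eq_zero_iff hϖ _).1 this
      have hz' : g z ∈ latColon ϖ Λ := hΛ ▸ ⟨z, rfl⟩
      rw [mem_latColon, ← map_smul, ← hz, map_sub] at hz'
      exact (Submodule.sub_mem_iff_left Λ hx').1 hz'
    · intro hy
      have : y ∈ latColon ϖ Λ := Λ.smul_mem ϖ hy
      rw [hΛ] at this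
      obtain ⟨x, rfl⟩ := this
      exact ⟨x, ⟨x, hy, rfl⟩, rfl⟩

lemma latOfSubspace_injective {g : (Fin 3 → O) →ₗ[O] (Fin 3 → O)} (hg : Function.Injective g) :
    Function.Injective (latOfSubspace g) := by
  intro U V h
  exact Submodule.comap_injective_of_surjective redVec_surjective
    (Submodule.map_injective_of_injective hg h)

lemma finrank_map_of_disjoint_ker {F V W : Type*} [Field F] [AddCommGroup V] [Module F V]
    [AddCommGroup W] [Module F W] [FiniteDimensional F V] (h : V →ₗ[F] W) {U : Submodule F V}
    (hU : Disjoint U (LinearMap.ker h)) : finrank F (U.map h) = finrank F U := by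
  have hinj : Function.Injective (h.domRestrict U) := by
    rw [← LinearMap.ker_eq_bot, LinearMap.ker_eq_bot']
    intro x hx
    exact Subtype.ext ((Submodule.disjoint_def.1 hU) _ x.2 hx)
  rw [← LinearMap.finrank_range_of_inj hinj, LinearMap.range_domRestrict]

/-- The dimension of the image of a lattice in `k³`. -/
def latRank (Λ : Submodule O (Fin 3 → O)) : ℕ := finrank (ResidueField O) (Λ.map (redVec O))

lemma latRank_le (Λ : Submodule O (Fin 3 → O)) : latRank Λ ≤ 3 := by
  simpa [latRank] using Submodule.finrank_le (Λ.map (redVec O))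

lemma natCard_latColon_eq {ϖ : O} (hϖ : Irreducible ϖ) {g : (Fin 3 → O) →ₗ[O] (Fin 3 → O)}
    (hg : Function.Injective g) (d : ℕ) :
    Nat.card {Λ : Submodule O (Fin 3 → O) // latColon ϖ Λ = LinearMap.range g ∧ latRank Λ = d} =
      Nat.card {U : Submodule (ResidueField O) (Fin 3 → ResidueField O) //
        Disjoint U (LinearMap.ker (redMap g)) ∧ finrank (ResidueField O) U = d} := by
  symm
  refine Nat.card_eq_of_bijective (fun U => ⟨latOfSubspace g U.1,
    latColon_latOfSubspace hϖ U.2.1, ?_⟩) ⟨?_, ?_⟩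
  · rw [latRank, map_latOfSubspace, finrank_map_of_disjoint_ker _ U.2.1, U.2.2]
  · intro U V h
    exact Subtype.ext (latOfSubspace_injective hg (congrArg Subtype.val h))
  · rintro ⟨Λ, h1, h2⟩
    obtain ⟨U, hU, rfl⟩ := eq_latOfSubspace hϖ hg h1
    refine ⟨⟨U, hU, ?_⟩, rfl⟩
    rw [← h2, latRank, map_latOfSubspace, finrank_map_of_disjoint_ker _ hU]

lemma finrank_ker_redMap_add (g : (Fin 3 → O) →ₗ[O] (Fin 3 → O)) :
    latRank (LinearMap.range g) + finrank (ResidueField O) (LinearMap.ker (redMap g)) = 3 := by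
  rw [latRank, map_redVec_range, LinearMap.finrank_range_add_finrank_ker]
  simp

/-- The number of lines that avoid a given subspace. -/
lemma natCard_lines_disjoint {F V : Type*} [Field F] [Finite F] [AddCommGroup V] [Module F V]
    [FiniteDimensional F V] (K : Submodule F V) :
    Nat.card {U : Submodule F V // Disjoint U K ∧ finrank F U = 1} * (Nat.card F - 1) +
      Nat.card F ^ finrank F K = Nat.card F ^ finrank F V := by
  classical
  have : Finite V := Module.finite_of_finite F
  have hcard (W : Submodule F V) : Nat.card W = Nat.card F ^ finrank F W :=
    Module.natCard_eq_pow_finrank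
  -- Each vector outside `K` spans exactly one line that avoids `K`, and each such line carries `|F|
  -- - 1` nonzero vectors.
  let e : (Σ U : {U : Submodule F V // Disjoint U K ∧ finrank F U = 1}, {v : V // v ∈ U.1 ∧ v ≠ 0})
      → {v : V // v ∉ K} := fun p => ⟨p.2.1, fun h =>
        p.2.2.2 (Submodule.disjoint_def.1 p.1.2.1 _ p.2.2.1 h)⟩
  have hspan (U : Submodule F V) (hU : finrank F U = 1) (v : V) (hv : v ∈ U) (h0 : v ≠ 0) :
      U = Submodule.span F {v} := by
    symm
    apply Submodule.eq_of_le_of_finrank_eq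
    · simpa using hv
    · rw [hU, finrank_span_singleton h0]
  have he : Function.Bijective e := by
    constructor
    · rintro ⟨⟨U, hU⟩, v, hv⟩ ⟨⟨U', hU'⟩, v', hv'⟩ h
      obtain rfl : v = v' := congrArg Subtype.val h
      obtain rfl : U = U' :=
        (hspan U hU.2 v hv.1 hv.2).trans (hspan U' hU'.2 v hv'.1 hv'.2).symm
      rfl
    · rintro ⟨v, hv⟩
      have h0 : v ≠ 0 := fun h => hv (h ▸ K.zero_mem)
      refine ⟨⟨⟨Submodule.span F {v}, ?_, finrank_span_singleton h0⟩, v,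
        Submodule.mem_span_singleton_self v, h0⟩, rfl⟩
      exact (Submodule.disjoint_span_singleton' h0).2 hv |>.symm
  have h1 := Nat.card_eq_of_bijective e he
  have h2 (U : {U : Submodule F V // Disjoint U K ∧ finrank F U = 1}) :
      Nat.card {v : V // v ∈ U.1 ∧ v ≠ 0} = Nat.card F - 1 := by
    have h3 : Nat.card U.1 = Nat.card F := by rw [hcard, U.2.2, pow_one]
    rw [← h3, show Nat.card {v : V // v ∈ U.1 ∧ v ≠ 0} =
      Nat.card ((U.1 : Set V) \ {0} : Set V) from rfl]
    rw [Nat.card_coe_set_eq, Set.ncard_sdiff_singleton_of_mem U.1.zero_mem]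
    rfl
  have := Fintype.ofFinite {U : Submodule F V // Disjoint U K ∧ finrank F U = 1}
  rw [Nat.card_sigma] at h1
  simp only [h2, Finset.sum_const, smul_eq_mul, Finset.card_univ, ← Nat.card_eq_fintype_card] at h1
  rw [h1, ← hcard K, ← Module.natCard_eq_pow_finrank (K := F) (V := V), add_comm]
  have := Set.ncard_add_ncard_compl (K : Set V)
  rwa [← Nat.card_coe_set_eq, ← Nat.card_coe_set_eq] at this

/-! ### Indices -/

lemma index_comap_redVec [Finite (ResidueField O)]
    (U : Submodule (ResidueField O) (Fin 3 → ResidueField O)) :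
    (U.comap (redVec O)).toAddSubgroup.index =
      Nat.card (ResidueField O) ^ (3 - finrank (ResidueField O) U) := by
  have h1 : (U.comap (redVec O)).toAddSubgroup =
      U.toAddSubgroup.comap (redVec O).toAddMonoidHom := rfl
  have hs : Function.Surjective (redVec O).toAddMonoidHom := redVec_surjective
  rw [h1, AddSubgroup.index_comap_of_surjective _ hs]
  have h2 : Nat.card U * U.toAddSubgroup.index = Nat.card (Fin 3 → ResidueField O) :=
    AddSubgroup.card_mul_index U.toAddSubgroup
  rw [Module.natCard_eq_pow_finrank (K := ResidueField O) (V := U),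
    Module.natCard_eq_pow_finrank (K := ResidueField O) (V := Fin 3 → ResidueField O),
    Module.finrank_fin_fun] at h2
  have hle : finrank (ResidueField O) U ≤ 3 := by simpa using Submodule.finrank_le U
  have hpos : 0 < Nat.card (ResidueField O) := Nat.card_pos
  apply Nat.eq_of_mul_eq_mul_left (pow_pos hpos (finrank (ResidueField O) U))
  rw [h2, ← pow_add]
  congr 1
  omega

lemma index_map_of_injective {g : (Fin 3 → O) →ₗ[O] (Fin 3 → O)} (hg : Function.Injective g)
    (N : Submodule O (Fin 3 → O)) :
    (N.map g).toAddSubgroup.index =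
      N.toAddSubgroup.index * (LinearMap.range g).toAddSubgroup.index := by
  have h1 : (N.map g).toAddSubgroup = N.toAddSubgroup.map g.toAddMonoidHom := rfl
  have h2 : (LinearMap.range g).toAddSubgroup = g.toAddMonoidHom.range := by
    ext; simp
  have h3 : g.toAddMonoidHom.ker = ⊥ := by
    rw [AddMonoidHom.ker_eq_bot_iff]; exact hg
  rw [h1, h2, AddSubgroup.index_map, h3, sup_bot_eq]

/-- Inside `(Λ : ϖ) = range g ≅ O³`, the lattice is the preimage of `U`, whose codimension in `k³`
is `3 - latRank Λ`. -/
lemma IsLat.index_eq [Finite (ResidueField O)] {ϖ : O} (hϖ : Irreducible ϖ)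
    {Λ : Submodule O (Fin 3 → O)} (h : IsLat ϖ Λ) :
    Λ.toAddSubgroup.index =
      Nat.card (ResidueField O) ^ (3 - latRank Λ) * (latColon ϖ Λ).toAddSubgroup.index := by
  obtain ⟨g, hg, hr⟩ := h.colon.exists_injective_range hϖ
  obtain ⟨U, hU, rfl⟩ := eq_latOfSubspace hϖ hg hr.symm
  rw [← hr, latRank, map_latOfSubspace, finrank_map_of_disjoint_ker _ hU, latOfSubspace,
    index_map_of_injective hg, index_comap_redVec]

/-- The fibre consists of the lines that avoid a kernel of dimension `3 - latRank Λ`. The count `(q³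
- q^(3-r))/(q - 1)` is stated without division. -/
lemma natCard_fiber_rank_one [Finite (ResidueField O)] {ϖ : O} (hϖ : Irreducible ϖ)
    {Λ : Submodule O (Fin 3 → O)} (h : IsLat ϖ Λ) :
    Nat.card {Λ' : Submodule O (Fin 3 → O) // latColon ϖ Λ' = Λ ∧ latRank Λ' = 1} *
      (Nat.card (ResidueField O) - 1) + Nat.card (ResidueField O) ^ (3 - latRank Λ) =
      Nat.card (ResidueField O) ^ 3 := by
  obtain ⟨g, hg, rfl⟩ := h.exists_injective_range hϖ
  rw [natCard_latColon_eq hϖ hg]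
  have h1 := natCard_lines_disjoint (LinearMap.ker (redMap g))
  have h2 := finrank_ker_redMap_add g
  rw [show finrank (ResidueField O) (LinearMap.ker (redMap g)) =
    3 - latRank (LinearMap.range g) by omega] at h1
  simpa using h1

/-- The only choice is `U = 0`, which gives `ϖΛ`. -/
lemma natCard_fiber_rank_zero {ϖ : O} (hϖ : Irreducible ϖ)
    {Λ : Submodule O (Fin 3 → O)} (h : IsLat ϖ Λ) :
    Nat.card {Λ' : Submodule O (Fin 3 → O) // latColon ϖ Λ' = Λ ∧ latRank Λ' = 0} = 1 := by
  obtain ⟨g, hg, rfl⟩ := h.exists_injective_range hϖ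
  rw [natCard_latColon_eq hϖ hg, Nat.card_eq_one_iff_unique]
  refine ⟨⟨fun U V => Subtype.ext ?_⟩, ⟨⟨⊥, disjoint_bot_left, finrank_bot _ _⟩⟩⟩
  rw [Submodule.finrank_eq_zero.1 U.2.2, Submodule.finrank_eq_zero.1 V.2.2]

/-- Nakayama's lemma. -/
lemma eq_top_of_latRank {Λ : Submodule O (Fin 3 → O)} (h : latRank Λ = 3) : Λ = ⊤ := by
  have h1 : Λ.map (redVec O) = ⊤ := by
    apply Submodule.eq_top_of_finrank_eq
    simpa [latRank] using h
  obtain ⟨ϖ, hϖ⟩ := IsDiscreteValuationRing.exists_irreducible O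
  rw [eq_top_iff]
  apply Submodule.le_of_le_smul_of_le_jacobson_bot (I := maximalIdeal O) Module.Finite.fg_top
  · rw [jacobson_eq_maximalIdeal ⊥ bot_ne_top]
  · intro x _
    have hx : redVec O x ∈ Λ.map (redVec O) := h1 ▸ Submodule.mem_top
    obtain ⟨y, hy, hxy⟩ := hx
    have : redVec O (x - y) = 0 := by rw [map_sub, hxy, sub_self]
    obtain ⟨z, hz⟩ := (redVec_eq_zero_iff hϖ _).1 this
    rw [← add_sub_cancel y x, hz]
    refine Submodule.add_mem_sup hy (Submodule.smul_mem_smul ?_ Submodule.mem_top)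
    rw [hϖ.maximalIdeal_eq]
    exact Ideal.mem_span_singleton_self ϖ

lemma latRank_top : latRank (⊤ : Submodule O (Fin 3 → O)) = 3 := by
  rw [latRank, Submodule.map_top, LinearMap.range_eq_top.2 redVec_surjective]
  simp

end Lattices

/-- Summation of a sequence that satisfies an inhomogeneous linear recursion of order one. -/
lemma hasSum_of_linear_recursion {𝕜 : Type*} [RCLike 𝕜] {x a : ℕ → 𝕜} {c A : 𝕜}
    (hc : ‖c‖ < 1) (h : ∀ n, x (n + 1) = c * x n + a n) (ha : HasSum a A) :
    HasSum x ((x 0 + A) / (1 - c)) := by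
  have hna : Summable fun n => ‖a n‖ := ha.summable.norm
  -- Summing the norms in the recursion gives `S ≤ ‖x 0‖ + ‖c‖ S + ∑ ‖a n‖` for each partial sum
  -- `S`.
  have hbound : ∀ N, ∑ i ∈ Finset.range N, ‖x i‖ ≤ (‖x 0‖ + ∑' n, ‖a n‖) / (1 - ‖c‖) := by
    intro N
    rw [le_div_iff₀ (by linarith)]
    have h1 : ∑ i ∈ Finset.range N, ‖x i‖ ≤ ∑ i ∈ Finset.range (N + 1), ‖x i‖ :=
      Finset.sum_le_sum_of_subset_of_nonneg (Finset.range_subset_range.2 N.le_succ)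
        fun _ _ _ => norm_nonneg _
    rw [Finset.sum_range_succ'] at h1
    have h2 : ∑ i ∈ Finset.range N, ‖x (i + 1)‖ ≤
        ∑ i ∈ Finset.range N, (‖c‖ * ‖x i‖ + ‖a i‖) := by
      refine Finset.sum_le_sum fun i _ => ?_
      rw [h i, ← norm_mul]
      exact norm_add_le _ _
    rw [Finset.sum_add_distrib, ← Finset.mul_sum] at h2
    have h3 : ∑ i ∈ Finset.range N, ‖a i‖ ≤ ∑' n, ‖a n‖ :=
      hna.sum_le_tsum _ fun _ _ => norm_nonneg _
    linarith
  have hs : Summable x := (summable_of_sum_range_le (fun _ => norm_nonneg _) hbound).of_norm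
  have hX : ∑' n, x n = x 0 + (c * ∑' n, x n + A) := by
    conv_lhs => rw [hs.tsum_eq_zero_add]
    congr 1
    simp_rw [h]
    rw [(hs.mul_left c).tsum_add ha.summable, tsum_mul_left, ha.tsum_eq]
  have h1c : (1 : 𝕜) - c ≠ 0 := by
    intro h0
    rw [sub_eq_zero] at h0
    rw [← h0, norm_one] at hc
    exact lt_irrefl _ hc
  convert hs.hasSum using 1
  rw [div_eq_iff h1c]
  linear_combination -hX

/-! ### Summation over lattices by level and rank -/

section Levels

variable {O : Type*} [CommRing O] [IsDomain O] [IsDiscreteValuationRing O]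

/-- The lattices whose quotient has exponent exactly `ϖⁿ`. -/
def latLevel (ϖ : O) : ℕ → Set (Submodule O (Fin 3 → O))
  | 0 => {⊤}
  | n + 1 => {Λ | latColon ϖ Λ ∈ latLevel ϖ n ∧ Λ ≠ ⊤}

lemma mem_latLevel_zero {ϖ : O} {Λ : Submodule O (Fin 3 → O)} :
    Λ ∈ latLevel ϖ 0 ↔ Λ = ⊤ := Iff.rfl

lemma isLat_of_mem_latLevel {ϖ : O} {n : ℕ} {Λ : Submodule O (Fin 3 → O)}
    (h : Λ ∈ latLevel ϖ n) : IsLat ϖ Λ := by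
  induction n generalizing Λ with
  | zero => rw [mem_latLevel_zero.1 h]; exact ⟨0, fun _ => trivial⟩
  | succ n ih => exact isLat_of_latColon (ih h.1)

lemma exists_mem_latLevel {ϖ : O} {Λ : Submodule O (Fin 3 → O)} (h : IsLat ϖ Λ) :
    ∃ n, Λ ∈ latLevel ϖ n := by
  obtain ⟨n, hn⟩ := h
  induction n generalizing Λ with
  | zero => exact ⟨0, eq_top_iff.2 fun y _ => by simpa using hn y⟩
  | succ n ih =>
    by_cases ht : Λ = ⊤
    · exact ⟨0, ht⟩
    · obtain ⟨m, hm⟩ := ih (Λ := latColon ϖ Λ) fun y => by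
        rw [mem_latColon, ← mul_smul, ← pow_succ']; exact hn y
      exact ⟨m + 1, hm, ht⟩

/-- Since `(⊤ : ϖ) = ⊤`, it is the clause `Λ ≠ ⊤` in the definition that keeps the levels disjoint.
-/
lemma latLevel_unique {ϖ : O} {m n : ℕ} {Λ : Submodule O (Fin 3 → O)}
    (hm : Λ ∈ latLevel ϖ m) (hn : Λ ∈ latLevel ϖ n) : m = n := by
  induction m generalizing n Λ with
  | zero =>
    cases n with
    | zero => rfl
    | succ n => exact absurd hm hn.2
  | succ m ih =>
    cases n with
    | zero => exact absurd hn hm.2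
    | succ n => rw [ih hm.1 hn.1]

variable [Finite (ResidueField O)]

lemma finite_latColon_eq {ϖ : O} (hϖ : Irreducible ϖ) {Λ : Submodule O (Fin 3 → O)}
    (h : IsLat ϖ Λ) : {Λ' | latColon ϖ Λ' = Λ}.Finite := by
  obtain ⟨g, hg, rfl⟩ := h.exists_injective_range hϖ
  refine (Set.finite_range (latOfSubspace g)).subset ?_
  intro Λ' h'
  obtain ⟨U, -, hU⟩ := eq_latOfSubspace hϖ hg h'
  exact ⟨U, hU⟩

lemma finite_latLevel {ϖ : O} (hϖ : Irreducible ϖ) (n : ℕ) : (latLevel ϖ n).Finite := by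
  induction n with
  | zero => exact Set.finite_singleton _
  | succ n ih =>
    refine (ih.biUnion fun Λ hΛ => finite_latColon_eq hϖ (isLat_of_mem_latLevel hΛ)).subset ?_
    intro Λ hΛ
    exact Set.mem_biUnion hΛ.1 rfl

/-- The sum of `W` over the lattices of given level and rank. -/
def levelSum {𝕜 : Type*} [AddCommMonoid 𝕜] (ϖ : O) (W : Submodule O (Fin 3 → O) → 𝕜)
    (r n : ℕ) : 𝕜 := ∑ᶠ Λ ∈ {Λ | Λ ∈ latLevel ϖ n ∧ latRank Λ = r}, W Λ

lemma finite_latLevel_rank {ϖ : O} (hϖ : Irreducible ϖ) (r n : ℕ) :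
    {Λ : Submodule O (Fin 3 → O) | Λ ∈ latLevel ϖ n ∧ latRank Λ = r}.Finite :=
  (finite_latLevel hϖ n).subset fun _ h => h.1

/-- Lattices of level `n + 1` are grouped by `(Λ : ϖ)`, and the size of a fibre depends only on the
rank of its base point. Rank 3 is excluded because the fibre over `⊤` contains `⊤`, which is not of
level `n + 1`. -/
lemma levelSum_fiber {𝕜 : Type*} [Field 𝕜] {ϖ : O} (hϖ : Irreducible ϖ)
    {W : Submodule O (Fin 3 → O) → 𝕜} {r n : ℕ} (hr : r ≠ 3) {y : 𝕜}
    (hW : ∀ Λ, IsLat ϖ Λ → latRank Λ = r → W Λ = y * W (latColon ϖ Λ)) {c : ℕ → 𝕜}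
    (hc : ∀ Λ, IsLat ϖ Λ →
      (Nat.card {Λ' : Submodule O (Fin 3 → O) // latColon ϖ Λ' = Λ ∧ latRank Λ' = r} : 𝕜) =
        c (latRank Λ)) :
    levelSum ϖ W r (n + 1) = y * (c 0 * levelSum ϖ W 0 n + c 1 * levelSum ϖ W 1 n +
      c 2 * levelSum ϖ W 2 n + c 3 * levelSum ϖ W 3 n) := by
  classical
  have hfin := fun r n => finite_latLevel_rank hϖ r n
  have hsum (r n : ℕ) : levelSum ϖ W r n = ∑ Λ ∈ (finite_latLevel hϖ n).toFinset with
      latRank Λ = r, W Λ := by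
    rw [levelSum, finsum_mem_eq_finite_toFinset_sum _ (hfin r n)]
    congr 1
    ext; simp
  have h1 : levelSum ϖ W r (n + 1) = ∑ Λ ∈ (finite_latLevel hϖ n).toFinset,
      y * (c (latRank Λ) * W Λ) := by
    rw [hsum, ← Finset.sum_fiberwise_of_maps_to (t := (finite_latLevel hϖ n).toFinset)
      (g := latColon ϖ)]
    · refine Finset.sum_congr rfl fun Λ hΛ => ?_
      rw [Set.Finite.mem_toFinset] at hΛ
      have h2 : ∀ Λ' ∈ ((finite_latLevel hϖ (n + 1)).toFinset.filter
          (fun Λ => latRank Λ = r)).filter (fun Λ' => latColon ϖ Λ' = Λ), W Λ' = y * W Λ := by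
        intro Λ' h'
        simp only [Finset.mem_filter, Set.Finite.mem_toFinset] at h'
        rw [hW Λ' (isLat_of_mem_latLevel h'.1.1) h'.1.2, h'.2]
      rw [Finset.sum_congr rfl h2, Finset.sum_const, nsmul_eq_mul, ← hc Λ
        (isLat_of_mem_latLevel hΛ), Nat.subtype_card]
      · ring
      · intro Λ'
        simp only [Finset.mem_filter, Set.Finite.mem_toFinset]
        constructor
        · rintro ⟨⟨-, h3⟩, h4⟩
          exact ⟨h4, h3⟩
        · rintro ⟨h4, h3⟩
          refine ⟨⟨⟨h4 ▸ hΛ, ?_⟩, h3⟩, h4⟩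
          rintro rfl
          exact hr (h3 ▸ latRank_top)
    · intro Λ hΛ
      simp only [Finset.mem_filter, Set.Finite.mem_toFinset] at hΛ ⊢
      exact hΛ.1.1
  rw [h1, ← Finset.mul_sum, ← Finset.sum_fiberwise_of_maps_to (t := Finset.range 4)
    (g := latRank) (fun Λ _ => Finset.mem_range.2 (Nat.lt_succ_of_le (latRank_le Λ)))]
  have h2 : ∀ j, ∑ Λ ∈ (finite_latLevel hϖ n).toFinset with latRank Λ = j, c (latRank Λ) * W Λ =
      c j * levelSum ϖ W j n := by
    intro j
    rw [hsum, Finset.mul_sum]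
    refine Finset.sum_congr rfl fun Λ hΛ => ?_
    rw [(Finset.mem_filter.1 hΛ).2]
  simp only [h2, Finset.sum_range_succ, Finset.sum_range_zero, zero_add]

lemma finsum_mem_latLevel {𝕜 : Type*} [AddCommMonoid 𝕜] {ϖ : O} (hϖ : Irreducible ϖ)
    (W : Submodule O (Fin 3 → O) → 𝕜) (n : ℕ) :
    ∑ᶠ Λ ∈ latLevel ϖ n, W Λ = levelSum ϖ W 0 n + levelSum ϖ W 1 n + levelSum ϖ W 2 n +
      levelSum ϖ W 3 n := by
  classical
  have hsum (r : ℕ) : levelSum ϖ W r n = ∑ Λ ∈ (finite_latLevel hϖ n).toFinset with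
      latRank Λ = r, W Λ := by
    rw [levelSum, finsum_mem_eq_finite_toFinset_sum _ (finite_latLevel_rank hϖ r n)]
    congr 1
    ext; simp
  rw [finsum_mem_eq_finite_toFinset_sum _ (finite_latLevel hϖ n),
    ← Finset.sum_fiberwise_of_maps_to (t := Finset.range 4)
    (g := latRank) (fun Λ _ => Finset.mem_range.2 (Nat.lt_succ_of_le (latRank_le Λ)))]
  simp only [hsum, Finset.sum_range_succ, Finset.sum_range_zero, zero_add]

lemma levelSum_zero {𝕜 : Type*} [AddCommMonoid 𝕜] {ϖ : O}
    (W : Submodule O (Fin 3 → O) → 𝕜) {r : ℕ} (hr : r ≠ 3) : levelSum ϖ W r 0 = 0 := by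
  rw [levelSum]
  apply finsum_mem_eq_zero_of_forall_eq_zero
  rintro Λ ⟨h1, h2⟩
  rw [mem_latLevel_zero] at h1
  exact absurd (h2.symm.trans (h1 ▸ latRank_top)) hr

lemma levelSum_three_zero {𝕜 : Type*} [AddCommMonoid 𝕜] {ϖ : O}
    (W : Submodule O (Fin 3 → O) → 𝕜) : levelSum ϖ W 3 0 = W ⊤ := by
  rw [levelSum, show {Λ : Submodule O (Fin 3 → O) | Λ ∈ latLevel ϖ 0 ∧ latRank Λ = 3} = {⊤} from ?_,
    finsum_mem_singleton]
  ext Λ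
  simp only [Set.mem_ofPred_eq, mem_latLevel_zero, Set.mem_singleton_iff, and_iff_left_iff_imp]
  rintro rfl
  exact latRank_top

lemma levelSum_three_succ {𝕜 : Type*} [AddCommMonoid 𝕜] {ϖ : O}
    (W : Submodule O (Fin 3 → O) → 𝕜) (n : ℕ) : levelSum ϖ W 3 (n + 1) = 0 := by
  rw [levelSum]
  apply finsum_mem_eq_zero_of_forall_eq_zero
  rintro Λ ⟨h1, h2⟩
  exact absurd (eq_top_of_latRank h2) h1.2

/-- Summation over all lattices, by levels, of a function that is multiplicative along `latColon`
on lattices of rank at most one. -/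
theorem hasSum_latLevel {𝕜 : Type*} [RCLike 𝕜] {ϖ : O} (hϖ : Irreducible ϖ)
    {W : Submodule O (Fin 3 → O) → 𝕜} {y z T q : 𝕜} (hq : q = Nat.card (ResidueField O))
    (hy : ‖q ^ 2 * y‖ < 1) (hz : ‖z‖ < 1) (hW : W ⊤ = 1)
    (hW1 : ∀ Λ, IsLat ϖ Λ → latRank Λ = 1 → W Λ = y * W (latColon ϖ Λ))
    (hW0 : ∀ Λ, IsLat ϖ Λ → latRank Λ = 0 → W Λ = z * W (latColon ϖ Λ))
    (hT : HasSum (fun n => levelSum ϖ W 2 n) T) :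
    HasSum (fun n => ∑ᶠ Λ ∈ latLevel ϖ n, W Λ)
      ((1 + T + y * (q ^ 2 + q + 1 + (q ^ 2 + q) * T) / (1 - q ^ 2 * y)) / (1 - z)) := by
  have hqn : 2 ≤ Nat.card (ResidueField O) := Finite.one_lt_card
  have hq1 : q - 1 ≠ 0 := by
    rw [hq, sub_ne_zero]
    exact_mod_cast (by omega : Nat.card (ResidueField O) ≠ 1)
  have hx (n : ℕ) : levelSum ϖ W 1 (n + 1) = y * (0 * levelSum ϖ W 0 n + q ^ 2 * levelSum ϖ W 1 n +
      (q ^ 2 + q) * levelSum ϖ W 2 n + (q ^ 2 + q + 1) * levelSum ϖ W 3 n) := by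
    -- The numbers of lines for ranks `0, 1, 2, 3` of the base point are `0`, `q²`, `q² + q` and `q²
    -- + q + 1`.
    have := levelSum_fiber hϖ (W := W) (r := 1) (n := n) (by norm_num) hW1
      (c := fun r => (q ^ 3 - q ^ (3 - r)) / (q - 1)) ?_
    · rw [this]
      congr 5 <;> rw [div_eq_iff hq1] <;> ring
    · intro Λ hΛ
      have h1 := natCard_fiber_rank_one hϖ hΛ
      rw [eq_div_iff hq1, eq_sub_iff_add_eq, hq]
      have h2 : ((Nat.card (ResidueField O) - 1 : ℕ) : 𝕜) = (Nat.card (ResidueField O) : 𝕜) - 1 := by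
        push_cast [show 1 ≤ Nat.card (ResidueField O) by omega]
        rfl
      rw [← h2]
      exact_mod_cast h1
  have hu (n : ℕ) : levelSum ϖ W 0 (n + 1) = z * (levelSum ϖ W 0 n + levelSum ϖ W 1 n +
      levelSum ϖ W 2 n + levelSum ϖ W 3 n) := by
    have := levelSum_fiber hϖ (W := W) (r := 0) (n := n) (by norm_num) hW0
      (c := fun r => 1) (fun Λ hΛ => by rw [natCard_fiber_rank_zero hϖ hΛ, Nat.cast_one])
    rw [this]
    ring
  have h3 : HasSum (fun n => levelSum ϖ W 3 n) 1 := by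
    have := hasSum_single (f := fun n => levelSum ϖ W 3 n) 0 (fun n hn => by
      obtain ⟨m, rfl⟩ := Nat.exists_eq_succ_of_ne_zero hn
      exact levelSum_three_succ W m)
    rwa [levelSum_three_zero, hW] at this
  -- The rank 1 sums satisfy a recursion of ratio `q² y`, driven by rank 2 and by `⊤`; rank 0 then
  -- has ratio `z` and is driven by the three others.
  have h1 : HasSum (fun n => levelSum ϖ W 1 n)
      (y * (q ^ 2 + q + 1 + (q ^ 2 + q) * T) / (1 - q ^ 2 * y)) := by
    have := hasSum_of_linear_recursion (x := fun n => levelSum ϖ W 1 n)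
      (a := fun n => y * ((q ^ 2 + q) * levelSum ϖ W 2 n + (q ^ 2 + q + 1) * levelSum ϖ W 3 n))
      hy (fun n => by rw [hx]; ring)
      (((hT.mul_left (q ^ 2 + q)).add (h3.mul_left (q ^ 2 + q + 1))).mul_left y)
    rw [levelSum_zero W (by norm_num)] at this
    convert this using 1
    ring
  have h012 := h1.add (hT.add h3)
  have h0 := hasSum_of_linear_recursion (x := fun n => levelSum ϖ W 0 n)
    (a := fun n => z * (levelSum ϖ W 1 n + (levelSum ϖ W 2 n + levelSum ϖ W 3 n))) hz
    (fun n => by rw [hu]; ring) (h012.mul_left z)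
  rw [levelSum_zero W (by norm_num)] at h0
  have h1z : (1 : 𝕜) - z ≠ 0 := by
    intro h
    rw [sub_eq_zero] at h
    rw [← h, norm_one] at hz
    exact lt_irrefl _ hz
  convert h0.add h012 using 1
  · ext n
    rw [finsum_mem_latLevel hϖ]
    ring
  · field_simp
    ring

/-- The lattices, sorted by level. -/
def latLevelEquiv (ϖ : O) :
    (Σ n, latLevel ϖ n) ≃ {Λ : Submodule O (Fin 3 → O) // IsLat ϖ Λ} :=
  Equiv.ofBijective (fun p => ⟨p.2.1, isLat_of_mem_latLevel p.2.2⟩) <| by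
    constructor
    · rintro ⟨n, Λ, h⟩ ⟨m, Λ', h'⟩ heq
      obtain rfl : Λ = Λ' := congrArg Subtype.val heq
      obtain rfl := latLevel_unique h h'
      rfl
    · rintro ⟨Λ, h⟩
      obtain ⟨n, hn⟩ := exists_mem_latLevel h
      exact ⟨⟨n, Λ, hn⟩, rfl⟩

/-- Convergence by levels does not imply summability over lattices; the same statement for `‖W‖`
does. This is why the sums by level are evaluated over any `RCLike` field: they are used over `ℂ` at
`t` and over `ℝ` at `‖t‖`. -/
lemma hasSum_isLat {ϖ : O} (hϖ : Irreducible ϖ) {W : Submodule O (Fin 3 → O) → ℂ} {A : ℂ}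
    (hs : Summable fun n => ∑ᶠ Λ ∈ latLevel ϖ n, ‖W Λ‖)
    (h : HasSum (fun n => ∑ᶠ Λ ∈ latLevel ϖ n, W Λ) A) :
    HasSum (fun Λ : {Λ : Submodule O (Fin 3 → O) // IsLat ϖ Λ} => W Λ) A := by
  have (n : ℕ) : Fintype (latLevel ϖ n) := (finite_latLevel hϖ n).fintype
  rw [← (latLevelEquiv ϖ).hasSum_iff]
  have hlev {𝕜 : Type} [AddCommMonoid 𝕜] (V : Submodule O (Fin 3 → O) → 𝕜) (n : ℕ) :
      ∑ᶠ Λ ∈ latLevel ϖ n, V Λ = ∑ Λ : latLevel ϖ n, V Λ := by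
    rw [← finsum_set_coe_eq_finsum_mem, finsum_eq_sum_of_fintype]
  simp only [hlev] at hs h
  have hsum : Summable fun p : Σ n, latLevel ϖ n => ‖W p.2‖ := by
    rw [summable_sigma_of_nonneg fun _ => norm_nonneg _]
    refine ⟨fun n => (hasSum_fintype _).summable, ?_⟩
    simpa only [tsum_fintype] using hs
  have h1 : HasSum (fun p : Σ n, latLevel ϖ n => W p.2) (∑' p : Σ n, latLevel ϖ n, W p.2) :=
    hsum.of_norm.hasSum
  have h2 := h1.sigma fun n => hasSum_fintype _
  rw [h2.unique h] at h1
  exact h1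

end Levels

/-! ### Lengths of quotients by lattices -/

section Lengths

variable {O : Type*} [CommRing O] [IsDomain O] [IsDiscreteValuationRing O]
  [Finite (ResidueField O)]

/-- The length of `O³/Λ`, for lattices `Λ`. -/
def latLen (Λ : Submodule O (Fin 3 → O)) : ℕ :=
  Nat.log (Nat.card (ResidueField O)) Λ.toAddSubgroup.index

lemma latLen_top : latLen (⊤ : Submodule O (Fin 3 → O)) = 0 := by
  simp [latLen]

lemma IsLat.index_eq_pow {ϖ : O} (hϖ : Irreducible ϖ) {Λ : Submodule O (Fin 3 → O)}
    (h : IsLat ϖ Λ) : Λ.toAddSubgroup.index = Nat.card (ResidueField O) ^ latLen Λ := by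
  have hq : 1 < Nat.card (ResidueField O) := Finite.one_lt_card
  suffices ∃ m, Λ.toAddSubgroup.index = Nat.card (ResidueField O) ^ m by
    obtain ⟨m, hm⟩ := this
    rw [latLen, hm, Nat.log_pow hq]
  obtain ⟨n, hn⟩ := exists_mem_latLevel h
  induction n generalizing Λ with
  | zero =>
    rw [mem_latLevel_zero.1 hn]
    exact ⟨0, by simp⟩
  | succ n ih =>
    obtain ⟨m, hm⟩ := ih h.colon hn.1
    exact ⟨3 - latRank Λ + m, by rw [h.index_eq hϖ, hm, pow_add]⟩

lemma IsLat.latLen_eq {ϖ : O} (hϖ : Irreducible ϖ) {Λ : Submodule O (Fin 3 → O)}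
    (h : IsLat ϖ Λ) : latLen Λ = latLen (latColon ϖ Λ) + (3 - latRank Λ) := by
  have hq : 1 < Nat.card (ResidueField O) := Finite.one_lt_card
  have h1 := h.index_eq hϖ
  rw [h.index_eq_pow hϖ, h.colon.index_eq_pow hϖ, ← pow_add] at h1
  rw [Nat.pow_right_injective hq h1, add_comm]

end Lengths

/-! ### Lattices of rank two: kernels of primitive linear forms -/

section Cyclic

variable {O : Type*} [CommRing O] [IsDomain O] [IsDiscreteValuationRing O]

/-- The lattice `{y : φ · y ≡ 0 mod ϖⁿ}`. -/
def dotLat (ϖ : O) (φ : Fin 3 → O) (n : ℕ) : Submodule O (Fin 3 → O) where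
  carrier := {y | ϖ ^ n ∣ φ ⬝ᵥ y}
  add_mem' ha hb := by
    simp only [Set.mem_ofPred_eq, dotProduct_add] at *
    exact dvd_add ha hb
  zero_mem' := by simp
  smul_mem' c y hy := by
    simp only [Set.mem_ofPred_eq, dotProduct_smul, smul_eq_mul] at *
    exact hy.mul_left c

@[simp] lemma mem_dotLat {ϖ : O} {φ : Fin 3 → O} {n : ℕ} {y : Fin 3 → O} :
    y ∈ dotLat ϖ φ n ↔ ϖ ^ n ∣ φ ⬝ᵥ y := Iff.rfl

lemma dotLat_zero {ϖ : O} {φ : Fin 3 → O} : dotLat ϖ φ 0 = ⊤ := by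
  ext; simp

lemma latColon_dotLat {ϖ : O} (hϖ : Irreducible ϖ) (φ : Fin 3 → O) (n : ℕ) :
    latColon ϖ (dotLat ϖ φ (n + 1)) = dotLat ϖ φ n := by
  ext y
  rw [mem_latColon, mem_dotLat, mem_dotLat, dotProduct_smul, smul_eq_mul, pow_succ',
    mul_dvd_mul_iff_left hϖ.ne_zero]

lemma exists_isUnit_of_redVec_ne_zero {φ : Fin 3 → O} (hφ : redVec O φ ≠ 0) :
    ∃ i, IsUnit (φ i) := by
  by_contra! h
  refine hφ (funext fun i => ?_)
  have := mt (isUnit_iff_residue_ne_zero (φ i)).2 (h i)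
  simpa using this

lemma exists_dotProduct_eq_one {φ : Fin 3 → O} (hφ : redVec O φ ≠ 0) :
    ∃ v : Fin 3 → O, φ ⬝ᵥ v = 1 := by
  obtain ⟨i, u, hu⟩ := exists_isUnit_of_redVec_ne_zero hφ
  exact ⟨Pi.single i (↑u⁻¹ : O), by rw [dotProduct_single, ← hu, Units.mul_inv]⟩

lemma residue_dotProduct (φ y : Fin 3 → O) :
    residue O (φ ⬝ᵥ y) = redVec O φ ⬝ᵥ redVec O y := by
  simp [dotProduct]

lemma dotLat_mem_latLevel {ϖ : O} (hϖ : Irreducible ϖ) {φ : Fin 3 → O} (hφ : redVec O φ ≠ 0)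
    (n : ℕ) : dotLat ϖ φ n ∈ latLevel ϖ n := by
  induction n with
  | zero => exact dotLat_zero
  | succ n ih =>
    refine ⟨by rwa [latColon_dotLat hϖ], fun h => ?_⟩
    obtain ⟨v, hv⟩ := exists_dotProduct_eq_one hφ
    have h1 : v ∈ dotLat ϖ φ (n + 1) := h ▸ Submodule.mem_top
    rw [mem_dotLat, hv] at h1
    exact hϖ.not_isUnit (isUnit_of_dvd_one ((dvd_pow_self ϖ n.succ_ne_zero).trans h1))

/-- The reduction is the whole plane orthogonal to `φ` mod `ϖ`: if `φ · y = ϖ c` and `φ · v = 1`,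
then `y - ϖ c v` lies in the lattice and has the same reduction as `y`. -/
lemma latRank_dotLat {ϖ : O} (hϖ : Irreducible ϖ) {φ : Fin 3 → O} (hφ : redVec O φ ≠ 0)
    (n : ℕ) : latRank (dotLat ϖ φ (n + 1)) = 2 := by
  obtain ⟨v, hv⟩ := exists_dotProduct_eq_one hφ
  let ℓ : (Fin 3 → ResidueField O) →ₗ[ResidueField O] ResidueField O :=
    dotProductBilin (ResidueField O) (ResidueField O) (redVec O φ)
  have hℓ : LinearMap.range ℓ = ⊤ := by
    rw [LinearMap.range_eq_top]
    intro c
    refine ⟨c • redVec O v, ?_⟩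
    change redVec O φ ⬝ᵥ (c • redVec O v) = c
    rw [dotProduct_smul, ← residue_dotProduct, hv, map_one, smul_eq_mul, mul_one]
  have h1 : (dotLat ϖ φ (n + 1)).map (redVec O) = LinearMap.ker ℓ := by
    ext z
    constructor
    · rintro ⟨y, hy, rfl⟩
      change redVec O φ ⬝ᵥ redVec O y = 0
      rw [← residue_dotProduct, residue_eq_zero_iff_dvd hϖ]
      exact (dvd_pow_self ϖ n.succ_ne_zero).trans hy
    · intro hz
      obtain ⟨y, rfl⟩ := redVec_surjective z
      change redVec O φ ⬝ᵥ redVec O y = 0 at hz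
      rw [← residue_dotProduct, residue_eq_zero_iff_dvd hϖ] at hz
      obtain ⟨c, hc⟩ := hz
      refine ⟨y - ϖ • c • v, ?_, ?_⟩
      · change ϖ ^ (n + 1) ∣ φ ⬝ᵥ (y - ϖ • c • v)
        rw [dotProduct_sub, dotProduct_smul, dotProduct_smul, hv, hc]
        simp
      · rw [map_sub, (redVec_eq_zero_iff hϖ _).2 ⟨c • v, rfl⟩, sub_zero]
  have h2 := LinearMap.finrank_range_add_finrank_ker ℓ
  rw [hℓ, finrank_top, finrank_self, finrank_fin_fun] at h2
  rw [latRank, h1]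
  omega

lemma smul_mem_of_mem_latLevel {ϖ : O} {n : ℕ} {Λ : Submodule O (Fin 3 → O)}
    (h : Λ ∈ latLevel ϖ n) (y : Fin 3 → O) : ϖ ^ n • y ∈ Λ := by
  induction n generalizing Λ with
  | zero => rw [mem_latLevel_zero.1 h]; trivial
  | succ n ih =>
    have := ih h.1
    rwa [mem_latColon, ← mul_smul, ← pow_succ'] at this

lemma le_of_forall_smul_mem {ϖ : O} {m n : ℕ} {Λ : Submodule O (Fin 3 → O)}
    (h : Λ ∈ latLevel ϖ n) (hm : ∀ y, ϖ ^ m • y ∈ Λ) : n ≤ m := by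
  induction m generalizing n Λ with
  | zero =>
    have : Λ = ⊤ := eq_top_iff.2 fun y _ => by simpa using hm y
    rw [latLevel_unique h (mem_latLevel_zero.2 this)]
  | succ m ih =>
    cases n with
    | zero => exact Nat.zero_le _
    | succ n =>
      refine Nat.succ_le_succ (ih h.1 fun y => ?_)
      rw [mem_latColon, ← mul_smul, ← pow_succ']
      exact hm y

/-- By Nakayama `O³/Λ` is generated by one vector `v`, and its annihilator is `ϖⁿ` because `Λ` has
level `n`. The form `φ` reads off the coefficient of `v`. -/
lemma exists_eq_dotLat {ϖ : O} (hϖ : Irreducible ϖ) {n : ℕ} {Λ : Submodule O (Fin 3 → O)}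
    (h : Λ ∈ latLevel ϖ n) (hr : latRank Λ = 2) :
    ∃ φ : Fin 3 → O, redVec O φ ≠ 0 ∧ Λ = dotLat ϖ φ n := by
  have h1 : Λ.map (redVec O) ≠ ⊤ := by
    intro h1
    rw [latRank, h1, finrank_top, finrank_fin_fun] at hr
    omega
  obtain ⟨w, hw⟩ : ∃ w, w ∉ Λ.map (redVec O) := by
    by_contra! h2
    exact h1 (eq_top_iff.2 fun x _ => h2 x)
  obtain ⟨v, rfl⟩ := redVec_surjective w
  have hsup : Λ ⊔ Submodule.span O {v} = ⊤ := by
    apply eq_top_of_latRank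
    apply le_antisymm (latRank_le _)
    have h3 : (Λ.map (redVec O)) < (Λ ⊔ Submodule.span O {v}).map (redVec O) := by
      refine lt_of_le_of_ne (Submodule.map_mono le_sup_left) fun h4 => hw ?_
      rw [h4]
      exact ⟨v, Submodule.mem_sup_right (Submodule.mem_span_singleton_self v), rfl⟩
    have := Submodule.finrank_lt_finrank_of_lt h3
    rw [latRank] at hr ⊢
    omega
  have hdec (y : Fin 3 → O) : ∃ c : O, y - c • v ∈ Λ := by
    have : y ∈ Λ ⊔ Submodule.span O {v} := hsup ▸ Submodule.mem_top
    obtain ⟨a, ha, b, hb, rfl⟩ := Submodule.mem_sup.1 this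
    obtain ⟨c, rfl⟩ := Submodule.mem_span_singleton.1 hb
    exact ⟨c, by simpa using ha⟩
  -- If `u ϖᵐ v ∈ Λ` with `u` a unit, then `ϖᵐ` kills the quotient, whence `n ≤ m`.
  have hcv (c : O) : c • v ∈ Λ ↔ ϖ ^ n ∣ c := by
    constructor
    · intro hc
      by_cases h0 : c = 0
      · simp [h0]
      obtain ⟨m, u, rfl⟩ := IsDiscreteValuationRing.eq_unit_mul_pow_irreducible h0 hϖ
      refine (pow_dvd_pow ϖ (le_of_forall_smul_mem h fun y => ?_)).mul_left _
      obtain ⟨d, hd⟩ := hdec y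
      have h3 := Λ.smul_mem (ϖ ^ m) hd
      have h4 := Λ.smul_mem (d * ↑u⁻¹) hc
      have h5 : (d * ↑u⁻¹ : O) • (↑u * ϖ ^ m : O) • v = ϖ ^ m • d • v := by
        rw [← mul_smul, ← mul_smul]
        congr 1
        linear_combination (ϖ ^ m * d) * u.mul_inv
      rw [h5] at h4
      have := Λ.add_mem h3 h4
      rwa [smul_sub, sub_add_cancel] at this
    · rintro ⟨d, rfl⟩
      rw [mul_smul]
      exact smul_mem_of_mem_latLevel h _
  choose φ hφ using fun i : Fin 3 => hdec (Pi.single i 1)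
  have hφy (y : Fin 3 → O) : y - (φ ⬝ᵥ y) • v ∈ Λ := by
    have h3 : y - (φ ⬝ᵥ y) • v = ∑ i, y i • (Pi.single i 1 - φ i • v) := by
      simp only [smul_sub, Finset.sum_sub_distrib, dotProduct, Finset.sum_smul, ← mul_smul]
      congr 1
      · ext j
        simp [Finset.sum_apply, Pi.single_apply]
      · simp [mul_comm]
    rw [h3]
    exact Submodule.sum_mem _ fun i _ => Λ.smul_mem _ (hφ i)
  refine ⟨φ, fun h0 => ?_, ?_⟩
  · have h3 : residue O (φ ⬝ᵥ v) = 0 := by rw [residue_dotProduct, h0, zero_dotProduct]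
    refine hw ⟨_, hφy v, ?_⟩
    rw [map_sub, map_smulₛₗ, h3, zero_smul, sub_zero]
  · ext y
    rw [mem_dotLat, ← hcv]
    constructor
    · intro hy
      have := Λ.sub_mem hy (hφy y)
      simpa using this
    · intro hy
      have := Λ.add_mem (hφy y) hy
      simpa using this

/-- With `φ · v = 1`, the vector `y - (φ · y) v` is killed by `φ`, so equality of the lattices gives
`φ' · y ≡ (φ' · v)(φ · y)`. The unit is `φ' · v`: if it vanished mod `ϖ`, then evaluation at `v'`
with `φ' · v' = 1` would be contradictory, as `n ≠ 0`. -/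
lemma dotLat_eq_iff {ϖ : O} (hϖ : Irreducible ϖ) {φ φ' : Fin 3 → O} (hφ : redVec O φ ≠ 0)
    (hφ' : redVec O φ' ≠ 0) {n : ℕ} (hn : n ≠ 0) :
    dotLat ϖ φ n = dotLat ϖ φ' n ↔ ∃ u : O, IsUnit u ∧ ∀ i, ϖ ^ n ∣ φ' i - u * φ i := by
  constructor
  · intro h
    obtain ⟨v, hv⟩ := exists_dotProduct_eq_one hφ
    have h1 (y : Fin 3 → O) : ϖ ^ n ∣ φ' ⬝ᵥ y - (φ' ⬝ᵥ v) * (φ ⬝ᵥ y) := by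
      have h2 : y - (φ ⬝ᵥ y) • v ∈ dotLat ϖ φ n := by
        rw [mem_dotLat, dotProduct_sub, dotProduct_smul, hv]
        simp
      rw [h, mem_dotLat, dotProduct_sub, dotProduct_smul, smul_eq_mul] at h2
      rwa [mul_comm]
    refine ⟨φ' ⬝ᵥ v, ?_, fun i => by simpa using h1 (Pi.single i 1)⟩
    obtain ⟨v', hv'⟩ := exists_dotProduct_eq_one hφ'
    have h3 := h1 v'
    rw [hv'] at h3
    rw [isUnit_iff_residue_ne_zero]
    intro h0
    have h4 := (residue_eq_zero_iff_dvd hϖ _).2 ((dvd_pow_self ϖ hn).trans h3)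
    rw [map_sub, map_mul, h0] at h4
    simp at h4
  · rintro ⟨u, hu, h⟩
    ext y
    have h1 : ϖ ^ n ∣ φ' ⬝ᵥ y - u * (φ ⬝ᵥ y) := by
      rw [dotProduct, dotProduct, Finset.mul_sum, ← Finset.sum_sub_distrib]
      refine Finset.dvd_sum fun i _ => ?_
      rw [← mul_assoc, ← sub_mul]
      exact (h i).mul_right _
    rw [mem_dotLat, mem_dotLat, dvd_iff_dvd_of_dvd_sub h1, hu.dvd_mul_left]

end Cyclic

/-! ### Sums over vectors modulo powers of the uniformizer -/

section Residues

variable {O : Type*} [CommRing O] [IsDomain O] [IsDiscreteValuationRing O]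

/-- The ring `O / ϖⁿ`. -/
abbrev ResPow (ϖ : O) (n : ℕ) : Type _ := O ⧸ Ideal.span {ϖ ^ n}

/-- A representative in `O` of an element of the residue field. -/
def liftRes (c : ResidueField O) : O := Function.surjInv residue_surjective c

@[simp] lemma residue_liftRes (c : ResidueField O) : residue O (liftRes c) = c :=
  Function.surjInv_eq residue_surjective c

lemma mk_eq_mk_iff_dvd {ϖ : O} {n : ℕ} {x y : O} :
    (Ideal.Quotient.mk (Ideal.span {ϖ ^ n}) x = Ideal.Quotient.mk _ y) ↔ ϖ ^ n ∣ x - y := by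
  rw [Ideal.Quotient.eq, Ideal.mem_span_singleton]

lemma dvd_out_mk_sub {ϖ : O} {n : ℕ} (x : O) :
    ϖ ^ n ∣ (Ideal.Quotient.mk (Ideal.span {ϖ ^ n}) x).out - x := by
  rw [← mk_eq_mk_iff_dvd, Ideal.Quotient.mk_out]

lemma eq_iff_dvd_out_sub {ϖ : O} {n : ℕ} (a b : ResPow ϖ n) : a = b ↔ ϖ ^ n ∣ a.out - b.out := by
  rw [← mk_eq_mk_iff_dvd, Ideal.Quotient.mk_out, Ideal.Quotient.mk_out]

/-- The digit expansion `O/ϖⁿ⁺¹ ≃ O/ϖⁿ × k`. -/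
def resPowSuccEquiv {ϖ : O} (hϖ : Irreducible ϖ) (n : ℕ) :
    ResPow ϖ n × ResidueField O ≃ ResPow ϖ (n + 1) :=
  Equiv.ofBijective
    (fun p => Ideal.Quotient.mk (Ideal.span {ϖ ^ (n + 1)}) (p.1.out + ϖ ^ n * liftRes p.2)) <| by
    constructor
    · rintro ⟨a, c⟩ ⟨b, d⟩ h
      rw [mk_eq_mk_iff_dvd] at h
      have h1 : ϖ ^ n ∣ (a.out + ϖ ^ n * liftRes c) - (b.out + ϖ ^ n * liftRes d) :=
        (pow_dvd_pow ϖ n.le_succ).trans h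
      have h2 : a = b := by
        rw [eq_iff_dvd_out_sub]
        convert (dvd_sub h1 (Dvd.intro (liftRes c - liftRes d) rfl : ϖ ^ n ∣
          ϖ ^ n * (liftRes c - liftRes d))) using 1
        ring
      subst h2
      have h3 : ϖ ∣ liftRes c - liftRes d := by
        rw [← mul_dvd_mul_iff_left (pow_ne_zero n hϖ.ne_zero), ← pow_succ]
        convert h using 1
        ring
      rw [← residue_eq_zero_iff_dvd hϖ, map_sub, residue_liftRes, residue_liftRes, sub_eq_zero] at h3
      rw [h3]
    · intro b
      obtain ⟨d, hd⟩ := dvd_out_mk_sub (ϖ := ϖ) (n := n) b.out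
      refine ⟨(Ideal.Quotient.mk _ b.out, residue O (-d)), ?_⟩
      conv_rhs => rw [← Ideal.Quotient.mk_out b]
      rw [mk_eq_mk_iff_dvd]
      have h1 : ϖ ∣ liftRes (residue O (-d)) + d := by
        rw [← residue_eq_zero_iff_dvd hϖ, map_add, residue_liftRes, ← map_add, neg_add_cancel,
          map_zero]
      obtain ⟨e, he⟩ := h1
      refine ⟨e, ?_⟩
      linear_combination hd + ϖ ^ n * he

instance (ϖ : O) : Unique (ResPow ϖ 0) where
  default := 0
  uniq a := by
    rw [eq_iff_dvd_out_sub]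
    simp

variable [Finite (ResidueField O)]

lemma finite_resPow {ϖ : O} (hϖ : Irreducible ϖ) (n : ℕ) : Finite (ResPow ϖ n) := by
  induction n with
  | zero => infer_instance
  | succ n ih => exact Finite.of_equiv _ (resPowSuccEquiv hϖ n)

lemma natCard_resPow {ϖ : O} (hϖ : Irreducible ϖ) (n : ℕ) :
    Nat.card (ResPow ϖ n) = Nat.card (ResidueField O) ^ n := by
  induction n with
  | zero => simp
  | succ n ih => rw [← Nat.card_congr (resPowSuccEquiv hϖ n), Nat.card_prod, ih, pow_succ]

/-- The sum of `F` over a set of representatives of `(O/ϖⁿ)³`. -/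
def resSum {𝕜 : Type*} [AddCommMonoid 𝕜] (ϖ : O) (n : ℕ) (F : (Fin 3 → O) → 𝕜) : 𝕜 :=
  ∑ᶠ φ : Fin 3 → ResPow ϖ n, F fun i => (φ i).out

/-- The vectors are expanded in digits. Chosen representatives need not be compatible with the
expansion, hence the invariance required of `F`. -/
lemma resSum_succ {𝕜 : Type*} [AddCommMonoid 𝕜] {ϖ : O} (hϖ : Irreducible ϖ) (n : ℕ)
    {F : (Fin 3 → O) → 𝕜}
    (hF : ∀ φ φ' : Fin 3 → O, (∀ i, ϖ ^ (n + 1) ∣ φ i - φ' i) → F φ = F φ') :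
    resSum ϖ (n + 1) F =
      resSum ϖ n fun φ => ∑ᶠ ψ : Fin 3 → ResidueField O, F fun i => φ i + ϖ ^ n * liftRes (ψ i) := by
  classical
  have := fun n => finite_resPow hϖ n
  have := fun n => Fintype.ofFinite (ResPow ϖ n)
  have := Fintype.ofFinite (ResidueField O)
  simp only [resSum, finsum_eq_sum_of_fintype]
  rw [← Fintype.sum_prod_type']
  symm
  refine Fintype.sum_equiv ((Equiv.arrowProdEquivProdArrow (Fin 3) (fun _ => ResPow ϖ n)
    (fun _ => ResidueField O)).symm.trans (Equiv.piCongrRight fun _ => resPowSuccEquiv hϖ n)) _ _ ?_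
  rintro ⟨φ, ψ⟩
  refine hF _ _ fun i => ?_
  rw [← neg_sub, dvd_neg]
  exact dvd_out_mk_sub _

lemma resSum_one {𝕜 : Type*} [AddCommMonoid 𝕜] {ϖ : O} (hϖ : Irreducible ϖ)
    {F : (Fin 3 → O) → 𝕜} (hF : ∀ φ φ' : Fin 3 → O, redVec O φ = redVec O φ' → F φ = F φ') :
    resSum ϖ 1 F = ∑ᶠ ψ : Fin 3 → ResidueField O, F fun i => liftRes (ψ i) := by
  have hF' : ∀ φ φ' : Fin 3 → O, (∀ i, ϖ ^ (0 + 1) ∣ φ i - φ' i) → F φ = F φ' := by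
    intro φ φ' h
    refine hF φ φ' (funext fun i => ?_)
    have := h i
    rw [zero_add, pow_one, ← residue_eq_zero_iff_dvd hϖ, map_sub, sub_eq_zero] at this
    exact this
  rw [← zero_add 1, resSum_succ hϖ 0 hF', resSum, finsum_unique]
  -- The representative of the only class modulo `ϖ⁰` need not be zero; its reduction acts as a
  -- translation of `k³`.
  set φ₀ : Fin 3 → O := fun i => ((default : Fin 3 → ResPow ϖ 0) i).out
  refine finsum_eq_of_bijective (fun ψ => redVec O φ₀ + ψ) (AddGroup.addLeft_bijective _) ?_
  intro ψ
  apply hF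
  ext i
  simp

lemma resSum_congr {𝕜 : Type*} [AddCommMonoid 𝕜] {ϖ : O} {n : ℕ} {F F' : (Fin 3 → O) → 𝕜}
    (h : ∀ φ, F φ = F' φ) : resSum ϖ n F = resSum ϖ n F' := by
  rw [funext h]

lemma resSum_mul_left {𝕜 : Type*} [Field 𝕜] {ϖ : O} (hϖ : Irreducible ϖ) {n : ℕ}
    (F : (Fin 3 → O) → 𝕜) (c : 𝕜) : resSum ϖ n (fun φ => c * F φ) = c * resSum ϖ n F := by
  have := finite_resPow hϖ n
  have := Fintype.ofFinite (ResPow ϖ n)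
  simp only [resSum, finsum_eq_sum_of_fintype, Finset.mul_sum]

lemma resSum_add {𝕜 : Type*} [AddCommMonoid 𝕜] {ϖ : O} (hϖ : Irreducible ϖ) {n : ℕ}
    (F F' : (Fin 3 → O) → 𝕜) :
    resSum ϖ n (fun φ => F φ + F' φ) = resSum ϖ n F + resSum ϖ n F' := by
  have := finite_resPow hϖ n
  rw [resSum, resSum, resSum, finsum_add_distrib (Set.toFinite _) (Set.toFinite _)]

/-- Multiplication by `ϖ` identifies `O/ϖⁿ` with the nonunits of `O/ϖⁿ⁺¹`. -/
lemma natCard_units_resPow {ϖ : O} (hϖ : Irreducible ϖ) (n : ℕ) :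
    Nat.card {a : ResPow ϖ (n + 1) // IsUnit a.out} + Nat.card (ResidueField O) ^ n =
      Nat.card (ResidueField O) ^ (n + 1) := by
  have := finite_resPow hϖ (n + 1)
  have h1 : Nat.card {a : ResPow ϖ (n + 1) // ¬ IsUnit a.out} = Nat.card (ResPow ϖ n) := by
    symm
    refine Nat.card_eq_of_bijective (fun b => ⟨Ideal.Quotient.mk _ (ϖ * b.out), ?_⟩) ⟨?_, ?_⟩
    · have h2 := dvd_out_mk_sub (ϖ := ϖ) (n := n + 1) (ϖ * b.out)
      intro hu
      have h3 := (dvd_sub_left (Dvd.intro _ rfl)).1 ((dvd_pow_self ϖ n.succ_ne_zero).trans h2)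
      exact hϖ.not_isUnit (isUnit_of_dvd_unit h3 hu)
    · intro b c h
      have h2 := congrArg Subtype.val h
      rw [mk_eq_mk_iff_dvd, ← mul_sub, pow_succ', mul_dvd_mul_iff_left hϖ.ne_zero] at h2
      rwa [eq_iff_dvd_out_sub]
    · rintro ⟨a, ha⟩
      rw [isUnit_iff_residue_ne_zero, not_not, residue_eq_zero_iff_dvd hϖ] at ha
      obtain ⟨d, hd⟩ := ha
      refine ⟨Ideal.Quotient.mk _ d, Subtype.ext ?_⟩
      change _ = a
      conv_rhs => rw [← Ideal.Quotient.mk_out a]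
      rw [mk_eq_mk_iff_dvd, hd, ← mul_sub, pow_succ', mul_dvd_mul_iff_left hϖ.ne_zero]
      exact dvd_out_mk_sub d
  rw [← natCard_resPow hϖ n, ← h1, ← natCard_resPow hϖ]
  have := Set.ncard_add_ncard_compl {a : ResPow ϖ (n + 1) | IsUnit a.out}
  rwa [← Nat.card_coe_set_eq, ← Nat.card_coe_set_eq] at this

lemma redVec_out_congr {ϖ : O} (hϖ : Irreducible ϖ) {n : ℕ} {φ φ' : Fin 3 → O}
    (h : ∀ i, ϖ ^ (n + 1) ∣ φ i - φ' i) : redVec O φ = redVec O φ' := by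
  ext i
  have := (residue_eq_zero_iff_dvd hϖ _).2 ((dvd_pow_self ϖ n.succ_ne_zero).trans (h i))
  rwa [map_sub, sub_eq_zero] at this

open Classical in
-- The primitive vectors modulo `ϖⁿ⁺¹` that define a given lattice form one free orbit of the units
-- of `O/ϖⁿ⁺¹`, of which there are `qⁿ⁺¹ - qⁿ`.
lemma resSum_dotLat {𝕜 : Type*} [Field 𝕜] {ϖ : O} (hϖ : Irreducible ϖ) (n : ℕ)
    (W : Submodule O (Fin 3 → O) → 𝕜) :
    resSum ϖ (n + 1) (fun φ => if redVec O φ ≠ 0 then W (dotLat ϖ φ (n + 1)) else 0) =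
      ((Nat.card (ResidueField O) : 𝕜) ^ (n + 1) - (Nat.card (ResidueField O) : 𝕜) ^ n) *
        levelSum ϖ W 2 (n + 1) := by
  have := finite_resPow hϖ (n + 1)
  have := Fintype.ofFinite (ResPow ϖ (n + 1))
  have hfin := finite_latLevel_rank hϖ 2 (n + 1)
  rw [resSum, finsum_eq_sum_of_fintype, ← Finset.sum_filter, levelSum,
    finsum_mem_eq_finite_toFinset_sum _ hfin,
    ← Finset.sum_fiberwise_of_maps_to (t := hfin.toFinset)
      (g := fun φ : Fin 3 → ResPow ϖ (n + 1) => dotLat ϖ (fun i => (φ i).out) (n + 1)),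
    Finset.mul_sum]
  · refine Finset.sum_congr rfl fun Λ hΛ => ?_
    rw [Set.Finite.mem_toFinset] at hΛ
    obtain ⟨φ₀, h0, rfl⟩ := exists_eq_dotLat hϖ hΛ.1 hΛ.2
    rw [Finset.sum_congr rfl (g := fun _ => W (dotLat ϖ φ₀ (n + 1))) (fun φ hφ => by
      rw [(Finset.mem_filter.1 hφ).2]), Finset.sum_const, nsmul_eq_mul]
    congr 1
    rw [eq_sub_iff_add_eq]
    have hcard := natCard_units_resPow hϖ n
    rw [← Nat.subtype_card (p := fun φ : Fin 3 → ResPow ϖ (n + 1) =>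
      redVec O (fun i => (φ i).out) ≠ 0 ∧ dotLat ϖ (fun i => (φ i).out) (n + 1) =
        dotLat ϖ φ₀ (n + 1)) _ (fun φ => by simp)]
    have hbij : Nat.card {a : ResPow ϖ (n + 1) // IsUnit a.out} =
        Nat.card {φ : Fin 3 → ResPow ϖ (n + 1) //
          redVec O (fun i => (φ i).out) ≠ 0 ∧ dotLat ϖ (fun i => (φ i).out) (n + 1) =
            dotLat ϖ φ₀ (n + 1)} := by
      have hred (a : O) : redVec O (fun i => (Ideal.Quotient.mk (Ideal.span {ϖ ^ (n + 1)})
          (a * φ₀ i)).out) = residue O a • redVec O φ₀ := by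
        exact (redVec_out_congr hϖ (n := n) (φ' := a • φ₀) (fun i => dvd_out_mk_sub _)).trans
          (map_smulₛₗ _ _ _)
      refine Nat.card_eq_of_bijective (fun a => ⟨fun i => Ideal.Quotient.mk _ (a.1.out * φ₀ i),
        ?_, ?_⟩) ⟨?_, ?_⟩
      · rw [hred]
        exact smul_ne_zero ((isUnit_iff_residue_ne_zero _).1 a.2) h0
      · symm
        rw [dotLat_eq_iff hϖ h0 _ n.succ_ne_zero]
        · exact ⟨a.1.out, a.2, fun i => dvd_out_mk_sub _⟩
        · rw [hred]
          exact smul_ne_zero ((isUnit_iff_residue_ne_zero _).1 a.2) h0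
      · rintro ⟨a, ha⟩ ⟨b, hb⟩ h
        obtain ⟨i, hi⟩ := exists_isUnit_of_redVec_ne_zero h0
        have h1 := congrFun (congrArg Subtype.val h) i
        dsimp only at h1
        rw [mk_eq_mk_iff_dvd, ← sub_mul, hi.dvd_mul_right, ← eq_iff_dvd_out_sub] at h1
        exact Subtype.ext h1
      · rintro ⟨φ, h1, h2⟩
        obtain ⟨u, hu, h3⟩ := (dotLat_eq_iff hϖ h0 h1 n.succ_ne_zero).1 h2.symm
        refine ⟨⟨Ideal.Quotient.mk _ u, ?_⟩, Subtype.ext (funext fun i => ?_)⟩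
        · have h4 := dvd_out_mk_sub (ϖ := ϖ) (n := n + 1) u
          rw [isUnit_iff_residue_ne_zero] at hu ⊢
          have h5 := (residue_eq_zero_iff_dvd hϖ _).2 ((dvd_pow_self ϖ n.succ_ne_zero).trans h4)
          rw [map_sub, sub_eq_zero] at h5
          rwa [h5]
        · change Ideal.Quotient.mk _ _ = φ i
          conv_rhs => rw [← Ideal.Quotient.mk_out (φ i)]
          rw [mk_eq_mk_iff_dvd]
          have h4 := (dvd_out_mk_sub (ϖ := ϖ) (n := n + 1) u).mul_right (φ₀ i)
          convert dvd_sub h4 (h3 i) using 1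
          ring
    rw [← hbij, ← Nat.cast_pow, ← Nat.cast_pow, ← Nat.cast_add, hcard]
  · intro φ hφ
    rw [Set.Finite.mem_toFinset]
    have h1 := (Finset.mem_filter.1 hφ).2
    exact ⟨dotLat_mem_latLevel hϖ h1 _, latRank_dotLat hϖ h1 n⟩

end Residues

/-! ### The domain of convergence -/

section SmallNorm

variable {𝕜 : Type*} [RCLike 𝕜] {q : ℕ} {t : 𝕜}

/-- The single bound `q⁶ ‖t‖ < 1`, that is `Re s > 6`, makes every geometric ratio that occurs
small. -/
lemma norm_natCast_pow_mul_pow_lt_one (hq : 1 < q) (ht : (q : ℝ) ^ 6 * ‖t‖ < 1) {a b : ℕ}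
    (ha : a ≤ 6) (hb : b ≠ 0) : ‖(q : 𝕜) ^ a * t ^ b‖ < 1 := by
  have hq1 : (1 : ℝ) ≤ q := by exact_mod_cast hq.le
  have h6 : (1 : ℝ) ≤ (q : ℝ) ^ 6 := one_le_pow₀ hq1
  have ht1 : ‖t‖ ≤ 1 := by nlinarith [norm_nonneg t]
  rw [norm_mul, norm_pow, norm_pow, RCLike.norm_natCast]
  calc (q : ℝ) ^ a * ‖t‖ ^ b ≤ (q : ℝ) ^ 6 * ‖t‖ ^ 1 := by
        apply mul_le_mul (pow_le_pow_right₀ hq1 ha)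
          (pow_le_pow_of_le_one (norm_nonneg t) ht1 (Nat.one_le_iff_ne_zero.2 hb))
          (by positivity) (by positivity)
    _ < 1 := by rwa [pow_one]

lemma one_sub_ne_zero_of_norm_lt_one {c : 𝕜} (hc : ‖c‖ < 1) : 1 - c ≠ 0 := by
  intro h
  rw [sub_eq_zero] at h
  rw [← h, norm_one] at hc
  exact lt_irrefl _ hc

end SmallNorm

/-! ### The zeta function of `O³` -/

section FreeZeta

variable {O : Type*} [CommRing O] [IsDomain O] [IsDiscreteValuationRing O]
  [Finite (ResidueField O)]

lemma latLen_dotLat {ϖ : O} (hϖ : Irreducible ϖ) {φ : Fin 3 → O} (hφ : redVec O φ ≠ 0) (n : ℕ) :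
    latLen (dotLat ϖ φ n) = n := by
  induction n with
  | zero => rw [dotLat_zero, latLen_top]
  | succ n ih =>
    rw [(isLat_of_mem_latLevel (dotLat_mem_latLevel hϖ hφ (n + 1))).latLen_eq hϖ,
      latColon_dotLat hϖ, ih, latRank_dotLat hϖ hφ]

lemma finsum_const_mul_ite {𝕜 α : Type*} [Field 𝕜] [Finite α] (P : α → Prop) [DecidablePred P]
    (c : 𝕜) : ∑ᶠ x, (if P x then c else 0) = Nat.card {x // P x} * c := by
  classical
  have := Fintype.ofFinite α
  rw [finsum_eq_sum_of_fintype, ← Finset.sum_filter, Finset.sum_const, nsmul_eq_mul,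
    Nat.subtype_card (Finset.univ.filter P) (by simp)]

lemma natCard_vec_ne_zero (F : Type*) [Field F] [Finite F] :
    Nat.card {ψ : Fin 3 → F // ψ ≠ 0} + 1 = Nat.card F ^ 3 := by
  have h1 := Set.ncard_add_ncard_compl ({0} : Set (Fin 3 → F))
  rw [Set.ncard_singleton, add_comm] at h1
  rw [← Nat.card_coe_set_eq] at h1
  have h2 : Nat.card (Fin 3 → F) = Nat.card F ^ 3 := by simp [Nat.card_pi]
  rw [← h2, ← h1]
  rfl

lemma ne_one_of_one_lt {𝕜 : Type*} [RCLike 𝕜] {q : ℕ} (hq : 1 < q) : (q : 𝕜) - 1 ≠ 0 := by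
  rw [sub_ne_zero]
  exact_mod_cast hq.ne'

lemma pow_succ_sub_pow_ne_zero {𝕜 : Type*} [RCLike 𝕜] {q : ℕ} (hq : 1 < q) (n : ℕ) :
    (q : 𝕜) ^ (n + 1) - (q : 𝕜) ^ n ≠ 0 := by
  have h1 : (q : 𝕜) ≠ 0 := by exact_mod_cast (by omega : q ≠ 0)
  rw [pow_succ, ← mul_sub_one]
  exact mul_ne_zero (pow_ne_zero n h1) (ne_one_of_one_lt hq)

open Classical in
lemma resSum_primitive {𝕜 : Type*} [RCLike 𝕜] {ϖ : O} (hϖ : Irreducible ϖ) (n : ℕ) :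
    resSum ϖ (n + 1) (fun φ => if redVec O φ ≠ 0 then (1 : 𝕜) else 0) =
      ((Nat.card (ResidueField O) : 𝕜) ^ 3 - 1) * ((Nat.card (ResidueField O) : 𝕜) ^ 3) ^ n := by
  induction n with
  | zero =>
    rw [zero_add, resSum_one hϖ (fun φ φ' h => by simp only [h])]
    have h1 (ψ : Fin 3 → ResidueField O) : redVec O (fun i => liftRes (ψ i)) = ψ := by
      ext; simp
    simp only [h1]
    rw [finsum_const_mul_ite, pow_zero, mul_one, mul_one, eq_sub_iff_add_eq]
    exact_mod_cast natCard_vec_ne_zero (ResidueField O)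
  | succ n ih =>
    rw [resSum_succ hϖ (n + 1)
      (fun φ φ' h => by simp only [redVec_out_congr hϖ (n := n + 1) h])]
    have h1 (φ : Fin 3 → O) : (∑ᶠ ψ : Fin 3 → ResidueField O,
        if redVec O (fun i => φ i + ϖ ^ (n + 1) * liftRes (ψ i)) ≠ 0 then (1 : 𝕜) else 0) =
        (Nat.card (ResidueField O) : 𝕜) ^ 3 * if redVec O φ ≠ 0 then (1 : 𝕜) else 0 := by
      have h2 (ψ : Fin 3 → ResidueField O) :
          redVec O (fun i => φ i + ϖ ^ (n + 1) * liftRes (ψ i)) = redVec O φ :=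
        redVec_out_congr hϖ (n := n) fun i => by simp
      simp only [h2]
      have := Fintype.ofFinite (ResidueField O)
      rw [finsum_eq_sum_of_fintype, Finset.sum_const, nsmul_eq_mul, Finset.card_univ,
        ← Nat.card_eq_fintype_card, Nat.card_pi, Finset.prod_const, Finset.card_fin, Nat.cast_pow]
    rw [resSum_congr h1, resSum_mul_left hϖ, ih]
    ring

lemma freeZeta_identity {K : Type*} [Field K] {q t : K} (h1 : 1 - t ≠ 0) (h2 : 1 - q * t ≠ 0)
    (h3 : 1 - q ^ 2 * t ≠ 0) (h4 : 1 - q ^ 2 * t ^ 2 ≠ 0) (h5 : 1 - t ^ 3 ≠ 0) :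
    1 / ((1 - t) * (1 - q * t) * (1 - q ^ 2 * t)) =
      (1 + (q ^ 2 + q + 1) * t / (1 - q ^ 2 * t) +
        t ^ 2 * (q ^ 2 + q + 1 + (q ^ 2 + q) * ((q ^ 2 + q + 1) * t / (1 - q ^ 2 * t))) /
          (1 - q ^ 2 * t ^ 2)) /
      (1 - t ^ 3) := by
  -- The denominators are named so that `field_simp` treats them as atoms.
  obtain ⟨A, hA⟩ : ∃ A, A = 1 - q * t := ⟨_, rfl⟩
  obtain ⟨B, hB⟩ : ∃ B, B = 1 - q ^ 2 * t := ⟨_, rfl⟩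
  obtain ⟨C, hC⟩ : ∃ C, C = 1 - q ^ 2 * t ^ 2 := ⟨_, rfl⟩
  obtain ⟨E, hE⟩ : ∃ E, E = 1 - t ^ 3 := ⟨_, rfl⟩
  rw [← hA] at h2 ⊢
  rw [← hB] at h3 ⊢
  rw [← hC] at h4 ⊢
  rw [← hE] at h5 ⊢
  field_simp
  subst hA hB hC hE
  ring
/-- The sum of `t ^ len(O³/Λ)` over all lattices `Λ`, by levels. -/
theorem hasSum_latLevel_pow_latLen {𝕜 : Type*} [RCLike 𝕜] {ϖ : O} (hϖ : Irreducible ϖ) {t : 𝕜}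
    {q : ℕ} (hq : q = Nat.card (ResidueField O)) (ht : (q : ℝ) ^ 6 * ‖t‖ < 1) :
    HasSum (fun n => ∑ᶠ Λ ∈ latLevel ϖ n, t ^ latLen Λ)
      (1 / ((1 - t) * (1 - q * t) * (1 - (q : 𝕜) ^ 2 * t))) := by
  classical
  have hq1 : 1 < q := hq ▸ Finite.one_lt_card
  have hne (a b : ℕ) (ha : a ≤ 6) (hb : b ≠ 0) : 1 - (q : 𝕜) ^ a * t ^ b ≠ 0 :=
    one_sub_ne_zero_of_norm_lt_one (norm_natCast_pow_mul_pow_lt_one hq1 ht ha hb)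
  -- The factor `(q² + q + 1) q²ⁿ` is the number of points of the projective plane over `O/ϖⁿ⁺¹`.
  have hL (n : ℕ) : levelSum ϖ (fun Λ => t ^ latLen Λ) 2 (n + 1) =
      ((q : 𝕜) ^ 2 + q + 1) * ((q : 𝕜) ^ 2) ^ n * t ^ (n + 1) := by
    have h1 := resSum_dotLat hϖ n (fun Λ => t ^ latLen Λ)
    have h2 (φ : Fin 3 → O) : (if redVec O φ ≠ 0 then t ^ latLen (dotLat ϖ φ (n + 1)) else 0) =
        t ^ (n + 1) * (if redVec O φ ≠ 0 then 1 else 0) := by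
      split_ifs with h
      · rw [latLen_dotLat hϖ h, mul_one]
      · rw [mul_zero]
    rw [resSum_congr h2, resSum_mul_left hϖ, resSum_primitive hϖ, ← hq] at h1
    refine mul_left_cancel₀ (pow_succ_sub_pow_ne_zero (𝕜 := 𝕜) hq1 n) ?_
    rw [← h1]
    ring
  have hT : HasSum (fun n => levelSum ϖ (fun Λ => t ^ latLen Λ) 2 n)
      (((q : 𝕜) ^ 2 + q + 1) * t / (1 - (q : 𝕜) ^ 2 * t)) := by
    have hc := norm_natCast_pow_mul_pow_lt_one hq1 ht (a := 2) (by norm_num) one_ne_zero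
    rw [pow_one] at hc
    have := hasSum_of_linear_recursion (x := fun n => levelSum ϖ (fun Λ => t ^ latLen Λ) 2 n)
      (a := fun n => if n = 0 then ((q : 𝕜) ^ 2 + q + 1) * t else 0) (c := (q : 𝕜) ^ 2 * t)
      hc ?_ (hasSum_ite_eq 0 _)
    · rwa [levelSum_zero _ (by norm_num), zero_add] at this
    · intro n
      cases n with
      | zero => rw [levelSum_zero _ (by norm_num), hL]; simp
      | succ n => rw [hL, hL]; simp only [Nat.succ_ne_zero, if_false]; ring
  have hz := norm_natCast_pow_mul_pow_lt_one hq1 ht (a := 0) (by norm_num) three_ne_zero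
  rw [pow_zero, one_mul] at hz
  -- The length grows by `3 - r` for rank `r`, whence `t²` and `t³`.
  have := hasSum_latLevel hϖ (W := fun Λ => t ^ latLen Λ) (y := t ^ 2) (z := t ^ 3)
    (q := (q : 𝕜)) (by rw [hq])
    (norm_natCast_pow_mul_pow_lt_one hq1 ht (by norm_num) two_ne_zero) hz (by simp [latLen_top])
    (fun Λ h hr => by rw [h.latLen_eq hϖ, hr, pow_add, mul_comm])
    (fun Λ h hr => by rw [h.latLen_eq hϖ, hr, pow_add, mul_comm]) hT
  convert this using 1
  have h1 := hne 0 1 (by norm_num) one_ne_zero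
  have h2 := hne 1 1 (by norm_num) one_ne_zero
  have h3 := hne 2 1 (by norm_num) one_ne_zero
  have h4 := hne 2 2 (by norm_num) two_ne_zero
  have h5 := hne 0 3 (by norm_num) (by norm_num)
  simp only [pow_zero, one_mul, pow_one] at h1 h2 h3 h5
  exact freeZeta_identity h1 h2 h3 h4 h5

end FreeZeta

/-! ### The largest lattice mapped into a given one -/

section EllipticLattices

variable {O : Type*} [CommRing O] [IsDomain O] [IsDiscreteValuationRing O]

/-- The three maps `f_j` on `O³`. -/
def ellArrow (O : Type*) [CommRing O] (D : ℤ) (j : Fin 3) : (Fin 3 → O) →ₗ[O] (Fin 3 → O) :=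
  Matrix.mulVecLin (match j with
    | 0 => !![0, 1, 0; 0, 0, 1; (D : O), 0, 0]
    | 1 => !![1, 0, 0; 0, 0, 0; 0, 1, 0]
    | 2 => !![0, 0, 1; 1, 0, 0; 0, 0, 0])

lemma ellArrow_zero (D : ℤ) (x : Fin 3 → O) : ellArrow O D 0 x = ![x 1, x 2, D * x 0] := by
  ext i
  fin_cases i <;> simp [ellArrow, Matrix.mulVec, dotProduct, Fin.sum_univ_three]

lemma ellArrow_one (D : ℤ) (x : Fin 3 → O) : ellArrow O D 1 x = ![x 0, 0, x 1] := by
  ext i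
  fin_cases i <;> simp [ellArrow, Matrix.mulVec, dotProduct, Fin.sum_univ_three]

lemma ellArrow_two (D : ℤ) (x : Fin 3 → O) : ellArrow O D 2 x = ![x 2, x 0, 0] := by
  ext i
  fin_cases i <;> simp [ellArrow, Matrix.mulVec, dotProduct, Fin.sum_univ_three]

/-- The largest lattice that is mapped into `Λ` by the three maps `f_j`. -/
def ellPre (D : ℤ) (Λ : Submodule O (Fin 3 → O)) : Submodule O (Fin 3 → O) :=
  ⨅ j, Λ.comap (ellArrow O D j)

lemma mem_ellPre {D : ℤ} {Λ : Submodule O (Fin 3 → O)} {x : Fin 3 → O} :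
    x ∈ ellPre D Λ ↔ ∀ j, ellArrow O D j x ∈ Λ := by
  simp [ellPre]

lemma ellPre_top (D : ℤ) : ellPre D (⊤ : Submodule O (Fin 3 → O)) = ⊤ := by
  simp [ellPre]

/-- This compatibility lets the lengths of `Λ` and of `ellPre D Λ` be followed by the same
recursion. -/
lemma latColon_ellPre (ϖ : O) (D : ℤ) (Λ : Submodule O (Fin 3 → O)) :
    latColon ϖ (ellPre D Λ) = ellPre D (latColon ϖ Λ) := by
  ext x
  simp only [mem_latColon, mem_ellPre, map_smul]

lemma IsLat.ellPre {ϖ : O} {D : ℤ} {Λ : Submodule O (Fin 3 → O)} (h : IsLat ϖ Λ) :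
    IsLat ϖ (ellPre D Λ) := by
  obtain ⟨n, hn⟩ := h
  exact ⟨n, fun y => mem_ellPre.2 fun j => by rw [map_smul]; exact hn _⟩

lemma latRank_eq_zero_iff {Λ : Submodule O (Fin 3 → O)} :
    latRank Λ = 0 ↔ ∀ x ∈ Λ, redVec O x = 0 := by
  rw [latRank, Submodule.finrank_eq_zero, eq_bot_iff, Submodule.map_le_iff_le_comap]
  rfl

/-- If `Λ` reduces into a line, the three images of `x` are proportional mod `ϖ`, so their 2 × 2
minors vanish. Among these are `x₀²`, `x₁² - D x₀²` and `x₀ x₁ - x₂²`, up to sign. -/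
lemma latRank_ellPre_eq_zero (D : ℤ) {Λ : Submodule O (Fin 3 → O)} (h : latRank Λ ≤ 1) :
    latRank (ellPre D Λ) = 0 := by
  rw [latRank_eq_zero_iff]
  intro x hx
  rw [mem_ellPre] at hx
  obtain ⟨v, hv⟩ := finrank_le_one_iff.1 h
  have hmem (j : Fin 3) : ∃ c : ResidueField O, c • (v : Fin 3 → ResidueField O) =
      redVec O (ellArrow O D j x) := by
    obtain ⟨c, hc⟩ := hv ⟨redVec O (ellArrow O D j x), _, hx j, rfl⟩
    exact ⟨c, congrArg Subtype.val hc⟩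
  obtain ⟨a, ha⟩ := hmem 0
  obtain ⟨b, hb⟩ := hmem 1
  obtain ⟨c, hc⟩ := hmem 2
  rw [ellArrow_zero] at ha
  rw [ellArrow_one] at hb
  rw [ellArrow_two] at hc
  have ha0 := congrFun ha 0
  have ha1 := congrFun ha 1
  have ha2 := congrFun ha 2
  have hb0 := congrFun hb 0
  have hb1 := congrFun hb 1
  have hb2 := congrFun hb 2
  have hc0 := congrFun hc 0
  have hc1 := congrFun hc 1
  have hc2 := congrFun hc 2
  simp only [Pi.smul_apply, smul_eq_mul, redVec_apply, Matrix.cons_val, map_zero, map_mul] at *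
  have h0 : residue O (x 0) = 0 := by
    have : residue O (x 0) * residue O (x 0) = 0 := by
      linear_combination (-residue O (x 0)) * hb0 - b * v.1 0 * hc1 + c * v.1 0 * hb1
    simpa using this
  have h1 : residue O (x 1) = 0 := by
    have : residue O (x 1) * residue O (x 1) = 0 := by
      linear_combination (-residue O (x 1)) * ha0 - a * v.1 0 * hb2 + b * v.1 0 * ha2 +
        residue O D * residue O (x 0) * hb0 + residue O D * residue O (x 0) * h0
    simpa using this
  have h2 : residue O (x 2) = 0 := by
    have : residue O (x 2) * residue O (x 2) = 0 := by
      linear_combination (-residue O (x 2)) * hc0 - c * v.1 0 * ha1 + a * v.1 0 * hc1 +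
        residue O (x 0) * ha0 + residue O (x 1) * h0
    simpa using this
  ext i
  fin_cases i <;> assumption

/-- The ternary cubic form that defines the curve. -/
def ellForm {R : Type*} [CommRing R] (D : ℤ) (φ : Fin 3 → R) : R :=
  D * φ 2 ^ 2 * φ 0 - φ 0 ^ 3 - φ 2 * φ 1 ^ 2

lemma residue_ellForm (D : ℤ) (φ : Fin 3 → O) :
    residue O (ellForm D φ) = ellForm D (redVec O φ) := by
  simp [ellForm]

/-- There is one congruence for each arrow. The coefficient matrix is symmetric, with determinant
`ellForm D φ`. -/
lemma mem_ellPre_dotLat {ϖ : O} {D : ℤ} {φ x : Fin 3 → O} {n : ℕ} :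
    x ∈ ellPre D (dotLat ϖ φ n) ↔ ϖ ^ n ∣ D * φ 2 * x 0 + φ 0 * x 1 + φ 1 * x 2 ∧
      ϖ ^ n ∣ φ 0 * x 0 + φ 2 * x 1 ∧ ϖ ^ n ∣ φ 1 * x 0 + φ 0 * x 2 := by
  rw [mem_ellPre, Fin.forall_fin_succ, Fin.forall_fin_two]
  simp only [Fin.succ_zero_eq_one, Fin.succ_one_eq_two, ellArrow_zero, ellArrow_one, ellArrow_two,
    mem_dotLat, dotProduct, Fin.sum_univ_three, Matrix.cons_val]
  ring_nf

/-- The matrix of linear forms has rank at least two everywhere. -/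
lemma finrank_le_one_of_ellMatrix {F : Type*} [Field F] {d u v w : F} (hd : d ≠ 0)
    (h : u ≠ 0 ∨ v ≠ 0 ∨ w ≠ 0) (U : Submodule F (Fin 3 → F))
    (hU : ∀ x ∈ U, d * w * x 0 + u * x 1 + v * x 2 = 0 ∧ u * x 0 + w * x 1 = 0 ∧
      v * x 0 + u * x 2 = 0) :
    finrank F U ≤ 1 := by
  suffices ∃ g : Fin 3 → F, U ≤ Submodule.span F {g} by
    obtain ⟨g, hg⟩ := this
    exact (Submodule.finrank_mono hg).trans ((finrank_span_le_card _).trans (by simp))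
  simp only [SetLike.le_def, Submodule.mem_span_singleton]
  by_cases hu : u = 0
  · subst hu
    by_cases hw : w = 0
    · subst hw
      have hv : v ≠ 0 := by simpa using h
      refine ⟨![0, 1, 0], fun x hx => ⟨x 1, ?_⟩⟩
      obtain ⟨h1, -, h3⟩ := hU x hx
      have h4 : x 2 = 0 := by simpa [hv] using h1
      have h5 : x 0 = 0 := by simpa [hv] using h3
      ext i; fin_cases i <;> simp [h4, h5]
    · refine ⟨![-(v / (d * w)), 0, 1], fun x hx => ⟨x 2, ?_⟩⟩
      obtain ⟨h1, h2, -⟩ := hU x hx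
      have h4 : x 1 = 0 := by simpa [hw] using h2
      have h5 : x 0 = - (v / (d * w)) * x 2 := by
        field_simp
        linear_combination h1
      ext i; fin_cases i <;> simp [h4, h5, mul_comm]
  · refine ⟨![-(w / u), 1, v * w / u ^ 2], fun x hx => ⟨x 1, ?_⟩⟩
    obtain ⟨-, h2, h3⟩ := hU x hx
    have h4 : x 0 = - (w / u) * x 1 := by
      field_simp
      linear_combination h2
    have h5 : x 2 = v * w / u ^ 2 * x 1 := by
      rw [h4] at h3
      field_simp at h3 ⊢
      linear_combination h3
    ext i; fin_cases i <;> simp [h4, h5, mul_comm]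

/-- The matrix has rank at least two mod `ϖ`, so the solutions reduce into a line. If the
determinant is divisible by `ϖⁿ⁺¹`, a row of the adjugate that is nonzero mod `ϖ` is a solution. If
some solution has a unit coordinate, Cramer's rule makes the determinant divisible. -/
lemma latRank_ellPre_dotLat {ϖ : O} (hϖ : Irreducible ϖ) {D : ℤ}
    (hD : (D : ResidueField O) ≠ 0) {φ : Fin 3 → O} (hφ : redVec O φ ≠ 0) (n : ℕ)
    [Decidable (ϖ ^ (n + 1) ∣ ellForm D φ)] :
    latRank (ellPre D (dotLat ϖ φ (n + 1))) = if ϖ ^ (n + 1) ∣ ellForm D φ then 1 else 0 := by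
  have hres (a : O) (ha : ϖ ^ (n + 1) ∣ a) : residue O a = 0 :=
    (residue_eq_zero_iff_dvd hϖ a).2 ((dvd_pow_self ϖ n.succ_ne_zero).trans ha)
  have hφ' : residue O (φ 0) ≠ 0 ∨ residue O (φ 1) ≠ 0 ∨ residue O (φ 2) ≠ 0 := by
    by_contra! h
    refine hφ (funext fun i => ?_)
    fin_cases i
    exacts [h.1, h.2.1, h.2.2]
  split_ifs with h
  · apply le_antisymm
    · refine finrank_le_one_of_ellMatrix hD hφ' _ ?_
      rintro _ ⟨x, hx, rfl⟩
      obtain ⟨h1, h2, h3⟩ := mem_ellPre_dotLat.1 hx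
      have h1 := hres _ h1
      have h2 := hres _ h2
      have h3 := hres _ h3
      simp only [map_add, map_mul, map_intCast] at h1 h2 h3
      exact ⟨h1, h2, h3⟩
    · rw [Nat.one_le_iff_ne_zero, Ne, latRank_eq_zero_iff]
      intro h0
      have hδ : ϖ ^ (n + 1) ∣ D * φ 2 ^ 2 * φ 0 - φ 0 ^ 3 - φ 2 * φ 1 ^ 2 := h
      -- The witnesses are the rows of the adjugate. Their diagonal entries reduce to `-φ₁²` if `φ₀`
      -- and `φ₂` vanish mod `ϖ`, and to `D φ₂²` if only `φ₀` is known to vanish; otherwise the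
      -- first row has the entry `-φ₀²`.
      by_cases hu : residue O (φ 0) = 0
      · by_cases hw : residue O (φ 2) = 0
        · have hv : residue O (φ 1) ≠ 0 := by simpa [hu, hw] using hφ'
          have h1 := h0 ![-φ 0 ^ 2, D * φ 2 * φ 0 - φ 1 ^ 2, φ 0 * φ 1] (mem_ellPre_dotLat.2 ?_)
          · have := congrFun h1 1
            simp [hu, hv] at this
          · simp only [Matrix.cons_val]
            refine ⟨?_, ?_, ?_⟩
            · convert dvd_zero (ϖ ^ (n + 1)) using 1; ring
            · convert hδ using 1; ring
            · convert dvd_zero (ϖ ^ (n + 1)) using 1; ring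
        · have h1 := h0 ![-φ 2 * φ 1, φ 0 * φ 1, D * φ 2 ^ 2 - φ 0 ^ 2] (mem_ellPre_dotLat.2 ?_)
          · have := congrFun h1 2
            simp [hu, hw, hD] at this
          · simp only [Matrix.cons_val]
            refine ⟨?_, ?_, ?_⟩
            · convert dvd_zero (ϖ ^ (n + 1)) using 1; ring
            · convert dvd_zero (ϖ ^ (n + 1)) using 1; ring
            · convert hδ using 1; ring
      · have h1 := h0 ![φ 2 * φ 0, -φ 0 ^ 2, -φ 2 * φ 1] (mem_ellPre_dotLat.2 ?_)
        · have := congrFun h1 1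
          simp [hu] at this
        · simp only [Matrix.cons_val]
          refine ⟨?_, ?_, ?_⟩
          · convert hδ using 1; ring
          · convert dvd_zero (ϖ ^ (n + 1)) using 1; ring
          · convert dvd_zero (ϖ ^ (n + 1)) using 1; ring
  · rw [latRank_eq_zero_iff]
    intro x hx
    by_contra hx0
    obtain ⟨i, hi⟩ := exists_isUnit_of_redVec_ne_zero hx0
    obtain ⟨h1, h2, h3⟩ := mem_ellPre_dotLat.1 hx
    -- Cramer's rule: the congruences are combined with the row of the adjugate that isolates the
    -- unit coordinate `x i`.
    refine h ?_
    rw [← hi.dvd_mul_right, ellForm]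
    fin_cases i
    · convert dvd_sub (dvd_sub (h1.mul_left (φ 2 * φ 0)) (h2.mul_left (φ 0 ^ 2)))
        (h3.mul_left (φ 2 * φ 1)) using 1
      simp only [Fin.zero_eta]
      ring
    · convert dvd_add (dvd_add (h1.mul_left (-φ 0 ^ 2))
        (h2.mul_left (D * φ 2 * φ 0 - φ 1 ^ 2))) (h3.mul_left (φ 0 * φ 1)) using 1
      simp only [Fin.mk_one]
      ring
    · convert dvd_add (dvd_add (h1.mul_left (-φ 2 * φ 1))
        (h2.mul_left (φ 0 * φ 1))) (h3.mul_left (D * φ 2 ^ 2 - φ 0 ^ 2)) using 1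
      simp only [Fin.reduceFinMk]
      ring

variable [Finite (ResidueField O)]

/-- The exponent of `q⁻ˢ` in the contribution of `Λ` to the zeta function. -/
def ellLen (D : ℤ) (Λ : Submodule O (Fin 3 → O)) : ℕ := latLen Λ + latLen (ellPre D Λ)

lemma ellLen_of_latRank_le_one {ϖ : O} (hϖ : Irreducible ϖ) (D : ℤ)
    {Λ : Submodule O (Fin 3 → O)} (h : IsLat ϖ Λ) (hr : latRank Λ ≤ 1) :
    ellLen D Λ = ellLen D (latColon ϖ Λ) + (6 - latRank Λ) := by
  rw [ellLen, ellLen, h.latLen_eq hϖ, (h.ellPre (D := D)).latLen_eq hϖ,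
    latRank_ellPre_eq_zero D hr, latColon_ellPre]
  omega

/-- The lattice itself contributes 1 and `ellPre` contributes 3 minus its rank. -/
lemma ellLen_dotLat_succ {ϖ : O} (hϖ : Irreducible ϖ) {D : ℤ}
    (hD : (D : ResidueField O) ≠ 0) {φ : Fin 3 → O} (hφ : redVec O φ ≠ 0) (n : ℕ)
    [Decidable (ϖ ^ (n + 1) ∣ ellForm D φ)] :
    ellLen D (dotLat ϖ φ (n + 1)) =
      ellLen D (dotLat ϖ φ n) + if ϖ ^ (n + 1) ∣ ellForm D φ then 3 else 4 := by
  have h := isLat_of_mem_latLevel (dotLat_mem_latLevel hϖ hφ (n + 1))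
  rw [ellLen, ellLen, (h.ellPre (D := D)).latLen_eq hϖ, latColon_ellPre, latColon_dotLat hϖ,
    latRank_ellPre_dotLat hϖ hD hφ, latLen_dotLat hϖ hφ, latLen_dotLat hϖ hφ]
  split_ifs <;> omega

end EllipticLattices

/-! ### Hensel lifting on the cubic and the sum over lattices -/

section Hensel

/-- The number of points of an affine plane in `F³`. -/
lemma natCard_affine_plane {F : Type*} [Field F] [Finite F] {g : Fin 3 → F} (hg : g ≠ 0) (e : F) :
    Nat.card {ψ : Fin 3 → F // e + g ⬝ᵥ ψ = 0} = Nat.card F ^ 2 := by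
  obtain ⟨i, hi⟩ := Function.ne_iff.1 hg
  let ℓ : (Fin 3 → F) →ₗ[F] F := dotProductBilin F F g
  have hℓ : LinearMap.range ℓ = ⊤ := by
    rw [LinearMap.range_eq_top]
    intro c
    refine ⟨Pi.single i (c / g i), ?_⟩
    change g ⬝ᵥ _ = c
    rw [dotProduct_single, mul_div_cancel₀ _ hi]
  obtain ⟨ψ₀, hψ₀⟩ := LinearMap.range_eq_top.1 hℓ (-e)
  change g ⬝ᵥ ψ₀ = -e at hψ₀
  have h1 : Nat.card {ψ : Fin 3 → F // e + g ⬝ᵥ ψ = 0} = Nat.card (LinearMap.ker ℓ) := by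
    symm
    refine Nat.card_eq_of_bijective (fun ψ => ⟨ψ.1 + ψ₀, ?_⟩) ⟨?_, ?_⟩
    · have h2 : g ⬝ᵥ ψ.1 = 0 := ψ.2
      rw [dotProduct_add, h2, hψ₀]
      ring
    · intro ψ ψ' h
      exact Subtype.ext (add_right_cancel (congrArg Subtype.val h))
    · rintro ⟨ψ, hψ⟩
      refine ⟨⟨ψ - ψ₀, ?_⟩, Subtype.ext (sub_add_cancel ψ ψ₀)⟩
      change g ⬝ᵥ (ψ - ψ₀) = 0
      rw [dotProduct_sub, hψ₀, sub_neg_eq_add, add_comm, hψ]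
  have h2 := LinearMap.finrank_range_add_finrank_ker ℓ
  rw [hℓ, finrank_top, finrank_self, finrank_fin_fun] at h2
  rw [h1, Module.natCard_eq_pow_finrank (K := F)]
  congr 1
  omega

/-- The gradient of the cubic form. -/
def ellGrad {R : Type*} [CommRing R] (D : ℤ) (φ : Fin 3 → R) : Fin 3 → R :=
  ![D * φ 2 ^ 2 - 3 * φ 0 ^ 2, -2 * φ 2 * φ 1, 2 * D * φ 2 * φ 0 - φ 1 ^ 2]

lemma ellForm_add_smul {R : Type*} [CommRing R] (D : ℤ) (φ ψ : Fin 3 → R) (h : R) :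
    ∃ r, ellForm D (fun i => φ i + h * ψ i) =
      ellForm D φ + h * (ellGrad D φ ⬝ᵥ ψ) + h ^ 2 * r := by
  refine ⟨D * (2 * φ 2 * ψ 2 * ψ 0 + ψ 2 ^ 2 * φ 0 + h * ψ 2 ^ 2 * ψ 0) -
    (3 * φ 0 * ψ 0 ^ 2 + h * ψ 0 ^ 3) -
    (2 * φ 1 * ψ 1 * ψ 2 + φ 2 * ψ 1 ^ 2 + h * ψ 2 * ψ 1 ^ 2), ?_⟩
  simp only [ellForm, ellGrad, dotProduct, Fin.sum_univ_three, Matrix.cons_val]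
  ring

/-- Smoothness of the projective cubic, which needs `2D ≠ 0`. -/
lemma ellGrad_ne_zero {F : Type*} [Field F] {D : ℤ} (h2 : (2 : F) ≠ 0) (hD : (D : F) ≠ 0)
    {φ : Fin 3 → F} (hφ : φ ≠ 0) (h : ellForm D φ = 0) : ellGrad D φ ≠ 0 := by
  intro hg
  have g0 := congrFun hg 0
  have g1 := congrFun hg 1
  have g2 := congrFun hg 2
  simp only [ellGrad, Matrix.cons_val, Pi.zero_apply] at g0 g1 g2
  rw [ellForm] at h
  apply hφ
  by_cases hw : φ 2 = 0
  · simp only [hw] at h g2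
    have hu : φ 0 = 0 := by simpa using h
    have hv : φ 1 = 0 := by simpa using g2
    ext i
    fin_cases i <;> assumption
  · exfalso
    have hv : φ 1 = 0 := by simpa [h2, hw] using g1
    have hu : φ 0 = 0 := by simpa [hv, h2, hD, hw] using g2
    simp [hu, hD, hw] at g0

variable {O : Type*} [CommRing O] [IsDomain O] [IsDiscreteValuationRing O]

lemma redVec_ellGrad (D : ℤ) (φ : Fin 3 → O) :
    redVec O (ellGrad D φ) = ellGrad D (redVec O φ) := by
  ext i
  fin_cases i <;> simp only [ellGrad, redVec_apply, Fin.zero_eta, Fin.mk_one, Fin.reduceFinMk,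
    Matrix.cons_val, map_sub, map_mul, map_neg, map_pow, map_ofNat, map_intCast]

variable [Finite (ResidueField O)]

/-- If `ellForm D φ = ϖⁿ⁺¹ e`, the lifting condition is the affine equation `e + grad · ψ = 0` over
`k`, because the quadratic remainder is divisible by `ϖ^(2n+2)`. Smoothness makes its solution set a
plane. -/
lemma natCard_hensel {ϖ : O} (hϖ : Irreducible ϖ) {D : ℤ} (h2 : (2 : ResidueField O) ≠ 0)
    (hD : (D : ResidueField O) ≠ 0) {φ : Fin 3 → O} (hφ : redVec O φ ≠ 0) (n : ℕ)
    [Decidable (ϖ ^ (n + 1) ∣ ellForm D φ)] :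
    Nat.card {ψ : Fin 3 → ResidueField O //
      ϖ ^ (n + 2) ∣ ellForm D (fun i => φ i + ϖ ^ (n + 1) * liftRes (ψ i))} =
      if ϖ ^ (n + 1) ∣ ellForm D φ then Nat.card (ResidueField O) ^ 2 else 0 := by
  split_ifs with h
  · obtain ⟨e, he⟩ := h
    have hg : redVec O (ellGrad D φ) ≠ 0 := by
      rw [redVec_ellGrad]
      refine ellGrad_ne_zero h2 hD hφ ?_
      rw [← residue_ellForm, residue_eq_zero_iff_dvd hϖ, he]
      exact (dvd_pow_self ϖ n.succ_ne_zero).mul_right _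
    rw [← natCard_affine_plane hg (residue O e)]
    refine Nat.card_congr (Equiv.subtypeEquivRight fun ψ => ?_)
    obtain ⟨r, hr⟩ := ellForm_add_smul D φ (fun i => liftRes (ψ i)) (ϖ ^ (n + 1))
    have h3 : redVec O (fun i => liftRes (ψ i)) = ψ := by ext; simp
    rw [hr, he, ← mul_add, dvd_add_left, pow_succ ϖ (n + 1),
      mul_dvd_mul_iff_left (pow_ne_zero _ hϖ.ne_zero), ← residue_eq_zero_iff_dvd hϖ, map_add,
      residue_dotProduct, h3]
    rw [← pow_mul]
    exact (pow_dvd_pow ϖ (by omega)).mul_right r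
  · have : IsEmpty {ψ : Fin 3 → ResidueField O //
        ϖ ^ (n + 2) ∣ ellForm D (fun i => φ i + ϖ ^ (n + 1) * liftRes (ψ i))} := by
      refine ⟨fun ψ => h ?_⟩
      obtain ⟨r, hr⟩ := ellForm_add_smul D φ (fun i => liftRes (ψ.1 i)) (ϖ ^ (n + 1))
      have h3 := ψ.2
      rw [hr] at h3
      have h4 := (pow_dvd_pow ϖ (Nat.le_succ (n + 1))).trans h3
      rw [dvd_add_left (by rw [pow_two, mul_assoc]; exact Dvd.intro _ rfl),
        dvd_add_left (Dvd.intro _ rfl)] at h4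
      exact h4
    exact Nat.card_of_isEmpty

lemma dotLat_congr {ϖ : O} {φ φ' : Fin 3 → O} {n : ℕ} (h : ∀ i, ϖ ^ n ∣ φ i - φ' i) :
    dotLat ϖ φ n = dotLat ϖ φ' n := by
  ext y
  have h1 : ϖ ^ n ∣ φ ⬝ᵥ y - φ' ⬝ᵥ y := by
    rw [← sub_dotProduct]
    exact Finset.dvd_sum fun i _ => (h i).mul_right _
  rw [mem_dotLat, mem_dotLat, dvd_iff_dvd_of_dvd_sub h1]

lemma dvd_ellForm_congr {ϖ : O} {D : ℤ} {φ φ' : Fin 3 → O} {n : ℕ}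
    (h : ∀ i, ϖ ^ n ∣ φ i - φ' i) : ϖ ^ n ∣ ellForm D φ ↔ ϖ ^ n ∣ ellForm D φ' := by
  choose ψ hψ using h
  obtain ⟨r, hr⟩ := ellForm_add_smul D φ' ψ (ϖ ^ n)
  have h1 : φ = fun i => φ' i + ϖ ^ n * ψ i := funext fun i => by rw [← hψ]; ring
  rw [h1, hr, dvd_add_left (by rw [pow_two, mul_assoc]; exact Dvd.intro _ rfl),
    dvd_add_left (Dvd.intro _ rfl)]

open Classical in
/-- The contribution of the points of the curve modulo `ϖⁿ`. -/
def ellSumOn {𝕜 : Type*} [Field 𝕜] (ϖ : O) (D : ℤ) (t : 𝕜) (n : ℕ) : 𝕜 :=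
  resSum ϖ n fun φ => if redVec O φ ≠ 0 ∧ ϖ ^ n ∣ ellForm D φ then t ^ ellLen D (dotLat ϖ φ n) else 0

open Classical in
/-- The contribution of the points outside the curve modulo `ϖⁿ`. -/
def ellSumOff {𝕜 : Type*} [Field 𝕜] (ϖ : O) (D : ℤ) (t : 𝕜) (n : ℕ) : 𝕜 :=
  resSum ϖ n fun φ =>
    if redVec O φ ≠ 0 ∧ ¬ ϖ ^ n ∣ ellForm D φ then t ^ ellLen D (dotLat ϖ φ n) else 0

/-- The number of nonzero zeros of the cubic form over a field. -/
def ellZeros (D : ℤ) (F : Type*) [Field F] : ℕ :=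
  Nat.card {φ : Fin 3 → F // φ ≠ 0 ∧ ellForm D φ = 0}

lemma natCard_subtype_not {α : Type*} [Finite α] (P : α → Prop) :
    Nat.card {x // P x} + Nat.card {x // ¬ P x} = Nat.card α := by
  have := Set.ncard_add_ncard_compl {x | P x}
  rwa [← Nat.card_coe_set_eq, ← Nat.card_coe_set_eq] at this

/-- Each solution has `q²` lifts that are solutions, and each of these raises the exponent by 3. -/
lemma ellSumOn_succ_succ {𝕜 : Type*} [RCLike 𝕜] {ϖ : O} (hϖ : Irreducible ϖ) {D : ℤ}
    (h2 : (2 : ResidueField O) ≠ 0) (hD : (D : ResidueField O) ≠ 0) (t : 𝕜) (n : ℕ) :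
    ellSumOn ϖ D t (n + 2) =
      (Nat.card (ResidueField O) : 𝕜) ^ 2 * t ^ 3 * ellSumOn ϖ D t (n + 1) := by
  classical
  rw [ellSumOn, resSum_succ hϖ, ellSumOn, ← resSum_mul_left hϖ]
  · refine resSum_congr fun φ => ?_
    have h3 (ψ : Fin 3 → ResidueField O) :
        redVec O (fun i => φ i + ϖ ^ (n + 1) * liftRes (ψ i)) = redVec O φ :=
      redVec_out_congr hϖ (n := n) fun i => by simp
    simp only [h3]
    by_cases hφ : redVec O φ ≠ 0
    · have h4 (ψ : Fin 3 → ResidueField O) :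
          (if redVec O φ ≠ 0 ∧ ϖ ^ (n + 1 + 1) ∣
            ellForm D (fun i => φ i + ϖ ^ (n + 1) * liftRes (ψ i)) then
              t ^ ellLen D (dotLat ϖ (fun i => φ i + ϖ ^ (n + 1) * liftRes (ψ i)) (n + 1 + 1))
            else 0) = if ϖ ^ (n + 2) ∣
              ellForm D (fun i => φ i + ϖ ^ (n + 1) * liftRes (ψ i)) then
                t ^ 3 * t ^ ellLen D (dotLat ϖ φ (n + 1)) else 0 := by
        by_cases h5 : ϖ ^ (n + 2) ∣ ellForm D (fun i => φ i + ϖ ^ (n + 1) * liftRes (ψ i))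
        · rw [if_pos ⟨hφ, h5⟩, if_pos h5, ellLen_dotLat_succ hϖ hD (by rwa [h3]), if_pos h5,
            dotLat_congr (φ' := φ) (n := n + 1) (fun i => by simp), pow_add, mul_comm]
        · rw [if_neg h5, if_neg (fun h => h5 h.2)]
      simp only [h4]
      rw [finsum_const_mul_ite, natCard_hensel hϖ h2 hD hφ]
      split_ifs with h5 h6 h6
      · push_cast; ring
      · exact absurd ⟨hφ, h5⟩ h6
      · exact absurd h6.2 h5
      · simp
    · simp only [hφ, false_and, if_false, finsum_zero, mul_zero]
  · intro φ φ' h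
    simp only [redVec_out_congr hϖ (n := n + 1) h, dvd_ellForm_congr (D := D) h, dotLat_congr h]

/-- All `q³` lifts of a nonsolution are nonsolutions, and so are `q³ - q²` lifts of each solution;
the exponent grows by 4. -/
lemma ellSumOff_succ_succ {𝕜 : Type*} [RCLike 𝕜] {ϖ : O} (hϖ : Irreducible ϖ) {D : ℤ}
    (h2 : (2 : ResidueField O) ≠ 0) (hD : (D : ResidueField O) ≠ 0) (t : 𝕜) (n : ℕ) :
    ellSumOff ϖ D t (n + 2) =
      (Nat.card (ResidueField O) : 𝕜) ^ 3 * t ^ 4 * ellSumOff ϖ D t (n + 1) +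
      ((Nat.card (ResidueField O) : 𝕜) ^ 3 - (Nat.card (ResidueField O) : 𝕜) ^ 2) * t ^ 4 *
        ellSumOn ϖ D t (n + 1) := by
  classical
  rw [ellSumOff, resSum_succ hϖ, ellSumOff, ellSumOn, ← resSum_mul_left hϖ, ← resSum_mul_left hϖ,
    ← resSum_add hϖ]
  · refine resSum_congr fun φ => ?_
    have h3 (ψ : Fin 3 → ResidueField O) :
        redVec O (fun i => φ i + ϖ ^ (n + 1) * liftRes (ψ i)) = redVec O φ :=
      redVec_out_congr hϖ (n := n) fun i => by simp
    simp only [h3]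
    by_cases hφ : redVec O φ ≠ 0
    · have h4 (ψ : Fin 3 → ResidueField O) :
          (if redVec O φ ≠ 0 ∧ ¬ ϖ ^ (n + 1 + 1) ∣
            ellForm D (fun i => φ i + ϖ ^ (n + 1) * liftRes (ψ i)) then
              t ^ ellLen D (dotLat ϖ (fun i => φ i + ϖ ^ (n + 1) * liftRes (ψ i)) (n + 1 + 1))
            else 0) = if ¬ ϖ ^ (n + 2) ∣
              ellForm D (fun i => φ i + ϖ ^ (n + 1) * liftRes (ψ i)) then
                t ^ 4 * t ^ ellLen D (dotLat ϖ φ (n + 1)) else 0 := by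
        by_cases h5 : ϖ ^ (n + 2) ∣ ellForm D (fun i => φ i + ϖ ^ (n + 1) * liftRes (ψ i))
        · rw [if_neg (not_not.2 h5), if_neg (fun h => h.2 h5)]
        · rw [if_pos ⟨hφ, h5⟩, if_pos h5, ellLen_dotLat_succ hϖ hD (by rwa [h3]), if_neg h5,
            dotLat_congr (φ' := φ) (n := n + 1) (fun i => by simp), pow_add, mul_comm]
      simp only [h4]
      have h5 := natCard_subtype_not (fun ψ : Fin 3 → ResidueField O =>
        ϖ ^ (n + 2) ∣ ellForm D (fun i => φ i + ϖ ^ (n + 1) * liftRes (ψ i)))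
      rw [natCard_hensel hϖ h2 hD hφ, Nat.card_pi, Finset.prod_const, Finset.card_fin] at h5
      have h6 : (Nat.card {ψ : Fin 3 → ResidueField O //
          ¬ ϖ ^ (n + 2) ∣ ellForm D (fun i => φ i + ϖ ^ (n + 1) * liftRes (ψ i))} : 𝕜) =
          (Nat.card (ResidueField O) : 𝕜) ^ 3 -
            if ϖ ^ (n + 1) ∣ ellForm D φ then (Nat.card (ResidueField O) : 𝕜) ^ 2 else 0 := by
        rw [eq_sub_iff_add_eq, add_comm]
        exact_mod_cast h5
      rw [finsum_const_mul_ite, h6]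
      by_cases h7 : ϖ ^ (n + 1) ∣ ellForm D φ
      · simp only [h7, if_true, not_true, and_false, if_false, and_true]
        rw [if_pos hφ]
        ring
      · simp only [h7, and_false, if_false, and_true, not_false_eq_true]
        rw [if_pos hφ]
        ring
    · simp only [hφ, false_and, if_false, finsum_zero, mul_zero, add_zero]
  · intro φ φ' h
    simp only [redVec_out_congr hϖ (n := n + 1) h, dvd_ellForm_congr (D := D) h, dotLat_congr h]

lemma ellLen_top (D : ℤ) : ellLen D (⊤ : Submodule O (Fin 3 → O)) = 0 := by
  rw [ellLen, ellPre_top, latLen_top]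

lemma ellSumOn_one {𝕜 : Type*} [RCLike 𝕜] {ϖ : O} (hϖ : Irreducible ϖ) {D : ℤ}
    (hD : (D : ResidueField O) ≠ 0) (t : 𝕜) :
    ellSumOn ϖ D t 1 = ellZeros D (ResidueField O) * t ^ 3 := by
  classical
  have h1 (φ : Fin 3 → O) : ϖ ^ 1 ∣ ellForm D φ ↔ ellForm D (redVec O φ) = 0 := by
    rw [pow_one, ← residue_eq_zero_iff_dvd hϖ, residue_ellForm]
  have h2 (φ : Fin 3 → O) :
      (if redVec O φ ≠ 0 ∧ ϖ ^ 1 ∣ ellForm D φ then t ^ ellLen D (dotLat ϖ φ 1) else 0) =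
      if redVec O φ ≠ 0 ∧ ellForm D (redVec O φ) = 0 then t ^ 3 else 0 := by
    simp only [h1]
    split_ifs with h
    · have := ellLen_dotLat_succ hϖ hD h.1 0
      rw [zero_add, dotLat_zero, ellLen_top, if_pos ((h1 φ).2 h.2), zero_add] at this
      rw [this]
    · rfl
  rw [ellSumOn, resSum_congr h2, resSum_one hϖ (fun φ φ' h => by simp only [h])]
  have h3 (ψ : Fin 3 → ResidueField O) : redVec O (fun i => liftRes (ψ i)) = ψ := by
    ext; simp
  simp only [h3]
  rw [finsum_const_mul_ite, ellZeros]

lemma ellSumOff_one {𝕜 : Type*} [RCLike 𝕜] {ϖ : O} (hϖ : Irreducible ϖ) {D : ℤ}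
    (hD : (D : ResidueField O) ≠ 0) (t : 𝕜) :
    ellSumOff ϖ D t 1 = ((Nat.card (ResidueField O) : 𝕜) ^ 3 - 1 - ellZeros D (ResidueField O)) *
      t ^ 4 := by
  classical
  have h1 (φ : Fin 3 → O) : ϖ ^ 1 ∣ ellForm D φ ↔ ellForm D (redVec O φ) = 0 := by
    rw [pow_one, ← residue_eq_zero_iff_dvd hϖ, residue_ellForm]
  have h2 (φ : Fin 3 → O) :
      (if redVec O φ ≠ 0 ∧ ¬ ϖ ^ 1 ∣ ellForm D φ then t ^ ellLen D (dotLat ϖ φ 1) else 0) =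
      if redVec O φ ≠ 0 ∧ ¬ ellForm D (redVec O φ) = 0 then t ^ 4 else 0 := by
    simp only [h1]
    split_ifs with h
    · have := ellLen_dotLat_succ hϖ hD h.1 0
      rw [zero_add, dotLat_zero, ellLen_top, if_neg ((h1 φ).not.2 h.2), zero_add] at this
      rw [this]
    · rfl
  rw [ellSumOff, resSum_congr h2, resSum_one hϖ (fun φ φ' h => by simp only [h])]
  have h3 (ψ : Fin 3 → ResidueField O) : redVec O (fun i => liftRes (ψ i)) = ψ := by
    ext; simp
  simp only [h3]
  rw [finsum_const_mul_ite]
  congr 1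
  have h4 := natCard_vec_ne_zero (ResidueField O)
  have h5 := natCard_subtype_not (fun ψ : {ψ : Fin 3 → ResidueField O // ψ ≠ 0} =>
    ellForm D ψ.1 = 0)
  rw [Nat.card_congr (Equiv.subtypeSubtypeEquivSubtypeInter _ (fun ψ => ellForm D ψ = 0)),
    Nat.card_congr (Equiv.subtypeSubtypeEquivSubtypeInter _ (fun ψ => ¬ ellForm D ψ = 0))] at h5
  rw [eq_sub_iff_add_eq, eq_sub_iff_add_eq, ellZeros]
  rw [← h5] at h4
  rw [← Nat.cast_add, ← Nat.cast_one, ← Nat.cast_add, ← Nat.cast_pow, ← h4]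
  congr 2
  exact add_comm _ _

lemma levelSum_ellLen {𝕜 : Type*} [RCLike 𝕜] {ϖ : O} (hϖ : Irreducible ϖ) (D : ℤ) (t : 𝕜) (n : ℕ) :
    ((Nat.card (ResidueField O) : 𝕜) ^ (n + 1) - (Nat.card (ResidueField O) : 𝕜) ^ n) *
      levelSum ϖ (fun Λ => t ^ ellLen D Λ) 2 (n + 1) =
        ellSumOn ϖ D t (n + 1) + ellSumOff ϖ D t (n + 1) := by
  classical
  rw [← resSum_dotLat hϖ, ellSumOn, ellSumOff, ← resSum_add hϖ]
  refine resSum_congr fun φ => ?_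
  by_cases h1 : redVec O φ ≠ 0 <;> by_cases h2 : ϖ ^ (n + 1) ∣ ellForm D φ <;> simp [h1, h2]

/-- Here `T` is the sum over lattices of rank 2: a geometric series for the points on the curve,
plus the solution of the recursion for the points off it. `N` stands for the number of projective
points over `k`. -/
lemma ellZeta_identity {K : Type*} [Field K] {q t N : K} (h0 : 1 - t ≠ 0) (h1 : 1 - q * t ≠ 0)
    (h2 : 1 - q ^ 2 * t ≠ 0) (h3 : 1 - q ^ 2 * t ^ 4 ≠ 0) (h4 : 1 - q ^ 2 * t ^ 5 ≠ 0)
    (h5 : 1 - t ^ 6 ≠ 0) (h6 : 1 - q * t ^ 3 ≠ 0) {T : K}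
    (hT : T = N * t ^ 3 / (1 - q * t ^ 3) + ((q ^ 2 + q + 1 - N) * t ^ 4 +
      (q ^ 2 - q) * t ^ 4 * (N * t ^ 3 / (1 - q * t ^ 3))) / (1 - q ^ 2 * t ^ 4)) :
    (1 / ((1 - t) * (1 - q * t) * (1 - q ^ 2 * t))) *
      ((1 + T + t ^ 5 * (q ^ 2 + q + 1 + (q ^ 2 + q) * T) / (1 - q ^ 2 * t ^ 5)) / (1 - t ^ 6)) =
      W₁ q t + N * W₂ q t := by
  subst hT
  unfold W₁ W₂
  obtain ⟨A, hA⟩ : ∃ A, A = 1 - q * t := ⟨_, rfl⟩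
  obtain ⟨B, hB⟩ : ∃ B, B = 1 - q ^ 2 * t := ⟨_, rfl⟩
  obtain ⟨C, hC⟩ : ∃ C, C = 1 - q ^ 2 * t ^ 4 := ⟨_, rfl⟩
  obtain ⟨E, hE⟩ : ∃ E, E = 1 - q ^ 2 * t ^ 5 := ⟨_, rfl⟩
  obtain ⟨F, hF⟩ : ∃ F, F = 1 - t ^ 6 := ⟨_, rfl⟩
  obtain ⟨G, hG⟩ : ∃ G, G = 1 - q * t ^ 3 := ⟨_, rfl⟩
  rw [← hA] at h1 ⊢
  rw [← hB] at h2 ⊢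
  rw [← hC] at h3 ⊢
  rw [← hE] at h4 ⊢
  rw [← hF] at h5 ⊢
  rw [← hG] at h6 ⊢
  field_simp
  subst hA hB hC hE hF hG
  ring

/-- The sum of `t ^ ellLen Λ` over all lattices `Λ`, by levels; the value is given by
`ellZeta_identity`. -/
theorem hasSum_latLevel_pow_ellLen {𝕜 : Type*} [RCLike 𝕜] {ϖ : O} (hϖ : Irreducible ϖ) {D : ℤ}
    (h2 : (2 : ResidueField O) ≠ 0) (hD : (D : ResidueField O) ≠ 0) {t : 𝕜}
    {q N : ℕ} (hq : q = Nat.card (ResidueField O)) (ht : (q : ℝ) ^ 6 * ‖t‖ < 1)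
    (hN : ellZeros D (ResidueField O) + N = q * N) :
    ∃ S : 𝕜, HasSum (fun n => ∑ᶠ Λ ∈ latLevel ϖ n, t ^ ellLen D Λ) S ∧
      (1 / ((1 - t) * (1 - (q : 𝕜) * t) * (1 - (q : 𝕜) ^ 2 * t))) * S =
        W₁ (q : 𝕜) t + (N : 𝕜) * W₂ (q : 𝕜) t := by
  have hq1 : 1 < q := hq ▸ Finite.one_lt_card
  have hlt (a b : ℕ) (ha : a ≤ 6) (hb : b ≠ 0) : ‖(q : 𝕜) ^ a * t ^ b‖ < 1 :=
    norm_natCast_pow_mul_pow_lt_one hq1 ht ha hb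
  have hne (a b : ℕ) (ha : a ≤ 6) (hb : b ≠ 0) : 1 - (q : 𝕜) ^ a * t ^ b ≠ 0 :=
    one_sub_ne_zero_of_norm_lt_one (hlt a b ha hb)
  have hN' : (ellZeros D (ResidueField O) : 𝕜) = ((q : 𝕜) - 1) * N := by
    rw [sub_one_mul, eq_sub_iff_add_eq]
    exact_mod_cast hN
  have hpow (n : ℕ) : (q : 𝕜) ^ (n + 1) - (q : 𝕜) ^ n ≠ 0 := pow_succ_sub_pow_ne_zero hq1 n
  -- Dividing by the number of unit multiples, which grows by the factor `q`, turns the ratio `q²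
  -- t³` into `q t³`, and below `q³ t⁴` into `q² t⁴`.
  have hOn (n : ℕ) : ellSumOn ϖ D t (n + 1) =
      ((q : 𝕜) ^ (n + 1) - (q : 𝕜) ^ n) * (N * t ^ 3 * ((q : 𝕜) * t ^ 3) ^ n) := by
    induction n with
    | zero => rw [zero_add, ellSumOn_one hϖ hD, hN']; ring
    | succ n ih => rw [ellSumOn_succ_succ hϖ h2 hD, ih, ← hq]; ring
  have hSon : HasSum (fun n : ℕ => (N : 𝕜) * t ^ 3 * ((q : 𝕜) * t ^ 3) ^ n)
      (N * t ^ 3 / (1 - q * t ^ 3)) := by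
    have hc := hlt 1 3 (by norm_num) (by norm_num)
    rw [pow_one] at hc
    rw [div_eq_mul_inv]
    exact (hasSum_geometric_of_norm_lt_one hc).mul_left ((N : 𝕜) * t ^ 3)
  obtain ⟨off, hoff⟩ : ∃ off : ℕ → 𝕜, ∀ n, ellSumOff ϖ D t (n + 1) =
      ((q : 𝕜) ^ (n + 1) - (q : 𝕜) ^ n) * off n :=
    ⟨fun n => ellSumOff ϖ D t (n + 1) / ((q : 𝕜) ^ (n + 1) - (q : 𝕜) ^ n),
      fun n => (mul_div_cancel₀ _ (hpow n)).symm⟩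
  have hoff0 : off 0 = ((q : 𝕜) ^ 2 + q + 1 - N) * t ^ 4 := by
    refine mul_left_cancel₀ (hpow 0) ?_
    rw [← hoff, zero_add, ellSumOff_one hϖ hD, hN', ← hq]
    ring
  have hrec (n : ℕ) : off (n + 1) = (q : 𝕜) ^ 2 * t ^ 4 * off n +
      ((q : 𝕜) ^ 2 - q) * t ^ 4 * (N * t ^ 3 * ((q : 𝕜) * t ^ 3) ^ n) := by
    refine mul_left_cancel₀ (hpow (n + 1)) ?_
    rw [← hoff, ellSumOff_succ_succ hϖ h2 hD, hoff, hOn, ← hq]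
    ring
  have hoffS := hasSum_of_linear_recursion (hlt 2 4 (by norm_num) (by norm_num)) hrec
    (hSon.mul_left _)
  rw [hoff0] at hoffS
  have hlev (n : ℕ) : levelSum ϖ (fun Λ => t ^ ellLen D Λ) 2 (n + 1) =
      N * t ^ 3 * ((q : 𝕜) * t ^ 3) ^ n + off n := by
    refine mul_left_cancel₀ (hpow n) ?_
    have := levelSum_ellLen hϖ D t n
    rw [← hq] at this
    rw [this, hOn, mul_add, hoff]
  have hT := hSon.add hoffS
  simp only [← hlev] at hT
  rw [hasSum_nat_add_iff (f := fun n => levelSum ϖ (fun Λ => t ^ ellLen D Λ) 2 n) 1,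
    Finset.sum_range_one, levelSum_zero _ (by norm_num), add_zero] at hT
  have hz := hlt 0 6 (by norm_num) (by norm_num)
  rw [pow_zero, one_mul] at hz
  -- For ranks 1 and 0 the exponent grows by `6 - r`, whence `t⁵` and `t⁶`.
  refine ⟨_, hasSum_latLevel hϖ (W := fun Λ => t ^ ellLen D Λ) (y := t ^ 5) (z := t ^ 6)
    (q := (q : 𝕜)) (by rw [hq]) (hlt 2 5 (by norm_num) (by norm_num)) hz (by simp [ellLen_top])
    (fun Λ h hr => by rw [ellLen_of_latRank_le_one hϖ D h (by omega), hr, pow_add, mul_comm])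
    (fun Λ h hr => by rw [ellLen_of_latRank_le_one hϖ D h (by omega), hr, pow_add, mul_comm]) hT,
    ?_⟩
  have e1 := hne 0 1 (by norm_num) one_ne_zero
  have e2 := hne 1 1 (by norm_num) one_ne_zero
  have e3 := hne 2 1 (by norm_num) one_ne_zero
  have e4 := hne 2 4 (by norm_num) (by norm_num)
  have e5 := hne 2 5 (by norm_num) (by norm_num)
  have e6 := hne 0 6 (by norm_num) (by norm_num)
  have e7 := hne 1 3 (by norm_num) (by norm_num)
  simp only [pow_zero, one_mul, pow_one] at e1 e2 e3 e6 e7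
  exact ellZeta_identity e1 e2 e3 e4 e5 e6 e7 rfl

end Hensel

/-! ### Lattices and submodules of finite index -/

section Pairs

variable {O : Type*} [CommRing O] [IsDomain O] [IsDiscreteValuationRing O]

lemma IsLat.map_of_isLat_range {ϖ : O} {g : (Fin 3 → O) →ₗ[O] (Fin 3 → O)}
    (hr : IsLat ϖ (LinearMap.range g)) {N : Submodule O (Fin 3 → O)} (hN : IsLat ϖ N) :
    IsLat ϖ (N.map g) := by
  obtain ⟨m, hm⟩ := hr
  obtain ⟨n, hn⟩ := hN
  refine ⟨n + m, fun y => ?_⟩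
  obtain ⟨x, hx⟩ := hm y
  exact ⟨ϖ ^ n • x, hn x, by rw [map_smul, hx, pow_add, mul_smul]⟩

lemma IsLat.comap {ϖ : O} (g : (Fin 3 → O) →ₗ[O] (Fin 3 → O))
    {Λ : Submodule O (Fin 3 → O)} (h : IsLat ϖ Λ) : IsLat ϖ (Λ.comap g) := by
  obtain ⟨n, hn⟩ := h
  exact ⟨n, fun y => by rw [Submodule.mem_comap, map_smul]; exact hn _⟩

/-- An injective endomorphism of `O³` with image a given lattice. -/
def latMap {ϖ : O} (hϖ : Irreducible ϖ) {Λ : Submodule O (Fin 3 → O)} (h : IsLat ϖ Λ) :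
    (Fin 3 → O) →ₗ[O] (Fin 3 → O) := (h.exists_injective_range hϖ).choose

lemma latMap_injective {ϖ : O} (hϖ : Irreducible ϖ) {Λ : Submodule O (Fin 3 → O)}
    (h : IsLat ϖ Λ) : Function.Injective (latMap hϖ h) :=
  (h.exists_injective_range hϖ).choose_spec.1

lemma range_latMap {ϖ : O} (hϖ : Irreducible ϖ) {Λ : Submodule O (Fin 3 → O)}
    (h : IsLat ϖ Λ) : LinearMap.range (latMap hϖ h) = Λ :=
  (h.exists_injective_range hϖ).choose_spec.2

variable [Finite (ResidueField O)]

/-- For finite index, two of the vectors `ϖⁱ y` agree modulo `Λ`, say for `i < j`. As `1 - ϖ^(j-i)`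
is a unit, `ϖⁱ y ∈ Λ`; three basis vectors suffice. -/
lemma isLat_iff_index_ne_zero {ϖ : O} (hϖ : Irreducible ϖ) {Λ : Submodule O (Fin 3 → O)} :
    IsLat ϖ Λ ↔ Λ.toAddSubgroup.index ≠ 0 := by
  constructor
  · intro h
    rw [h.index_eq_pow hϖ]
    exact pow_ne_zero _ Nat.card_pos.ne'
  · intro h
    have hfi : Finite ((Fin 3 → O) ⧸ Λ) := AddSubgroup.index_ne_zero_iff_finite.1 h
    have h1 (y : Fin 3 → O) : ∃ n : ℕ, ϖ ^ n • y ∈ Λ := by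
      obtain ⟨i, j, hij, hmk⟩ := Finite.exists_ne_map_eq_of_infinite
        fun n : ℕ => Λ.mkQ (ϖ ^ n • y)
      wlog hlt : i < j generalizing i j
      · exact this j i hij.symm hmk.symm (by omega)
      refine ⟨i, ?_⟩
      rw [← sub_eq_zero, ← map_sub, Submodule.mkQ_apply, Submodule.Quotient.mk_eq_zero] at hmk
      have hu : IsUnit (1 - ϖ ^ (j - i)) := by
        rw [isUnit_iff_residue_ne_zero, map_sub, map_pow, map_one,
          (residue_eq_zero_iff_dvd hϖ ϖ).2 dvd_rfl, zero_pow (by omega), sub_zero]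
        exact one_ne_zero
      obtain ⟨u, hu⟩ := hu
      have h2 := Λ.smul_mem (↑u⁻¹ : O) hmk
      have h3 : (↑u⁻¹ : O) • (ϖ ^ i • y - ϖ ^ j • y) = ϖ ^ i • y := by
        rw [show j = i + (j - i) by omega, ← sub_smul, ← mul_smul, pow_add]
        congr 1
        have := u.inv_mul
        rw [hu] at this
        linear_combination ϖ ^ i * this
      rwa [h3] at h2
    choose n hn using fun i : Fin 3 => h1 (Pi.single i 1)
    refine ⟨∑ i, n i, fun y => ?_⟩
    have h2 : ϖ ^ (∑ i, n i) • y = ∑ i, y i • ϖ ^ (∑ i, n i) • (Pi.single i 1 : Fin 3 → O) := by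
      ext j
      simp [Finset.sum_apply, Pi.single_apply, mul_comm]
    rw [h2]
    refine Submodule.sum_mem _ fun i _ => Λ.smul_mem _ ?_
    rw [← Nat.sub_add_cancel (Finset.single_le_sum (f := n) (fun _ _ => Nat.zero_le _)
      (Finset.mem_univ i)), pow_add, mul_smul]
    exact Λ.smul_mem _ (hn i)

end Pairs

/-! ### Subrepresentations as pairs of lattices -/

section Transfer

variable {O : Type*} [CommRing O] [IsDomain O] [IsDiscreteValuationRing O]

/-- `O ⊗ ℤ³ ≃ O³`, at each vertex of the quiver. -/
def ellRepEquiv (O : Type*) [CommRing O] (D : ℤ) (i : KroneckerQuiver 3) :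
    ((ellRep D).baseChange O).L i ≃ₗ[O] (Fin 3 → O) :=
  TensorProduct.piScalarRight ℤ O O (Fin 3)

/-- The `j`-th arrow of the Kronecker quiver. -/
def kroneckerArrow (j : Fin 3) :
    (KroneckerQuiver.src : KroneckerQuiver 3) ⟶ KroneckerQuiver.tgt := j

lemma piScalarRight_baseChange (D : ℤ) (j : Fin 3) (z : TensorProduct ℤ O (Fin 3 → ℤ)) :
    TensorProduct.piScalarRight ℤ O O (Fin 3)
      ((Fintype.linearCombination ℤ fun i => ellMatrix D i j).baseChange O z) =
      ellArrow O D j (TensorProduct.piScalarRight ℤ O O (Fin 3) z) := by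
  induction z using TensorProduct.induction_on with
  | zero => simp
  | add x y hx hy => rw [map_add, map_add, hx, hy, map_add, map_add]
  | tmul c x =>
    rw [LinearMap.baseChange_tmul,
      TensorProduct.piScalarRight_apply, TensorProduct.piScalarRightHom_tmul,
      TensorProduct.piScalarRight_apply, TensorProduct.piScalarRightHom_tmul,
      Fintype.linearCombination_apply, Fin.sum_univ_three]
    fin_cases j
    · rw [Fin.zero_eta, ellArrow_zero]
      ext i
      fin_cases i <;> simp [ellMatrix]
      ring
    · rw [Fin.mk_one, ellArrow_one]
      ext i
      fin_cases i <;> simp [ellMatrix]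
    · refine Eq.trans ?_ (ellArrow_two D _).symm
      ext i
      fin_cases i <;> simp [ellMatrix]

lemma ellRepEquiv_f (D : ℤ) (j : Fin 3)
    (z : ((ellRep D).baseChange O).L KroneckerQuiver.src) :
    ellRepEquiv O D KroneckerQuiver.tgt (((ellRep D).baseChange O).f (kroneckerArrow j) z) =
      ellArrow O D j (ellRepEquiv O D KroneckerQuiver.src z) :=
  piScalarRight_baseChange D j z

/-- The subrepresentation given by a pair of lattices. -/
def ellSubrep (D : ℤ) (Λ₁ Λ₂ : Submodule O (Fin 3 → O)) (h : Λ₁ ≤ ellPre D Λ₂) :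
    ((ellRep D).baseChange O).Subrep where
  carrier i := match i with
    | .src => Λ₁.comap (ellRepEquiv O D .src).toLinearMap
    | .tgt => Λ₂.comap (ellRepEquiv O D .tgt).toLinearMap
  map_le {i j} φ := by
    match i, j, φ with
    | .src, .tgt, k =>
      rintro _ ⟨z, hz, rfl⟩
      have := mem_ellPre.1 (h hz) k
      rw [LinearEquiv.coe_coe, ← ellRepEquiv_f] at this
      exact this
    | .src, .src, k => exact k.elim
    | .tgt, .src, k => exact k.elim
    | .tgt, .tgt, k => exact k.elim

lemma index_comap_linearEquiv {R V W : Type*} [Ring R] [AddCommGroup V] [Module R V]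
    [AddCommGroup W] [Module R W] (e : V ≃ₗ[R] W) (Λ : Submodule R W) :
    (Λ.comap e.toLinearMap).toAddSubgroup.index = Λ.toAddSubgroup.index :=
  AddSubgroup.index_comap_of_surjective (f := e.toAddMonoidHom) Λ.toAddSubgroup e.surjective

lemma prod_kroneckerQuiver {α : Type*} [CommMonoid α] (f : KroneckerQuiver 3 → α) :
    ∏ i, f i = f .src * f .tgt := by
  rw [show (Finset.univ : Finset (KroneckerQuiver 3)) = {.src, .tgt} from rfl,
    Finset.prod_pair (by decide)]

lemma forall_kroneckerQuiver {p : KroneckerQuiver 3 → Prop} :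
    (∀ i, p i) ↔ p .src ∧ p .tgt :=
  ⟨fun h => ⟨h _, h _⟩, fun h i => by cases i; exacts [h.1, h.2]⟩

lemma index_ellSubrep (D : ℤ) (Λ₁ Λ₂ : Submodule O (Fin 3 → O)) (h : Λ₁ ≤ ellPre D Λ₂) :
    (ellSubrep D Λ₁ Λ₂ h).index = Λ₁.toAddSubgroup.index * Λ₂.toAddSubgroup.index := by
  rw [QuiverRep.Subrep.index, prod_kroneckerQuiver]
  exact congrArg₂ _ (index_comap_linearEquiv _ _) (index_comap_linearEquiv _ _)

lemma finiteIndex_ellSubrep (D : ℤ) (Λ₁ Λ₂ : Submodule O (Fin 3 → O)) (h : Λ₁ ≤ ellPre D Λ₂) :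
    (ellSubrep D Λ₁ Λ₂ h).FiniteIndex ↔
      Λ₁.toAddSubgroup.index ≠ 0 ∧ Λ₂.toAddSubgroup.index ≠ 0 := by
  rw [QuiverRep.Subrep.FiniteIndex, forall_kroneckerQuiver]
  refine and_congr ?_ ?_
  · rw [← index_comap_linearEquiv (ellRepEquiv O D .src) Λ₁]; rfl
  · rw [← index_comap_linearEquiv (ellRepEquiv O D .tgt) Λ₂]; rfl

lemma exists_eq_ellSubrep (D : ℤ) (V' : ((ellRep D).baseChange O).Subrep) :
    ∃ Λ₁ Λ₂ h, V' = ellSubrep D Λ₁ Λ₂ h := by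
  refine ⟨(V'.carrier .src).comap (ellRepEquiv O D .src).symm.toLinearMap,
    (V'.carrier .tgt).comap (ellRepEquiv O D .tgt).symm.toLinearMap, ?_, ?_⟩
  · intro x hx
    rw [mem_ellPre]
    intro j
    obtain ⟨z, rfl⟩ := (ellRepEquiv O D .src).surjective x
    rw [← ellRepEquiv_f]
    simp only [Submodule.mem_comap, LinearEquiv.coe_coe, LinearEquiv.symm_apply_apply] at hx ⊢
    exact V'.map_le (kroneckerArrow j) ⟨z, hx, rfl⟩
  · obtain ⟨c, hc⟩ := V'
    rw [ellSubrep, QuiverRep.Subrep.mk.injEq]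
    ext i z
    cases i <;> simp

lemma ellSubrep_injective (D : ℤ) {Λ₁ Λ₂ Λ₁' Λ₂' : Submodule O (Fin 3 → O)}
    {h : Λ₁ ≤ ellPre D Λ₂} {h' : Λ₁' ≤ ellPre D Λ₂'}
    (heq : ellSubrep D Λ₁ Λ₂ h = ellSubrep D Λ₁' Λ₂' h') : Λ₁ = Λ₁' ∧ Λ₂ = Λ₂' := by
  have h1 := congrArg QuiverRep.Subrep.carrier heq
  have hs := congrFun h1 .src
  have ht := congrFun h1 .tgt
  exact ⟨Submodule.comap_injective_of_surjective (ellRepEquiv O D .src).surjective hs,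
    Submodule.comap_injective_of_surjective (ellRepEquiv O D .tgt).surjective ht⟩

variable [Finite (ResidueField O)]

/-- The finite-index subrepresentation attached to a pair of lattices `(N, Λ)`: the second
component is `Λ` and the first one is the image of `N` in the largest lattice mapped to `Λ`. -/
def ellSubrepOfLat {ϖ : O} (hϖ : Irreducible ϖ) (D : ℤ)
    (p : {Λ : Submodule O (Fin 3 → O) // IsLat ϖ Λ} ×
      {Λ : Submodule O (Fin 3 → O) // IsLat ϖ Λ}) :
    {V' : ((ellRep D).baseChange O).Subrep // V'.FiniteIndex} :=
  ⟨ellSubrep D (p.1.1.map (latMap hϖ (p.2.2.ellPre (D := D)))) p.2.1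
    (by
      conv_rhs => rw [← range_latMap hϖ (p.2.2.ellPre (D := D))]
      exact LinearMap.map_le_range), by
    rw [finiteIndex_ellSubrep, ← isLat_iff_index_ne_zero hϖ, ← isLat_iff_index_ne_zero hϖ]
    refine ⟨IsLat.map_of_isLat_range ?_ p.1.2, p.2.2⟩
    rw [range_latMap]
    exact p.2.2.ellPre⟩

lemma ellSubrepOfLat_bijective {ϖ : O} (hϖ : Irreducible ϖ) (D : ℤ) :
    Function.Bijective (ellSubrepOfLat hϖ D) := by
  constructor
  · rintro ⟨⟨N, hN⟩, Λ, hΛ⟩ ⟨⟨N', hN'⟩, Λ', hΛ'⟩ heq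
    rw [ellSubrepOfLat, ellSubrepOfLat, Subtype.mk.injEq] at heq
    obtain ⟨h1, h2⟩ := ellSubrep_injective D heq
    dsimp only at h2
    subst h2
    obtain rfl := Submodule.map_injective_of_injective (latMap_injective hϖ _) h1
    rfl
  · rintro ⟨V', hV'⟩
    obtain ⟨Λ₁, Λ₂, h, rfl⟩ := exists_eq_ellSubrep D V'
    rw [finiteIndex_ellSubrep, ← isLat_iff_index_ne_zero hϖ, ← isLat_iff_index_ne_zero hϖ] at hV'
    refine ⟨(⟨Λ₁.comap (latMap hϖ (hV'.2.ellPre (D := D))), hV'.1.comap _⟩, ⟨Λ₂, hV'.2⟩), ?_⟩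
    apply Subtype.ext
    have h2 : (Λ₁.comap (latMap hϖ (hV'.2.ellPre (D := D)))).map
        (latMap hϖ (hV'.2.ellPre (D := D))) = Λ₁ := by
      rw [Submodule.map_comap_eq, range_latMap, inf_eq_right]
      exact h
    simp only [ellSubrepOfLat, h2]

lemma index_ellSubrepOfLat {ϖ : O} (hϖ : Irreducible ϖ) (D : ℤ)
    (p : {Λ : Submodule O (Fin 3 → O) // IsLat ϖ Λ} ×
      {Λ : Submodule O (Fin 3 → O) // IsLat ϖ Λ}) :
    (ellSubrepOfLat hϖ D p).1.index =
      Nat.card (ResidueField O) ^ (latLen p.1.1 + ellLen D p.2.1) := by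
  rw [ellSubrepOfLat, index_ellSubrep,
    index_map_of_injective (latMap_injective hϖ _), range_latMap, p.1.2.index_eq_pow hϖ,
    p.2.2.index_eq_pow hϖ, (p.2.2.ellPre (D := D)).index_eq_pow hϖ, ← pow_add, ← pow_add, ellLen]
  congr 1
  ring

end Transfer

/-! ### The Dirichlet series -/

section ZetaSeries

lemma natCast_pow_cpow (q e : ℕ) (s : ℂ) : ((q ^ e : ℕ) : ℂ) ^ s = ((q : ℂ) ^ s) ^ e := by
  induction e with
  | zero => simp
  | succ e ih => rw [pow_succ, Nat.cast_mul, Complex.natCast_mul_natCast_cpow, ih, pow_succ]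

lemma pow_six_mul_norm_cpow_lt_one {q : ℕ} (hq : 1 < q) {s : ℂ} (hs : 6 < s.re) :
    (q : ℝ) ^ 6 * ‖(q : ℂ) ^ (-s)‖ < 1 := by
  have h0 : (0 : ℝ) < q := by exact_mod_cast (by omega : 0 < q)
  rw [Complex.norm_natCast_cpow_of_pos (by omega), ← Real.rpow_natCast, ← Real.rpow_add h0]
  refine Real.rpow_lt_one_of_one_lt_of_neg (by exact_mod_cast hq) ?_
  simp only [Complex.neg_re, Nat.cast_ofNat]
  linarith

lemma hasSum_mul_complex {α β : Type*} {f : α → ℂ} {g : β → ℂ} {a b : ℂ} (hf : HasSum f a)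
    (hg : HasSum g b) : HasSum (fun p : α × β => f p.1 * g p.2) (a * b) :=
  hf.mul hg (summable_mul_of_summable_norm hf.summable.norm hg.summable.norm)

variable {O : Type*} [CommRing O] [IsDomain O] [IsDiscreteValuationRing O]
  [Finite (ResidueField O)]

lemma hasSum_subrep {D : ℤ} (h2 : (2 : ResidueField O) ≠ 0) (hD : (D : ResidueField O) ≠ 0)
    {q N : ℕ} (hq : q = Nat.card (ResidueField O))
    (hN : ellZeros D (ResidueField O) + N = q * N) {s : ℂ} (hs : 6 < s.re) :
    HasSum (fun V' : {V' : ((ellRep D).baseChange O).Subrep // V'.FiniteIndex} =>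
      (V'.1.index : ℂ) ^ (-s))
      (W₁ (q : ℂ) ((q : ℂ) ^ (-s)) + (N : ℂ) * W₂ (q : ℂ) ((q : ℂ) ^ (-s))) := by
  obtain ⟨ϖ, hϖ⟩ := IsDiscreteValuationRing.exists_irreducible O
  have hq1 : 1 < q := hq ▸ Finite.one_lt_card
  have hind : ∀ p, (((ellSubrepOfLat hϖ D p).1.index : ℕ) : ℂ) ^ (-s) =
      ((q : ℂ) ^ (-s)) ^ latLen p.1.1 * ((q : ℂ) ^ (-s)) ^ ellLen D p.2.1 := fun p => by
    rw [index_ellSubrepOfLat, ← hq, natCast_pow_cpow, pow_add]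
  have ht : (q : ℝ) ^ 6 * ‖(q : ℂ) ^ (-s)‖ < 1 := pow_six_mul_norm_cpow_lt_one hq1 hs
  generalize (q : ℂ) ^ (-s) = t at hind ht ⊢
  -- The evaluation over `ℝ` at `‖t‖` supplies the absolute convergence.
  have ht' : (q : ℝ) ^ 6 * ‖‖t‖‖ < 1 := by rwa [norm_norm]
  obtain ⟨S, hS, hval⟩ := hasSum_latLevel_pow_ellLen hϖ h2 hD hq ht hN
  obtain ⟨S', hS', -⟩ := hasSum_latLevel_pow_ellLen hϖ h2 hD hq ht' hN
  have h1 := hasSum_isLat hϖ (W := fun Λ => t ^ ellLen D Λ) (by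
    simp only [norm_pow]; exact hS'.summable) hS
  have h1' := hasSum_isLat hϖ (W := fun Λ => t ^ latLen Λ) (by
    simp only [norm_pow]; exact (hasSum_latLevel_pow_latLen hϖ hq ht').summable)
    (hasSum_latLevel_pow_latLen hϖ hq ht)
  have h3 := hasSum_mul_complex h1' h1
  rw [hval, ← funext hind] at h3
  exact (Equiv.ofBijective _ (ellSubrepOfLat_bijective hϖ D)).hasSum_iff.1 h3

/-- Finite-index subrepresentations of given index, as finite-index subrepresentations. -/
def subrepsOfIndexEmbedding (D : ℤ) (m : ℕ) :
    ((ellRep D).baseChange O).subrepsOfIndex m ↪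
      {V' : ((ellRep D).baseChange O).Subrep // V'.FiniteIndex} where
  toFun V' := ⟨V'.1, V'.2.1⟩
  inj' := fun ⟨_, _⟩ ⟨_, _⟩ h => Subtype.ext (Subtype.mk.inj h)

/-- Otherwise the nonzero term `m⁻⁷` would occur infinitely often in a series that converges
absolutely at `s = 7`. -/
theorem finite_subrepsOfIndex {D : ℤ} (h2 : (2 : ResidueField O) ≠ 0)
    (hD : (D : ResidueField O) ≠ 0) {q N : ℕ} (hq : q = Nat.card (ResidueField O))
    (hN : ellZeros D (ResidueField O) + N = q * N) (m : ℕ) :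
    (((ellRep D).baseChange O).subrepsOfIndex m).Finite := by
  by_contra hinf
  have hinf : (((ellRep D).baseChange O).subrepsOfIndex m).Infinite := hinf
  have := hinf.to_subtype
  have hs := (hasSum_subrep h2 hD hq hN (s := 7) (by norm_num)).summable
  have h1 := hs.comp_injective (subrepsOfIndexEmbedding D m).injective
  have h3 : ((fun V' : {V' : ((ellRep D).baseChange O).Subrep // V'.FiniteIndex} =>
      (V'.1.index : ℂ) ^ (-7 : ℂ)) ∘ subrepsOfIndexEmbedding D m) =
      fun _ => (m : ℂ) ^ (-7 : ℂ) :=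
    funext fun V' => congrArg (fun k : ℕ => (k : ℂ) ^ (-7 : ℂ)) V'.2.2
  rw [h3, summable_const_iff] at h1
  obtain ⟨V', hV'⟩ := hinf.nonempty
  have hm : m ≠ 0 := by
    rw [← hV'.2, QuiverRep.Subrep.index]
    exact Finset.prod_ne_zero_iff.2 fun i _ => hV'.1 i
  rw [Complex.cpow_eq_zero_iff] at h1
  exact hm (by exact_mod_cast h1.1)

theorem lSeriesHasSum_zetaCoeff {D : ℤ} (h2 : (2 : ResidueField O) ≠ 0)
    (hD : (D : ResidueField O) ≠ 0) {q N : ℕ} (hq : q = Nat.card (ResidueField O))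
    (hN : ellZeros D (ResidueField O) + N = q * N) {s : ℂ} (hs : 6 < s.re) :
    LSeriesHasSum ((ellRep D).baseChange O).zetaCoeff s
      (W₁ (q : ℂ) ((q : ℂ) ^ (-s)) + (N : ℂ) * W₂ (q : ℂ) ((q : ℂ) ^ (-s))) := by
  have h1 := hasSum_subrep h2 hD hq hN hs
  let idx : {V' : ((ellRep D).baseChange O).Subrep // V'.FiniteIndex} → ℕ := fun V' => V'.1.index
  rw [← (Equiv.sigmaFiberEquiv idx).hasSum_iff] at h1
  have hfin (m : ℕ) : Finite {V' // idx V' = m} := by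
    have := (finite_subrepsOfIndex h2 hD hq hN m).to_subtype
    exact Finite.of_injective (β := ((ellRep D).baseChange O).subrepsOfIndex m)
      (fun V' => ⟨V'.1.1, V'.1.2, V'.2⟩)
      fun ⟨⟨_, _⟩, _⟩ ⟨⟨_, _⟩, _⟩ h => Subtype.ext (Subtype.ext (Subtype.mk.inj h))
  have := fun m => Fintype.ofFinite {V' // idx V' = m}
  have h3 := h1.sigma fun m => hasSum_fintype _
  rw [LSeriesHasSum]
  convert h3 using 2 with m
  have hcard : Nat.card {V' // idx V' = m} =
      (((ellRep D).baseChange O).subrepsOfIndex m).ncard := by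
    rw [← Nat.card_coe_set_eq]
    exact Nat.card_congr ⟨fun V' => ⟨V'.1.1, V'.1.2, V'.2⟩, fun V' => ⟨⟨V'.1, V'.2.1⟩, V'.2.2⟩,
      fun _ => rfl, fun _ => rfl⟩
  have hterm (V' : {V' // idx V' = m}) : (((fun V' : {V' : ((ellRep D).baseChange O).Subrep //
      V'.FiniteIndex} => (V'.1.index : ℂ) ^ (-s)) ∘ (Equiv.sigmaFiberEquiv idx)) ⟨m, V'⟩) =
        (m : ℂ) ^ (-s) := by
    change (idx V'.1 : ℂ) ^ (-s) = _
    rw [V'.2]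
  rw [Finset.sum_congr rfl fun V' _ => hterm V', Finset.sum_const, Finset.card_univ,
    ← Nat.card_eq_fintype_card, hcard, nsmul_eq_mul]
  -- The term at `m = 0` is zero by convention, in agreement with the fact that a product of nonzero
  -- indices is never 0.
  rcases eq_or_ne m 0 with rfl | hm
  · rw [LSeries.term_zero]
    have : ((ellRep D).baseChange O).subrepsOfIndex 0 = ∅ := by
      ext V'
      simp only [Set.mem_empty_iff_false, iff_false]
      intro hV'
      have h4 := hV'.2
      rw [QuiverRep.Subrep.index, Finset.prod_eq_zero_iff] at h4
      obtain ⟨i, -, hi⟩ := h4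
      exact hV'.1 i hi
    rw [this, Set.ncard_empty, Nat.cast_zero, zero_mul]
  · rw [LSeries.term_of_ne_zero hm, Complex.cpow_neg, div_eq_mul_inv, QuiverRep.zetaCoeff]

end ZetaSeries

/-! ### Euler products over monic polynomials -/

section MonicSums

open Polynomial UniqueFactorizationMonoid

variable {k : Type*} [Field k] [Finite k]

lemma finite_monic_natDegree (k : Type*) [Field k] [Finite k] (n : ℕ) :
    {g : k[X] | g.Monic ∧ g.natDegree = n}.Finite := by
  have : Finite (degreeLT k n) := Finite.of_equiv _ (degreeLTEquiv k n).symm.toEquiv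
  exact Finite.of_equiv _ (monicEquivDegreeLT (R := k) n).symm

/-- The monic polynomials of degree `n`. -/
def monics (k : Type*) [Field k] [Finite k] (n : ℕ) : Finset k[X] :=
  (finite_monic_natDegree k n).toFinset

@[simp]
lemma mem_monics {n : ℕ} {g : k[X]} : g ∈ monics k n ↔ g.Monic ∧ g.natDegree = n := by
  simp [monics]

open Classical in
lemma finite_monic_irreducible (k : Type*) [Field k] [Finite k] (n : ℕ) :
    {g : k[X] | g.Monic ∧ Irreducible g ∧ g.natDegree ≤ n}.Finite := by
  refine ((Finset.range (n + 1)).biUnion (monics k)).finite_toSet.subset fun g hg => ?_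
  simp only [Finset.coe_biUnion, Set.mem_iUnion, Finset.mem_coe, Finset.mem_range, mem_monics]
  exact ⟨g.natDegree, Nat.lt_succ_of_le hg.2.2, hg.1, rfl⟩

/-- The monic irreducible polynomials of degree at most `n`. -/
def monicPrimes (k : Type*) [Field k] [Finite k] (n : ℕ) : Finset k[X] :=
  (finite_monic_irreducible k n).toFinset

@[simp]
lemma mem_monicPrimes {n : ℕ} {g : k[X]} :
    g ∈ monicPrimes k n ↔ g.Monic ∧ Irreducible g ∧ g.natDegree ≤ n := by
  simp [monicPrimes]

open Classical in
-- The polynomial analogue of `log m = ∑_{d ∣ m} Λ(d)` for the von Mangoldt function.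
lemma natDegree_eq_sum_monicPrimes {n : ℕ} {g : k[X]} (hg : g.Monic) (hn : g.natDegree ≤ n) :
    g.natDegree = ∑ P ∈ monicPrimes k n, ∑ e ∈ Finset.Icc 1 n,
      if P ^ e ∣ g then P.natDegree else 0 := by
  have hprod : (normalizedFactors g).prod = g := by
    rw [prod_normalizedFactors_eq hg.ne_zero, hg.normalize_eq_self]
  have hmonic : ∀ P ∈ normalizedFactors g, P.Monic := fun P hP => by
    rw [← normalize_normalized_factor P hP]
    exact monic_normalize (irreducible_of_normalized_factor P hP).ne_zero
  have hsub : (normalizedFactors g).toFinset ⊆ monicPrimes k n := fun P hP => by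
    rw [Multiset.mem_toFinset] at hP
    exact mem_monicPrimes.2 ⟨hmonic P hP, irreducible_of_normalized_factor P hP,
      (natDegree_le_of_dvd (dvd_of_mem_normalizedFactors hP) hg.ne_zero).trans hn⟩
  have h1 : g.natDegree = ∑ P ∈ monicPrimes k n, (normalizedFactors g).count P * P.natDegree := by
    conv_lhs => rw [← hprod, natDegree_multiset_prod_of_monic _ hmonic,
      Finset.sum_multiset_map_count]
    refine Finset.sum_subset hsub fun P _ hP => ?_
    rw [Multiset.mem_toFinset] at hP
    rw [Multiset.count_eq_zero_of_notMem hP, zero_smul]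
  rw [h1]
  refine Finset.sum_congr rfl fun P hP => ?_
  obtain ⟨hP1, hP2, hP3⟩ := mem_monicPrimes.1 hP
  have hdvd (e : ℕ) : P ^ e ∣ g ↔ e ≤ (normalizedFactors g).count P := by
    rw [pow_dvd_iff_le_emultiplicity, emultiplicity_eq_count_normalizedFactors hP2 hg.ne_zero,
      hP1.normalize_eq_self, Nat.cast_le]
  have hle : (normalizedFactors g).count P ≤ n := by
    have h2 := natDegree_le_of_dvd ((hdvd _).2 le_rfl) hg.ne_zero
    rw [natDegree_pow] at h2
    exact ((Nat.le_mul_of_pos_right _ hP2.natDegree_pos).trans h2).trans hn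
  rw [← Finset.sum_filter, Finset.sum_const, smul_eq_mul]
  congr 1
  rw [show (Finset.Icc 1 n).filter (fun e => P ^ e ∣ g) =
    Finset.Icc 1 ((normalizedFactors g).count P) from ?_, Nat.card_Icc, Nat.add_sub_cancel]
  ext e
  simp only [Finset.mem_filter, Finset.mem_Icc, hdvd]
  omega

/-- The sum of `deg P · lam(P)^e` over the prime powers `P^e` of degree `j` (if `j ≤ n`). -/
def primePowerSum (lam : k[X] → ℤ) (n j : ℕ) : ℤ :=
  ∑ P ∈ monicPrimes k n, ∑ e ∈ Finset.Icc 1 n,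
    if e * P.natDegree = j then (P.natDegree : ℤ) * lam P ^ e else 0

open Classical in
lemma sum_monics_dvd {lam : k[X] → ℤ}
    (hmul : ∀ g h : k[X], g.Monic → h.Monic → lam (g * h) = lam g * lam h) {n : ℕ} {Q : k[X]}
    (hQ : Q.Monic) :
    ∑ g ∈ monics k n, (if Q ∣ g then lam g else 0) =
      if Q.natDegree ≤ n then lam Q * ∑ g ∈ monics k (n - Q.natDegree), lam g else 0 := by
  split_ifs with h
  · rw [← Finset.sum_filter, Finset.mul_sum]
    symm
    refine Finset.sum_bij (fun g _ => Q * g) (fun g hg => ?_) (fun g _ g' _ h => ?_)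
      (fun g hg => ?_) (fun g hg => ?_)
    · rw [mem_monics] at hg
      rw [Finset.mem_filter, mem_monics]
      refine ⟨⟨hQ.mul hg.1, ?_⟩, dvd_mul_right _ _⟩
      rw [hQ.natDegree_mul hg.1, hg.2]
      omega
    · exact mul_left_cancel₀ hQ.ne_zero h
    · rw [Finset.mem_filter, mem_monics] at hg
      obtain ⟨⟨h1, h2⟩, g', rfl⟩ := hg
      have h3 := hQ.of_mul_monic_left h1
      rw [hQ.natDegree_mul h3] at h2
      exact ⟨g', mem_monics.2 ⟨h3, by omega⟩, rfl⟩
    · rw [hmul _ _ hQ (mem_monics.1 hg).1]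
  · refine Finset.sum_eq_zero fun g hg => if_neg fun hd => h ?_
    rw [mem_monics] at hg
    rw [← hg.2]
    exact natDegree_le_of_dvd hd hg.1.ne_zero

/-- The logarithmic derivative of the Euler product of the `L`-series of `lam`. -/
theorem natCast_mul_sum_monics {lam : k[X] → ℤ} (hone : lam 1 = 1)
    (hmul : ∀ g h : k[X], g.Monic → h.Monic → lam (g * h) = lam g * lam h) (n : ℕ) :
    (n : ℤ) * ∑ g ∈ monics k n, lam g =
      ∑ j ∈ Finset.Icc 1 n, primePowerSum lam n j * ∑ g ∈ monics k (n - j), lam g := by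
  classical
  have hpow (P : k[X]) (hP : P.Monic) (e : ℕ) : lam (P ^ e) = lam P ^ e := by
    induction e with
    | zero => simp [hone]
    | succ e ih => rw [pow_succ, pow_succ, hmul _ _ (hP.pow e) hP, ih]
  have h1 : (n : ℤ) * ∑ g ∈ monics k n, lam g = ∑ P ∈ monicPrimes k n, ∑ e ∈ Finset.Icc 1 n,
      ∑ g ∈ monics k n, (P.natDegree : ℤ) * if P ^ e ∣ g then lam g else 0 := by
    rw [Finset.mul_sum]
    refine Eq.trans ?_ (Finset.sum_congr rfl fun P _ => Finset.sum_comm)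
    rw [Finset.sum_comm]
    refine Finset.sum_congr rfl fun g hg => ?_
    rw [mem_monics] at hg
    conv_lhs => rw [← hg.2, natDegree_eq_sum_monicPrimes hg.1 hg.2.le]
    push_cast
    simp only [Finset.sum_mul]
    refine Finset.sum_congr rfl fun P _ => Finset.sum_congr rfl fun e _ => ?_
    split_ifs <;> simp
  rw [h1]
  simp only [primePowerSum, Finset.sum_mul]
  conv_rhs => rw [Finset.sum_comm]
  refine Finset.sum_congr rfl fun P hP => ?_
  conv_rhs => rw [Finset.sum_comm]
  refine Finset.sum_congr rfl fun e he => ?_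
  obtain ⟨hP1, hP2, hP3⟩ := mem_monicPrimes.1 hP
  rw [← Finset.mul_sum, sum_monics_dvd hmul (hP1.pow e), hP1.natDegree_pow, hpow P hP1]
  simp only [ite_mul, zero_mul]
  rw [Finset.sum_ite_eq]
  have : 1 ≤ e * P.natDegree := Nat.mul_pos (Finset.mem_Icc.1 he).1 hP2.natDegree_pos
  simp only [Finset.mem_Icc, this, true_and]
  split_ifs
  · ring
  · simp

variable {K : Type*} [Field K] [Fintype K] [Algebra k K]

/-- As its degree divides `[K : k]`, the polynomial divides `X^|K| - X` and splits over `K`. It is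
separable, and its roots are the elements with minimal polynomial `P`. -/
lemma card_minpoly_eq [DecidableEq k[X]] {P : k[X]} (hP : P.Monic) (hi : Irreducible P)
    (hd : P.natDegree ∣ finrank k K) :
    (Finset.univ.filter fun x : K => minpoly k x = P).card = P.natDegree := by
  classical
  have : Fintype k := Fintype.ofFinite k
  have hdvd := (hi.natDegree_dvd_iff_dvd_X_pow_card_pow_sub_X).1 hd
  rw [← Module.natCard_eq_pow_finrank, Nat.card_eq_fintype_card] at hdvd
  have hs : (P.map (algebraMap k K)).Splits := by
    have h1 := map_dvd (mapRingHom (algebraMap k K)) hdvd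
    simp only [coe_mapRingHom, Polynomial.map_sub, Polynomial.map_pow, map_X] at h1
    refine Splits.of_dvd ?_ (FiniteField.X_pow_card_sub_X_ne_zero K Fintype.one_lt_card) h1
    simpa using (FiniteField.isSplittingField_sub K k).splits
  rw [← card_rootSet_eq_natDegree (PerfectField.separable_of_irreducible hi) hs,
    ← Set.toFinset_card]
  congr 1
  ext x
  simp only [Finset.mem_filter, Finset.mem_univ, true_and, Set.mem_toFinset, mem_rootSet]
  refine ⟨fun h => ⟨hP.ne_zero, h ▸ minpoly.aeval k x⟩ , fun h => ?_⟩
  exact (minpoly.eq_of_irreducible_of_monic hi h.2 hP).symm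

/-- The sum over the prime powers of degree `j`, as a sum over the field with `q^j` elements. -/
theorem sum_pow_minpoly_eq_primePowerSum (lam : k[X] → ℤ) {n j : ℕ} (hj : finrank k K = j)
    (hn : j ≤ n) :
    ∑ x : K, lam (minpoly k x) ^ (j / (minpoly k x).natDegree) = primePowerSum lam n j := by
  classical
  have hj0 : 0 < j := hj ▸ finrank_pos
  have h1 : primePowerSum lam n j = ∑ x : K, ∑ P ∈ monicPrimes k n, ∑ e ∈ Finset.Icc 1 n,
      if minpoly k x = P then (if e * P.natDegree = j then lam P ^ e else 0) else 0 := by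
    rw [Finset.sum_comm, primePowerSum]
    refine Finset.sum_congr rfl fun P hP => ?_
    obtain ⟨hP1, hP2, hP3⟩ := mem_monicPrimes.1 hP
    rw [Finset.sum_comm]
    refine Finset.sum_congr rfl fun e he => ?_
    rw [← Finset.sum_filter, Finset.sum_const, nsmul_eq_mul]
    split_ifs with h
    · rw [card_minpoly_eq hP1 hP2 (hj ▸ h ▸ dvd_mul_left _ _)]
    · simp
  rw [h1]
  refine Finset.sum_congr rfl fun x _ => ?_
  have hx : IsIntegral k x := .of_finite k x
  have hd : (minpoly k x).natDegree ∣ j := hj ▸ minpoly.degree_dvd hx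
  have hpos := minpoly.natDegree_pos hx
  have hle := Nat.le_of_dvd hj0 hd
  rw [Finset.sum_eq_single_of_mem (minpoly k x) (mem_monicPrimes.2
      ⟨minpoly.monic hx, minpoly.irreducible hx, hle.trans hn⟩)
      fun P _ hP => Finset.sum_eq_zero fun e _ => if_neg hP.symm,
    Finset.sum_eq_single_of_mem (j / (minpoly k x).natDegree)
      (Finset.mem_Icc.2 ⟨Nat.div_pos hle hpos, (Nat.div_le_self _ _).trans hn⟩), if_pos rfl,
    if_pos (Nat.div_mul_cancel hd)]
  intro e _ he
  rw [if_pos rfl, if_neg]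
  rintro rfl
  exact he (Nat.mul_div_cancel _ hpos).symm

end MonicSums

/-! ### Norms from `k[X]/(X³ - dX)` -/

section EllNorm

open Polynomial IntermediateField

variable {R S : Type*} [CommRing R] [CommRing S]

/-- The norm of the class of a polynomial in `R[X]/(X³ - d X)`. -/
def ellNorm (d : R) : R[X] →* R :=
  ((evalRingHom 0 : R[X] →+* R) : R[X] →* R) *
    (QuadraticAlgebra.norm (R := R) (a := d) (b := 0)).comp
      ((aeval (⟨0, 1⟩ : QuadraticAlgebra R d 0) : R[X] →ₐ[R] _) : R[X] →* QuadraticAlgebra R d 0)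

/-- The factorization `X(X² - d)` makes the norm the product of the value at 0 and of the norm of
the value at `√d`. -/
lemma ellNorm_apply (d : R) (g : R[X]) :
    ellNorm d g = g.eval 0 * ((aeval (⟨0, 1⟩ : QuadraticAlgebra R d 0) g).re ^ 2 -
      d * (aeval (⟨0, 1⟩ : QuadraticAlgebra R d 0) g).im ^ 2) := by
  have : ellNorm d g = g.eval 0 * (aeval (⟨0, 1⟩ : QuadraticAlgebra R d 0) g).norm := rfl
  rw [this, QuadraticAlgebra.norm_def]
  ring

lemma aeval_quadratic_map (φ : R →+* S) (d : R) (g : R[X]) :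
    aeval (⟨0, 1⟩ : QuadraticAlgebra S (φ d) 0) (g.map φ) =
      ⟨φ (aeval (⟨0, 1⟩ : QuadraticAlgebra R d 0) g).re,
        φ (aeval (⟨0, 1⟩ : QuadraticAlgebra R d 0) g).im⟩ := by
  have hω (n : ℕ) : (⟨0, 1⟩ : QuadraticAlgebra S (φ d) 0) ^ n =
      ⟨φ ((⟨0, 1⟩ : QuadraticAlgebra R d 0) ^ n).re,
        φ ((⟨0, 1⟩ : QuadraticAlgebra R d 0) ^ n).im⟩ := by
    induction n with
    | zero => ext <;> simp [QuadraticAlgebra.re_one, QuadraticAlgebra.im_one]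
    | succ n ih => rw [pow_succ, pow_succ, ih]; ext <;> simp
  induction g using Polynomial.induction_on' with
  | add p q hp hq => rw [Polynomial.map_add, map_add, hp, hq, map_add]; ext <;> simp
  | monomial n a =>
    rw [map_monomial, aeval_monomial, aeval_monomial, hω, ← Algebra.smul_def, ← Algebra.smul_def]
    ext <;> simp

lemma ellNorm_map (φ : R →+* S) (d : R) (g : R[X]) :
    ellNorm (φ d) (g.map φ) = φ (ellNorm d g) := by
  rw [ellNorm_apply, ellNorm_apply, aeval_quadratic_map, eval_map, eval₂_at_zero,
    coeff_zero_eq_eval_zero]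
  simp

lemma ellNorm_X_sub_C (d y : R) : ellNorm d (X - C y) = -(y ^ 3 - d * y) := by
  rw [ellNorm_apply]
  simp [QuadraticAlgebra.algebraMap_eq]
  ring

variable {k K : Type*} [Field k] [Field K] [Algebra k K]

lemma norm_aeval_eq_prod_aroots [FiniteDimensional k K] [Algebra.IsSeparable k K] (E : Type*)
    [Field E] [Algebra k E] [IsAlgClosed E] (x : K) (g : k[X]) :
    algebraMap k E (Algebra.norm k (aeval x g)) =
      (((minpoly k x).aroots E).map fun y => aeval y g).prod ^ finrank k⟮x⟯ K := by
  classical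
  have hx : IsIntegral k x := .of_finite k x
  have := Algebra.isSeparable_tower_bot_of_isSeparable k k⟮x⟯ K
  have h1 : aeval x g = algebraMap k⟮x⟯ K (aeval (AdjoinSimple.gen k x) g) := by
    rw [← aeval_algebraMap_apply, AdjoinSimple.algebraMap_gen]
  rw [h1, ← Algebra.norm_norm (S := k⟮x⟯), Algebra.norm_algebraMap, map_pow, map_pow,
    Algebra.norm_eq_prod_embeddings k E]
  congr 1
  rw [Fintype.prod_equiv (adjoin.powerBasis hx).liftEquiv' _ (fun y => aeval (y : E) g)
    fun σ => by rw [PowerBasis.liftEquiv'_apply_coe, adjoin.powerBasis_gen, aeval_algHom_apply]]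
  rw [Finset.prod_mem_multiset (f := fun y => aeval (y : E) g)
      (g := fun y => aeval y g) (hfg := fun _ => rfl),
    Finset.prod_eq_multiset_prod,
    Multiset.toFinset_val, adjoin.powerBasis_gen, minpoly_gen, Multiset.dedup_eq_self.mpr]
  exact nodup_roots (.map (Algebra.IsSeparable.isSeparable k x))

/-- A reciprocity of resultants. The norm is the product of `y³ - d y` over the conjugates `y` of
`x`, to the power `[K : k(x)]`. Each factor is `-ellNorm d (X - y)`, and multiplicativity
reassembles the minimal polynomial. -/
lemma norm_cubic_eq [FiniteDimensional k K] [Algebra.IsSeparable k K] (d : k) (x : K) :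
    Algebra.norm k (x ^ 3 - algebraMap k K d * x) =
      ((-1) ^ (minpoly k x).natDegree * ellNorm d (minpoly k x)) ^
        (finrank k K / (minpoly k x).natDegree) := by
  have hx : IsIntegral k x := .of_finite k x
  let E := AlgebraicClosure k
  have hsplit := IsAlgClosed.splits ((minpoly k x).map (algebraMap k E))
  have hmap := hsplit.eq_prod_roots_of_monic ((minpoly.monic hx).map _)
  have hcard : Multiset.card ((minpoly k x).aroots E) = (minpoly k x).natDegree := by
    rw [aroots, ← hsplit.natDegree_eq_card_roots, natDegree_map]
  have hfin : finrank k K / (minpoly k x).natDegree = finrank k⟮x⟯ K := by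
    rw [← adjoin.finrank hx, ← finrank_mul_finrank k k⟮x⟯ K, Nat.mul_div_cancel_left _ finrank_pos]
  have h1 : x ^ 3 - algebraMap k K d * x = aeval x (X ^ 3 - C d * X) := by simp
  refine (algebraMap k E).injective ?_
  rw [h1, norm_aeval_eq_prod_aroots E, hfin, map_pow]
  congr 1
  rw [map_mul, ← ellNorm_map, hmap, map_multiset_prod, Multiset.map_map, map_pow, map_neg, map_one,
    ← hcard]
  have h2 : (ellNorm ((algebraMap k E) d) ∘ fun a => X - C a) = fun y : E =>
      -(aeval y (X ^ 3 - C d * X)) := by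
    funext y
    simp [ellNorm_X_sub_C]
  have h3 : (fun y : E => -(aeval y (X ^ 3 - C d * X))) =
      Neg.neg ∘ fun y : E => aeval y (X ^ 3 - C d * X) := rfl
  rw [h2, h3, ← Multiset.map_map, Multiset.prod_map_neg, Multiset.card_map, ← mul_assoc,
    ← mul_pow, show (-1 : E) * -1 = 1 by ring]
  simp [aroots]

end EllNorm

/-! ### The quadratic character and the cubic character sums -/

section QuadraticChar

open Polynomial

variable {k K : Type*} [Field k] [Fintype k] [DecidableEq k] [Field K] [Fintype K] [DecidableEq K]
  [Algebra k K]

/-- Euler's criterion: with `Q = |K|` and `q = |k|`, the norm of `y` is `y^((Q-1)/(q-1))`, and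
raising it to the power `(q-1)/2` gives `y^((Q-1)/2)`. -/
lemma quadraticChar_norm (hk : ringChar k ≠ 2) (y : K) :
    quadraticChar k (Algebra.norm k y) = quadraticChar K y := by
  have hK : ringChar K ≠ 2 := by rwa [← Algebra.ringChar_eq k K]
  refine Int.cast_injOn_of_ringChar_ne_two hK ?_ ?_ ?_
  · rcases quadraticChar_isQuadratic k (Algebra.norm k y) with h | h | h <;> simp [h]
  · rcases quadraticChar_isQuadratic K y with h | h | h <;> simp [h]
  · rw [quadraticChar_eq_pow_of_char_ne_two' hK, ← map_intCast (algebraMap k K),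
      quadraticChar_eq_pow_of_char_ne_two' hk, map_pow, FiniteField.algebraMap_norm_eq_pow,
      ← pow_mul]
    congr 1
    have hq := FiniteField.odd_card_of_char_ne_two hk
    have hQ := FiniteField.odd_card_of_char_ne_two hK
    have hdvd : Nat.card k - 1 ∣ Nat.card K - 1 := by
      rw [Module.natCard_eq_pow_finrank (K := k) (V := K)]
      simpa using Nat.sub_dvd_pow_sub_pow (Nat.card k) 1 (finrank k K)
    rw [Nat.card_eq_fintype_card, Nat.card_eq_fintype_card] at *
    obtain ⟨c, hc⟩ := hdvd
    have h1 : 1 < Fintype.card k := Fintype.one_lt_card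
    have h2 : 1 < Fintype.card K := Fintype.one_lt_card
    rw [hc, Nat.mul_div_cancel_left _ (by omega)]
    obtain ⟨m, hm⟩ : ∃ m, Fintype.card k = 2 * m + 1 := ⟨Fintype.card k / 2, by omega⟩
    rw [hm] at hc ⊢
    have : Fintype.card K = 2 * (m * c) + 1 := by
      rw [Nat.add_sub_cancel] at hc
      rw [← mul_assoc]
      omega
    rw [this]
    have e1 : (2 * m + 1) / 2 = m := by omega
    have e2 : (2 * (m * c) + 1) / 2 = m * c := by omega
    rw [e1, e2, mul_comm]

/-- The quadratic character of the norm of `X³ - d X` modulo a monic polynomial. -/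
def ellLam (d : k) (g : k[X]) : ℤ :=
  quadraticChar k ((-1) ^ g.natDegree * ellNorm d g)

lemma ellLam_one (d : k) : ellLam d 1 = 1 := by
  simp [ellLam]

lemma ellLam_mul (d : k) {g h : k[X]} (hg : g.Monic) (hh : h.Monic) :
    ellLam d (g * h) = ellLam d g * ellLam d h := by
  rw [ellLam, ellLam, ellLam, ← map_mul, hg.natDegree_mul hh, pow_add, map_mul (ellNorm d)]
  congr 1
  ring

lemma quadraticChar_cubic (hk : ringChar k ≠ 2) (d : k) (x : K) :
    quadraticChar K (x ^ 3 - algebraMap k K d * x) =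
      ellLam d (minpoly k x) ^ (finrank k K / (minpoly k x).natDegree) := by
  rw [← quadraticChar_norm (k := k) hk, norm_cubic_eq, map_pow, ellLam]

/-- The character sum `∑ χ(x³ - d x)`. -/
def cubicSum (d : k) : ℤ := ∑ x : k, quadraticChar k (x ^ 3 - d * x)

/-- The character sums over all extensions are thereby governed by the single multiplicative
function `ellLam d` over `k`. -/
lemma cubicSum_algebraMap (hk : ringChar k ≠ 2) (d : k) {n j : ℕ} (hj : finrank k K = j)
    (hn : j ≤ n) : cubicSum (algebraMap k K d) = primePowerSum (ellLam d) n j := by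
  rw [← sum_pow_minpoly_eq_primePowerSum (K := K) _ hj hn, cubicSum]
  simp only [quadraticChar_cubic hk, hj]

end QuadraticChar

/-! ### The `L`-series is a polynomial of degree two -/

section EllSums

open Polynomial

variable {k : Type*} [Field k] [Fintype k] [DecidableEq k]

/-- The nondegenerate binary form `u² - d v²` represents every element of a finite field of odd
order, in particular a nonsquare. -/
lemma exists_quadraticChar_sq_sub (hk : ringChar k ≠ 2) {d : k} (hd : d ≠ 0) :
    ∃ u v : k, quadraticChar k (u ^ 2 - d * v ^ 2) = -1 := by
  obtain ⟨n, hn⟩ := quadraticChar_exists_neg_one hk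
  obtain ⟨u, v, huv⟩ := FiniteField.exists_root_sum_quadratic (f := (X ^ 2 : k[X]))
    (g := C (-d) * X ^ 2 + C 0 * X + C (-n)) (degree_X_pow 2)
    (degree_quadratic (neg_ne_zero.2 hd)) (FiniteField.odd_card_of_char_ne_two hk)
  refine ⟨u, v, ?_⟩
  rw [← hn]
  congr 1
  simp at huv
  linear_combination huv

/-- The sum of the values of the quadratic character at a norm form vanishes. -/
lemma sum_quadraticChar_sq_sub (hk : ringChar k ≠ 2) {d : k} (hd : d ≠ 0) :
    ∑ x : k, ∑ y : k, quadraticChar k (x ^ 2 - d * y ^ 2) = 0 := by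
  obtain ⟨u, v, huv⟩ := exists_quadraticChar_sq_sub hk hd
  have hne : u ^ 2 - d * v ^ 2 ≠ 0 := fun h => by rw [h] at huv; simp at huv
  have hi := mul_inv_cancel₀ hne
  -- Multiplication by `u + v√d` permutes the pairs and multiplies the norm form by a nonsquare, so
  -- the sum equals its negative.
  let e : k × k ≃ k × k :=
    { toFun := fun p => (u * p.1 + d * v * p.2, v * p.1 + u * p.2)
      invFun := fun p => ((u * p.1 - d * v * p.2) * (u ^ 2 - d * v ^ 2)⁻¹,
        (u * p.2 - v * p.1) * (u ^ 2 - d * v ^ 2)⁻¹)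
      left_inv := fun p => Prod.ext (by linear_combination p.1 * hi)
        (by linear_combination p.2 * hi)
      right_inv := fun p => Prod.ext (by linear_combination p.1 * hi)
        (by linear_combination p.2 * hi) }
  rw [← Fintype.sum_prod_type' (f := fun x y : k => quadraticChar k (x ^ 2 - d * y ^ 2))]
  have h1 := Equiv.sum_comp e fun p : k × k => quadraticChar k (p.1 ^ 2 - d * p.2 ^ 2)
  have h2 (p : k × k) : quadraticChar k ((e p).1 ^ 2 - d * (e p).2 ^ 2) =
      -quadraticChar k (p.1 ^ 2 - d * p.2 ^ 2) := by
    rw [← neg_one_mul, ← huv, ← map_mul]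
    congr 1
    simp only [e, Equiv.coe_fn_mk]
    ring
  simp only [h2, Finset.sum_neg_distrib] at h1
  linarith

lemma sum_quadraticChar_zero_sub (d : k) :
    ∑ y : k, quadraticChar k ((0 : k) ^ 2 - d * y ^ 2) =
    (Fintype.card k - 1) * quadraticChar k (-d) := by
  rw [← Finset.add_sum_erase _ _ (Finset.mem_univ (0 : k))]
  have h1 : ∀ y ∈ Finset.univ.erase (0 : k),
      quadraticChar k ((0 : k) ^ 2 - d * y ^ 2) = quadraticChar k (-d) := fun y hy => by
    rw [show (0 : k) ^ 2 - d * y ^ 2 = -d * y ^ 2 by ring, map_mul,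
      quadraticChar_sq_one' (Finset.ne_of_mem_erase hy), mul_one]
  rw [Finset.sum_congr rfl h1, Finset.sum_const, Finset.card_erase_of_mem (Finset.mem_univ _),
    Finset.card_univ, nsmul_eq_mul, Nat.cast_sub Fintype.card_pos]
  simp

/-- Scaling `y` by `m` shows that the sum is the same for all `m ≠ 0`; the vanishing of the double
sum and the value at `m = 0` determine it. -/
lemma sum_quadraticChar_sq_sub_of_ne_zero (hk : ringChar k ≠ 2) {d : k} (hd : d ≠ 0) {m : k}
    (hm : m ≠ 0) : ∑ y : k, quadraticChar k (m ^ 2 - d * y ^ 2) = -quadraticChar k (-d) := by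
  have hscale {m : k} (hm : m ≠ 0) : ∑ y : k, quadraticChar k (m ^ 2 - d * y ^ 2) =
      ∑ y : k, quadraticChar k (1 - d * y ^ 2) := by
    rw [← Equiv.sum_comp (Equiv.mulLeft₀ m hm)]
    refine Finset.sum_congr rfl fun y _ => ?_
    rw [Equiv.mulLeft₀_apply, show m ^ 2 - d * (m * y) ^ 2 = m ^ 2 * (1 - d * y ^ 2) by ring,
      map_mul, quadraticChar_sq_one' hm, one_mul]
  have h := sum_quadraticChar_sq_sub hk hd
  rw [← Finset.add_sum_erase _ _ (Finset.mem_univ (0 : k)), sum_quadraticChar_zero_sub,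
    Finset.sum_congr rfl fun x hx => hscale (Finset.ne_of_mem_erase hx), Finset.sum_const,
    Finset.card_erase_of_mem (Finset.mem_univ _), Finset.card_univ, nsmul_eq_mul,
    Nat.cast_sub Fintype.card_pos, Nat.cast_one, ← mul_add] at h
  have hq : (Fintype.card k : ℤ) - 1 ≠ 0 := by
    have : 1 < Fintype.card k := Fintype.one_lt_card
    omega
  have h3 := (mul_eq_zero.1 h).resolve_left hq
  rw [hscale hm]
  linarith

lemma sum_monics_zero (d : k) : ∑ g ∈ monics k 0, ellLam d g = 1 := by
  have : monics k 0 = {1} := by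
    ext g
    rw [mem_monics, Finset.mem_singleton]
    exact ⟨fun h => h.1.natDegree_eq_zero.1 h.2, by rintro rfl; simp⟩
  rw [this, Finset.sum_singleton, ellLam_one]

lemma sum_monics_two (hk : ringChar k ≠ 2) {d : k} (hd : d ≠ 0) :
    ∑ g ∈ monics k 2, ellLam d g = Fintype.card k := by
  have h1 : ∑ g ∈ monics k 2, ellLam d g = ∑ p : k × k,
      quadraticChar k (p.1 * ((p.1 + d) ^ 2 - d * p.2 ^ 2)) := by
    symm
    refine Finset.sum_bij' (fun p _ => X ^ 2 + C p.2 * X + C p.1)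
      (fun g _ => (g.coeff 0, g.coeff 1)) (fun p _ => ?_) (fun g _ => Finset.mem_univ _)
      (fun p _ => ?_) (fun g hg => ?_) (fun p _ => ?_)
    · rw [mem_monics]
      constructor
      · monicity!
      · compute_degree!
    · ext <;> simp [coeff_X, coeff_C]
    · rw [mem_monics] at hg
      have h2 := hg.1.as_sum
      rw [hg.2, Finset.sum_range_succ, Finset.sum_range_one] at h2
      conv_rhs => rw [h2]
      simp
      ring
    · have h2 : (X ^ 2 + C p.2 * X + C p.1 : k[X]).natDegree = 2 := by compute_degree!
      rw [ellLam, h2, ellNorm_apply]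
      congr 1
      simp only [QuadraticAlgebra.algebraMap_eq, pow_two, map_add, map_mul, aeval_X, aeval_C,
        eval_add, eval_mul, eval_X, eval_C, QuadraticAlgebra.re_add, QuadraticAlgebra.im_add,
        QuadraticAlgebra.re_mul, QuadraticAlgebra.im_mul]
      ring
  rw [h1, Fintype.sum_prod_type]
  -- For `X² + bX + c` the value at `√d` is `(c + d) + b√d`. The row `c = -d` is exceptional and
  -- yields the term `|k|`; the other term sums to 0 over `c`.
  have h2 (c : k) : ∑ b : k, quadraticChar k (c * ((c + d) ^ 2 - d * b ^ 2)) =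
      quadraticChar k c * -quadraticChar k (-d) +
        if c = -d then (Fintype.card k : ℤ) else 0 := by
    simp only [map_mul (quadraticChar k) c, ← Finset.mul_sum]
    split_ifs with h
    · subst h
      have h3 := sum_quadraticChar_zero_sub d
      simp only [neg_add_cancel, h3]
      have h4 := quadraticChar_sq_one (neg_ne_zero.2 hd)
      linear_combination ((Fintype.card k : ℤ)) * h4
    · rw [sum_quadraticChar_sq_sub_of_ne_zero hk hd fun h' => h (eq_neg_of_add_eq_zero_left h'),
        add_zero]
  simp only [h2, Finset.sum_add_distrib, ← Finset.sum_mul, quadraticChar_sum_zero hk]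
  simp

/-- Translation by polynomials of degree at most 2, a full residue system modulo `X³ - dX`, permutes
the monic polynomials of degree `n ≥ 3`. The sum over each full residue system vanishes. -/
lemma sum_monics_of_three_le (hk : ringChar k ≠ 2) {d : k} (hd : d ≠ 0) {n : ℕ} (hn : 3 ≤ n) :
    ∑ g ∈ monics k n, ellLam d g = 0 := by
  have hdeg (r : k × k × k) : (C r.1 + C r.2.1 * X + C r.2.2 * X ^ 2).natDegree < n := by
    refine lt_of_le_of_lt (b := 2) ?_ (by omega)
    compute_degree
  have hshift (r : k × k × k) : ∑ g ∈ monics k n,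
      ellLam d (g + (C r.1 + C r.2.1 * X + C r.2.2 * X ^ 2)) =
        ∑ g ∈ monics k n, ellLam d g := by
    refine Finset.sum_equiv (Equiv.addRight (C r.1 + C r.2.1 * X + C r.2.2 * X ^ 2))
      (fun g => ?_) (fun g _ => by rw [Equiv.coe_addRight])
    have hlt {g : k[X]} (hg : g.natDegree = n) :
        (C r.1 + C r.2.1 * X + C r.2.2 * X ^ 2).degree < g.degree :=
      degree_lt_degree (hg ▸ hdeg r)
    simp only [mem_monics, Equiv.coe_addRight]
    refine ⟨fun h => ⟨h.1.add_of_left (hlt h.2), ?_⟩, fun h => ?_⟩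
    · rw [natDegree_add_eq_left_of_degree_lt (hlt h.2), h.2]
    · rw [← add_sub_cancel_right g (C r.1 + C r.2.1 * X + C r.2.2 * X ^ 2)]
      exact ⟨h.1.sub_of_left (hlt h.2),
        by rw [natDegree_sub_eq_left_of_natDegree_lt (h.2 ▸ hdeg r), h.2]⟩
  have hinner (g : k[X]) (hg : g ∈ monics k n) : ∑ r : k × k × k,
      ellLam d (g + (C r.1 + C r.2.1 * X + C r.2.2 * X ^ 2)) = 0 := by
    obtain ⟨hg1, hg2⟩ := mem_monics.1 hg
    have hval (a b c : k) : ellLam d (g + (C a + C b * X + C c * X ^ 2)) =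
        quadraticChar k ((-1) ^ n * (g.eval 0 + a)) * quadraticChar k
          (((aeval (⟨0, 1⟩ : QuadraticAlgebra k d 0) g).re + a + c * d) ^ 2 -
            d * ((aeval (⟨0, 1⟩ : QuadraticAlgebra k d 0) g).im + b) ^ 2) := by
      rw [ellLam, natDegree_add_eq_left_of_natDegree_lt (hg2 ▸ hdeg (a, b, c)), hg2,
        ellNorm_apply, ← map_mul]
      congr 1
      simp only [QuadraticAlgebra.algebraMap_eq, pow_two, map_add, map_mul, aeval_X, aeval_C,
        eval_add, eval_mul, eval_X, eval_C, QuadraticAlgebra.re_add, QuadraticAlgebra.im_add,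
        QuadraticAlgebra.re_mul, QuadraticAlgebra.im_mul]
      ring
    rw [Fintype.sum_prod_type]
    refine Finset.sum_eq_zero fun a _ => ?_
    rw [Fintype.sum_prod_type]
    simp only [hval, ← Finset.mul_sum]
    generalize (aeval (⟨0, 1⟩ : QuadraticAlgebra k d 0) g) = z
    rw [Finset.sum_comm]
    refine mul_eq_zero_of_right _ (Eq.trans ?_ (sum_quadraticChar_sq_sub hk hd))
    -- For fixed `a`, the pair `(c, b)` runs through all values at `√d`, because `d ≠ 0`.
    refine Fintype.sum_equiv ((Equiv.mulRight₀ d hd).trans (Equiv.addLeft (z.re + a))) _ _ fun c => ?_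
    exact Fintype.sum_equiv (Equiv.addLeft z.im) _ _ fun b => rfl
  have h1 : ∑ r : k × k × k, ∑ g ∈ monics k n,
      ellLam d (g + (C r.1 + C r.2.1 * X + C r.2.2 * X ^ 2)) = 0 := by
    rw [Finset.sum_comm]
    exact Finset.sum_eq_zero hinner
  simp only [hshift, Finset.sum_const, nsmul_eq_mul] at h1
  refine (mul_eq_zero.1 h1).resolve_left ?_
  simp

end EllSums

/-! ### Newton's identities and the points of the curve -/

section Weil

/-- The recursion says `T L'/L = ∑ sⱼ Tʲ` for `L = 1 + L₁T + qT² = (1 - αT)(1 - βT)`. -/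
lemma exists_roots_of_newton {L s : ℕ → ℤ} {q : ℤ} (h0 : L 0 = 1) (h2 : L 2 = q)
    (h3 : ∀ n, 3 ≤ n → L n = 0)
    (h : ∀ n : ℕ, (n : ℤ) * L n = ∑ j ∈ Finset.Icc 1 n, s j * L (n - j)) :
    ∃ α β : ℂ, α * β = q ∧ ∀ n, (s (n + 1) : ℂ) = -(α ^ (n + 1) + β ^ (n + 1)) := by
  obtain ⟨δ, hδ⟩ := IsAlgClosed.exists_pow_nat_eq ((L 1 : ℂ) ^ 2 - 4 * q) two_pos
  refine ⟨(-L 1 + δ) / 2, (-L 1 - δ) / 2, by linear_combination -hδ / 4, ?_⟩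
  set α : ℂ := (-L 1 + δ) / 2 with hα
  set β : ℂ := (-L 1 - δ) / 2 with hβ
  have hsum : α + β = -L 1 := by rw [hα, hβ]; ring
  have hprod : α * β = q := by rw [hα, hβ]; linear_combination -hδ / 4
  have hs1 : s 1 = L 1 := by
    have := h 1
    simp [h0] at this
    exact this.symm
  have hs2 : s 2 = 2 * q - L 1 * L 1 := by
    have := h 2
    rw [show Finset.Icc 1 2 = {1, 2} by rfl, Finset.sum_pair (by norm_num)] at this
    simp [h0, h2, hs1] at this
    linarith
  have hs3 (n : ℕ) : s (n + 3) = -(s (n + 2) * L 1) - s (n + 1) * q := by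
    have := h (n + 3)
    rw [h3 _ (by omega), Finset.sum_Icc_succ_top (by omega), Finset.sum_Icc_succ_top (by omega),
      Finset.sum_Icc_succ_top (by omega), Finset.sum_eq_zero fun j hj => by
        rw [h3 _ (by have := Finset.mem_Icc.1 hj; omega), mul_zero],
      show n + 3 - (n + 1) = 2 by omega, show n + 3 - (n + 1 + 1) = 1 by omega,
      Nat.sub_self, h0, h2] at this
    linarith
  intro n
  induction n using Nat.strong_induction_on with
  | _ n ih =>
    match n, ih with
    | 0, _ => rw [zero_add, pow_one, pow_one, hs1, hsum, neg_neg]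
    | 1, _ =>
      rw [one_add_one_eq_two, hs2]
      push_cast
      linear_combination (-2) * hprod + (α + β - L 1) * hsum
    | n + 2, ih =>
      have e1 := ih n (by omega)
      have e2 := ih (n + 1) (by omega)
      rw [show n + 2 + 1 = n + 3 by rfl, hs3]
      push_cast
      rw [show n + 2 = n + 1 + 1 by rfl, e1, e2]
      linear_combination (α ^ (n + 1 + 1) + β ^ (n + 1 + 1)) * hsum -
        (α ^ (n + 1) + β ^ (n + 1)) * hprod

/-- The affine points of `y² = x³ - D x`. -/
def AffinePoints (D : ℤ) (F : Type*) [Field F] : Type _ :=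
  {p : F × F // p.2 ^ 2 = p.1 ^ 3 - D * p.1}

instance (D : ℤ) (F : Type*) [Field F] [Finite F] : Finite (AffinePoints D F) :=
  inferInstanceAs (Finite {p : F × F // p.2 ^ 2 = p.1 ^ 3 - D * p.1})

variable {F : Type*} [Field F]

lemma ellCurve_nonsingular_iff {D : ℤ} (h2 : (2 : F) ≠ 0) (hD : (D : F) ≠ 0) (x y : F) :
    (ellCurve D F).toAffine.Nonsingular x y ↔ y ^ 2 = x ^ 3 - D * x := by
  have hΔ : (ellCurve D F).toAffine.Δ ≠ 0 := by
    have : (ellCurve D F).toAffine.Δ = 2 ^ 6 * (D : F) ^ 3 := by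
      simp [WeierstrassCurve.Δ, WeierstrassCurve.b₂, WeierstrassCurve.b₄, WeierstrassCurve.b₆,
        WeierstrassCurve.b₈, ellCurve]
      ring
    rw [this]
    exact mul_ne_zero (pow_ne_zero _ h2) (pow_ne_zero _ hD)
  rw [← WeierstrassCurve.Affine.equation_iff_nonsingular_of_Δ_ne_zero hΔ,
    WeierstrassCurve.Affine.equation_iff]
  simp [ellCurve, sub_eq_add_neg]

/-- The points of the curve are the affine points and the point at infinity. -/
def ellPointEquiv {D : ℤ} (h2 : (2 : F) ≠ 0) (hD : (D : F) ≠ 0) :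
    (ellCurve D F).toAffine.Point ≃ Option (AffinePoints D F) where
  toFun P := match P with
    | .zero => none
    | .some x y h => some ⟨(x, y), (ellCurve_nonsingular_iff h2 hD x y).1 h⟩
  invFun o := match o with
    | none => .zero
    | some p => .some p.1.1 p.1.2 ((ellCurve_nonsingular_iff h2 hD _ _).2 p.2)
  left_inv P := by cases P <;> rfl
  right_inv o := by cases o <;> rfl

lemma ellCard_eq_card_affinePoints [Finite F] {D : ℤ} (h2 : (2 : F) ≠ 0) (hD : (D : F) ≠ 0) :
    ellCard D F = Nat.card (AffinePoints D F) + 1 := by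
  rw [ellCard, Nat.card_congr (ellPointEquiv h2 hD), Finite.card_option]

lemma card_affinePoints [Fintype F] [DecidableEq F] {D : ℤ} (hF : ringChar F ≠ 2) :
    (Nat.card (AffinePoints D F) : ℤ) = Fintype.card F + cubicSum (D : F) := by
  have h1 : Nat.card (AffinePoints D F) =
      ∑ x : F, ({y : F | y ^ 2 = x ^ 3 - D * x} : Set F).toFinset.card := by
    rw [Nat.card_congr (show AffinePoints D F ≃ Σ x : F, {y : F | y ^ 2 = x ^ 3 - D * x} from
      ⟨fun p => ⟨p.1.1, p.1.2, p.2⟩, fun p => ⟨(p.1, p.2.1), p.2.2⟩, fun _ => rfl, fun _ => rfl⟩),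
      Nat.card_sigma]
    simp
  rw [h1]
  push_cast
  simp only [quadraticChar_card_sqrts hF, Finset.sum_add_distrib]
  rw [cubicSum]
  simp [add_comm]

lemma ellCard_eq_cubicSum [Fintype F] [DecidableEq F] {D : ℤ} (h2 : (2 : F) ≠ 0)
    (hD : (D : F) ≠ 0) : (ellCard D F : ℤ) = Fintype.card F + 1 + cubicSum (D : F) := by
  have hF : ringChar F ≠ 2 := fun h => h2 (by
    have := ringChar.Nat.cast_ringChar (R := F)
    rwa [h] at this)
  rw [ellCard_eq_card_affinePoints h2 hD, Nat.cast_add, card_affinePoints hF]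
  ring

/-- The projective cubic `D w² u = u³ + w v²` has `|E(F)|` points. -/
lemma ellZeros_add_ellCard [Finite F] {D : ℤ} (h2 : (2 : F) ≠ 0) (hD : (D : F) ≠ 0) :
    ellZeros D F + ellCard D F = Nat.card F * ellCard D F := by
  -- The point at infinity is `(0 : 1 : 0)`, the affine point `(x, y)` is `(-x : y : 1)`, and the
  -- unit `c` scales the representative.
  let g : Fˣ × Option (AffinePoints D F) → {φ : Fin 3 → F // φ ≠ 0 ∧ ellForm D φ = 0} := fun p =>
    match p with
    | (c, none) => ⟨![0, c, 0], fun h => c.ne_zero (by simpa using congrFun h 1),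
        by simp [ellForm]⟩
    | (c, some p) => ⟨![-(c * p.1.1), c * p.1.2, c], fun h => c.ne_zero (by simpa using congrFun h 2),
        by simp [ellForm]; linear_combination -(c : F) ^ 3 * p.2⟩
  have hg : Function.Bijective g := by
    constructor
    · rintro ⟨c, _ | p⟩ ⟨c', _ | p'⟩ h
      · have h1 := congrFun (congrArg Subtype.val h) 1
        simp only [g, Matrix.cons_val_one, Matrix.cons_val_zero] at h1
        rw [Units.ext h1]
      · have h1 := congrFun (congrArg Subtype.val h) 2
        exact absurd h1.symm c'.ne_zero
      · have h1 := congrFun (congrArg Subtype.val h) 2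
        exact absurd h1 c.ne_zero
      · have e0 : -(c * p.1.1) = -(c' * p'.1.1) := congrFun (congrArg Subtype.val h) 0
        have e1 : c * p.1.2 = c' * p'.1.2 := congrFun (congrArg Subtype.val h) 1
        have e2 : (c : F) = c' := congrFun (congrArg Subtype.val h) 2
        obtain rfl := Units.ext e2
        have h3 := mul_left_cancel₀ c.ne_zero (neg_injective e0)
        have h4 := mul_left_cancel₀ c.ne_zero e1
        rw [show p = p' from Subtype.ext (Prod.ext h3 h4)]
    · rintro ⟨φ, hφ, h⟩
      rw [ellForm] at h
      by_cases hw : φ 2 = 0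
      · have hu : φ 0 = 0 := by
          rw [hw] at h
          have : φ 0 ^ 3 = 0 := by linear_combination -h
          exact pow_eq_zero_iff (by norm_num) |>.1 this
        have hv : φ 1 ≠ 0 := fun hv => hφ (by
          ext i
          fin_cases i
          exacts [hu, hv, hw])
        refine ⟨(Units.mk0 _ hv, none), Subtype.ext ?_⟩
        ext i
        fin_cases i <;> simp [g, hu, hw]
      · refine ⟨(Units.mk0 _ hw, some ⟨(-φ 0 / φ 2, φ 1 / φ 2), ?_⟩), Subtype.ext ?_⟩
        · dsimp only
          field_simp
          linear_combination -h
        · ext i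
          fin_cases i <;> simp [g, mul_div_cancel₀, hw]
  have h1 := Nat.card_congr (Equiv.ofBijective g hg)
  have : Fintype F := Fintype.ofFinite F
  classical
  rw [Nat.card_prod, Nat.card_congr (ellPointEquiv h2 hD).symm, Nat.card_units] at h1
  rw [ellZeros, ← h1, ← ellCard, Nat.sub_one_mul, Nat.sub_add_cancel]
  exact Nat.le_mul_of_pos_left _ Nat.card_pos

end Weil

/-! ### Frobenius eigenvalues -/

section Frobenius

variable {k : Type*} [Field k] [Finite k]

/-- Both sides are the character sum over the extension of degree `j`. -/
lemma primePowerSum_ellLam_eq [Fintype k] [DecidableEq k] (hk : ringChar k ≠ 2) (d : k) {n j : ℕ}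
    (hj : 1 ≤ j) (hn : j ≤ n) :
    primePowerSum (ellLam d) n j = primePowerSum (ellLam d) j j := by
  classical
  obtain ⟨p, hp⟩ := CharP.exists k
  have : Fact p.Prime := ⟨CharP.char_is_prime k p⟩
  have : NeZero j := ⟨by omega⟩
  have := Fintype.ofFinite (FiniteField.Extension k p j)
  have h := FiniteField.finrank_extension k p j
  rw [← cubicSum_algebraMap hk d h hn, ← cubicSum_algebraMap hk d h le_rfl]

/-- The numbers of points of the curve over the extensions of a finite field, in terms of the
eigenvalues of Frobenius. -/
theorem exists_ellCard_eq {D : ℤ} (h2 : (2 : k) ≠ 0) (hD : (D : k) ≠ 0) :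
    ∃ α β : ℂ, α * β = Nat.card k ∧ ∀ f : ℕ, 1 ≤ f → ∀ (F : Type v) [Field F],
      Nat.card F = Nat.card k ^ f →
        (ellCard D F : ℂ) = (Nat.card k : ℂ) ^ f + 1 - α ^ f - β ^ f := by
  classical
  have := Fintype.ofFinite k
  have hk : ringChar k ≠ 2 := fun h => h2 (by
    have := ringChar.Nat.cast_ringChar (R := k)
    rwa [h] at this)
  obtain ⟨α, β, h1, hs⟩ := exists_roots_of_newton
    (L := fun n => ∑ g ∈ monics k n, ellLam (D : k) g)
    (s := fun j => primePowerSum (ellLam (D : k)) j j) (q := Nat.card k)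
    (sum_monics_zero _) (by rw [sum_monics_two hk hD, Nat.card_eq_fintype_card])
    (fun n hn => sum_monics_of_three_le hk hD hn) (fun n => by
      rw [natCast_mul_sum_monics (ellLam_one _) fun g h hg hh => ellLam_mul _ hg hh]
      refine Finset.sum_congr rfl fun j hj => ?_
      rw [Finset.mem_Icc] at hj
      rw [primePowerSum_ellLam_eq hk _ hj.1 hj.2])
  refine ⟨α, β, by exact_mod_cast h1, fun f hf F _ hF => ?_⟩
  obtain ⟨p, hp⟩ := CharP.exists k
  have : Fact p.Prime := ⟨CharP.char_is_prime k p⟩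
  have : NeZero f := ⟨by omega⟩
  have := Fintype.ofFinite (FiniteField.Extension k p f)
  have : Finite F := Nat.finite_of_card_ne_zero (by rw [hF]; exact pow_ne_zero _ Nat.card_pos.ne')
  have := Fintype.ofFinite F
  -- Any field with `|k|^f` elements receives a `k`-algebra structure through this isomorphism.
  let e : FiniteField.Extension k p f ≃+* F := FiniteField.ringEquivOfCardEq (by
    rw [← Nat.card_eq_fintype_card, ← Nat.card_eq_fintype_card, hF,
      FiniteField.natCard_extension])
  let := ((e : FiniteField.Extension k p f →+* F).comp
    (algebraMap k (FiniteField.Extension k p f))).toAlgebra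
  have hfin : finrank k F = f := by
    have h3 := Module.natCard_eq_pow_finrank (K := k) (V := F)
    rw [hF] at h3
    exact (Nat.pow_right_injective Finite.one_lt_card h3).symm
  have h2' : (2 : F) ≠ 0 := by
    rw [← map_ofNat (algebraMap k F)]
    exact (map_ne_zero _).2 h2
  have hD' : (D : F) ≠ 0 := by
    rw [← map_intCast (algebraMap k F)]
    exact (map_ne_zero _).2 hD
  have h4 := ellCard_eq_cubicSum h2' hD'
  rw [← map_intCast (algebraMap k F), cubicSum_algebraMap hk _ hfin le_rfl,
    ← Nat.card_eq_fintype_card, hF] at h4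
  obtain ⟨m, rfl⟩ : ∃ m, f = m + 1 := ⟨f - 1, by omega⟩
  have h5 := congrArg (Int.cast : ℤ → ℂ) h4
  push_cast at h5
  rw [h5, hs]
  ring

end Frobenius

/-! ### Exponential sums and independence of the formula -/

section ExpSum

open Polynomial

/-- The value at `f` of the exponential sum `∑ c_λ λ^f`. -/
def expEval (f : ℤ) : MonoidAlgebra ℂ ℂˣ →ₐ[ℂ] ℂ :=
  MonoidAlgebra.lift ℂ ℂ ℂˣ ((Units.coeHom ℂ).comp (zpowGroupHom f))

lemma expEval_single (f : ℤ) (l : ℂˣ) (c : ℂ) :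
    expEval f (MonoidAlgebra.single l c) = c * ((l ^ f : ℂˣ) : ℂ) := by
  simp [expEval]

/-- Dedekind's independence of the characters `n ↦ lⁿ`. The shift to `n + 1`, needed because only `f
≥ 1` is available, multiplies each by the unit `l`. -/
lemma linearIndependent_pow_succ :
    LinearIndependent ℂ fun (l : ℂˣ) (n : ℕ) => (l : ℂ) ^ (n + 1) := by
  have h1 := linearIndependent_monoidHom (Multiplicative ℕ) ℂ
  have h2 : Function.Injective fun l : ℂˣ => powersHom ℂ (l : ℂ) :=
    (powersHom ℂ).injective.comp Units.val_injective
  have h3 := (h1.comp _ h2).units_smul fun l => l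
  change LinearIndependent ℂ (M := Multiplicative ℕ → ℂ)
    fun (l : ℂˣ) (n : Multiplicative ℕ) => (l : ℂ) ^ (n.toAdd + 1)
  have h4 : (fun (l : ℂˣ) (n : Multiplicative ℕ) => (l : ℂ) ^ (n.toAdd + 1)) =
      (fun l : ℂˣ => l) • (fun f : Multiplicative ℕ →* ℂ => (f : Multiplicative ℕ → ℂ)) ∘
        fun l : ℂˣ => powersHom ℂ (l : ℂ) := by
    funext l n
    rw [pow_succ']
    rfl
  rw [h4]
  exact h3

/-- An exponential sum is determined by its values at the positive integers. -/
lemma eq_zero_of_expEval_eq_zero {x : MonoidAlgebra ℂ ℂˣ}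
    (h : ∀ f : ℕ, 1 ≤ f → expEval f x = 0) : x = 0 := by
  have h1 := linearIndependent_iff.1 linearIndependent_pow_succ x.coeff (by
    funext n
    have h2 := h (n + 1) (by omega)
    rw [expEval, MonoidAlgebra.lift_apply] at h2
    rw [Finsupp.linearCombination_apply, Finsupp.sum, Finset.sum_apply]
    rw [Finsupp.sum] at h2
    rw [Pi.zero_apply, ← h2]
    refine Finset.sum_congr rfl fun l _ => ?_
    rw [MonoidHom.comp_apply, zpowGroupHom_apply, zpow_natCast, Units.coeHom_apply,
      Units.val_pow_eq_pow_val]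
    rfl)
  ext l
  rw [h1]
  rfl

/-- The value at `f` of a polynomial whose coefficients are exponential sums. -/
def expEval₂ (f : ℤ) (b : RatFunc ℂ) : (MonoidAlgebra ℂ ℂˣ)[X] →+* RatFunc ℂ :=
  eval₂RingHom ((RatFunc.C : ℂ →+* RatFunc ℂ).comp (expEval f : MonoidAlgebra ℂ ℂˣ →+* ℂ)) b

lemma expEval₂_X (f : ℤ) (P : (MonoidAlgebra ℂ ℂˣ)[X]) :
    expEval₂ f RatFunc.X P =
      algebraMap ℂ[X] (RatFunc ℂ) (P.map (expEval f : MonoidAlgebra ℂ ℂˣ →+* ℂ)) := by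
  induction P using Polynomial.induction_on' with
  | add p q hp hq => rw [map_add, hp, hq, Polynomial.map_add, map_add]
  | monomial n a => simp [expEval₂, ← C_mul_X_pow_eq_monomial]

lemma eq_zero_of_expEval₂_eq_zero {P : (MonoidAlgebra ℂ ℂˣ)[X]}
    (h : ∀ f : ℕ, 1 ≤ f → expEval₂ f RatFunc.X P = 0) : P = 0 := by
  ext1 n
  rw [coeff_zero]
  refine eq_zero_of_expEval_eq_zero fun f hf => ?_
  have h1 := h f hf
  rw [expEval₂_X, map_eq_zero_iff _ (IsFractionRing.injective ℂ[X] (RatFunc ℂ))] at h1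
  simpa using congrArg (fun p => coeff p n) h1

/-- Up to a power of `X`, the substitution `X ↦ X⁻¹` reverses the coefficients. -/
lemma expEval₂_X_inv_ne_zero {f : ℤ} {P : (MonoidAlgebra ℂ ℂˣ)[X]}
    (h : expEval₂ f RatFunc.X P ≠ 0) : expEval₂ f RatFunc.X⁻¹ P ≠ 0 := by
  rw [expEval₂_X] at h
  have h0 : P.map (expEval f : MonoidAlgebra ℂ ℂˣ →+* ℂ) ≠ 0 := fun h0 => h (by rw [h0, map_zero])
  let := invertibleOfNonzero (inv_ne_zero (RatFunc.X_ne_zero (K := ℂ)))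
  have h1 := eval₂_reverse_mul_pow (RatFunc.C : ℂ →+* RatFunc ℂ) (RatFunc.X⁻¹ : RatFunc ℂ)
    (P.map (expEval f : MonoidAlgebra ℂ ℂˣ →+* ℂ))
  have h2 : expEval₂ f RatFunc.X⁻¹ P = eval₂ (RatFunc.C : ℂ →+* RatFunc ℂ) (RatFunc.X⁻¹ : RatFunc ℂ)
    (P.map (expEval f : MonoidAlgebra ℂ ℂˣ →+* ℂ)) := by
    rw [eval₂_map]; rfl
  rw [h2, ← h1]
  refine mul_ne_zero ?_ (pow_ne_zero _ (inv_ne_zero RatFunc.X_ne_zero))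
  rw [invOf_eq_inv, inv_inv]
  have h3 (p : ℂ[X]) : eval₂ (RatFunc.C : ℂ →+* RatFunc ℂ) RatFunc.X p =
      algebraMap ℂ[X] (RatFunc ℂ) p := by
    induction p using Polynomial.induction_on' with
    | add p q hp hq => rw [eval₂_add, hp, hq, map_add]
    | monomial n a => simp [← C_mul_X_pow_eq_monomial]
  rw [h3, Ne, map_eq_zero_iff _ (IsFractionRing.injective ℂ[X] (RatFunc ℂ)), reverse_eq_zero]
  exact h0

/-- The common numerator vanishes at all `f ≥ 1`, hence identically, hence at `f = -1`. The group
algebra of `ℂˣ` has zero divisors, so denominators are cleared after evaluation, where they are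
nonzero. -/
lemma sum_expEval₂_div_eq_zero {ι : Type*} [Fintype ι] (N Δ : ι → (MonoidAlgebra ℂ ℂˣ)[X])
    (hreg : ∀ i, ∀ f : ℤ, (1 ≤ f ∨ f = -1) → expEval₂ f RatFunc.X (Δ i) ≠ 0)
    (h : ∀ f : ℕ, 1 ≤ f → ∑ i, expEval₂ f RatFunc.X (N i) / expEval₂ f RatFunc.X (Δ i) = 0) :
    ∑ i, expEval₂ (-1) RatFunc.X⁻¹ (N i) / expEval₂ (-1) RatFunc.X⁻¹ (Δ i) = 0 := by
  classical
  have key (f : ℤ) (b : RatFunc ℂ) (hb : ∀ i, expEval₂ f b (Δ i) ≠ 0) :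
      expEval₂ f b (∑ i, N i * ∏ j ∈ Finset.univ.erase i, Δ j) =
        (∏ j, expEval₂ f b (Δ j)) * ∑ i, expEval₂ f b (N i) / expEval₂ f b (Δ i) := by
    rw [map_sum, Finset.mul_sum]
    refine Finset.sum_congr rfl fun i _ => ?_
    rw [map_mul, map_prod, ← Finset.mul_prod_erase _ _ (Finset.mem_univ i)]
    have := hb i
    field_simp
  have h0 : ∑ i, N i * ∏ j ∈ Finset.univ.erase i, Δ j = 0 :=
    eq_zero_of_expEval₂_eq_zero fun f hf => by
      rw [key _ _ fun i => hreg i f (Or.inl (by exact_mod_cast hf)), h f hf, mul_zero]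
  have hne (i : ι) := expEval₂_X_inv_ne_zero (hreg i (-1) (Or.inr rfl))
  have h1 := key (-1) RatFunc.X⁻¹ hne
  rw [h0, map_zero, eq_comm, mul_eq_zero] at h1
  exact h1.resolve_left (Finset.prod_ne_zero_iff.2 fun i _ => hne i)

/-- The exponential sum with given integral multiplicities. -/
def expSum (m : ℂˣ →₀ ℤ) : MonoidAlgebra ℂ ℂˣ :=
  m.sum fun l c => MonoidAlgebra.single l (c : ℂ)

lemma expEval_expSum (m : ℂˣ →₀ ℤ) (f : ℤ) : expEval f (expSum m) = powerSum m f := by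
  rw [expSum, Finsupp.sum, map_sum, powerSum, Finsupp.sum]
  simp only [expEval_single]

/-- The substitution `X = q^f` in a polynomial in two variables. -/
def expPoly (q : ℂˣ) (P : ℚ[X][X]) : (MonoidAlgebra ℂ ℂˣ)[X] :=
  P.map (aeval (MonoidAlgebra.single q (1 : ℂ)) : ℚ[X] →ₐ[ℚ] MonoidAlgebra ℂ ℂˣ).toRingHom

lemma expEval₂_expPoly (q : ℂˣ) (P : ℚ[X][X]) (f : ℤ) (b : RatFunc ℂ) :
    expEval₂ f b (expPoly q P) = evalXY P ((q : ℂ) ^ f) b := by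
  rw [expEval₂, coe_eval₂RingHom, expPoly, eval₂_map, evalXY]
  congr 1
  refine ringHom_ext' (RingHom.ext_rat _ _) ?_
  · simp [expEval_single]

lemma expEval₂_C (f : ℤ) (b : RatFunc ℂ) (x : MonoidAlgebra ℂ ℂˣ) :
    expEval₂ f b (C x) = RatFunc.C (expEval f x) := by
  simp [expEval₂]

lemma DenefFormula.value_eq (𝓓 : DenefFormula) {q : ℕ} (u : ℂˣ) (hu : (u : ℂ) = q) (f : ℤ)
    (b : RatFunc ℂ) : 𝓓.value q f b = ∑ i, expEval₂ f b (C (expSum (𝓓.eig i)) *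
      expPoly u (𝓓.num i)) / expEval₂ f b (expPoly u (𝓓.den i)) := by
  rw [DenefFormula.value]
  refine Finset.sum_congr rfl fun i _ => ?_
  rw [map_mul, expEval₂_C, expEval_expSum, expEval₂_expPoly, expEval₂_expPoly, hu, mul_div_assoc]

/-- The result of the operation `q → q⁻¹` does not depend on the formula. -/
theorem DenefFormula.value_neg_one_eq {𝓓 𝓓' : DenefFormula} {q : ℕ} (hq : q ≠ 0)
    (h : 𝓓.Regular q) (h' : 𝓓'.Regular q)
    (heq : ∀ f : ℕ, 1 ≤ f → 𝓓.value q f RatFunc.X = 𝓓'.value q f RatFunc.X) :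
    𝓓.value q (-1) RatFunc.X⁻¹ = 𝓓'.value q (-1) RatFunc.X⁻¹ := by
  obtain ⟨u, hu⟩ : ∃ u : ℂˣ, (u : ℂ) = q := ⟨Units.mk0 q (by exact_mod_cast hq), rfl⟩
  have hsplit (f : ℤ) (b : RatFunc ℂ) : 𝓓.value q f b - 𝓓'.value q f b =
      ∑ i : Fin 𝓓.n ⊕ Fin 𝓓'.n, expEval₂ f b (Sum.elim
        (fun i => C (expSum (𝓓.eig i)) * expPoly u (𝓓.num i))
        (fun i => -(C (expSum (𝓓'.eig i)) * expPoly u (𝓓'.num i))) i) /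
        expEval₂ f b (Sum.elim (fun i => expPoly u (𝓓.den i))
          (fun i => expPoly u (𝓓'.den i)) i) := by
    rw [𝓓.value_eq u hu, 𝓓'.value_eq u hu, Fintype.sum_sum_type, sub_eq_add_neg,
      ← Finset.sum_neg_distrib]
    simp only [Sum.elim_inl, Sum.elim_inr, map_neg]
    exact congrArg _ (Finset.sum_congr rfl fun _ _ => (neg_div _ _).symm)
  rw [← sub_eq_zero, hsplit]
  refine sum_expEval₂_div_eq_zero _ _ (fun i f hf => ?_) fun f hf => ?_
  · rcases i with i | i
    · rw [Sum.elim_inl, expEval₂_expPoly, hu]; exact h i f hf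
    · rw [Sum.elim_inr, expEval₂_expPoly, hu]; exact h' i f hf
  · rw [← hsplit, heq f hf, sub_self]

end ExpSum

/-! ### Uniqueness of the rational function -/

section Rational

variable {R : Type u} [CommRing R] {Q : Type v} [Quiver.{w} Q] [Fintype Q]

/-- The rational function in `q^{-s}` that describes a zeta function is unique. -/
theorem QuiverRep.ZetaEqRational.unique {V : QuiverRep.{u, v, w, x} R Q} {q : ℕ} (hq : 1 < q)
    {Z Z' : RatFunc ℂ} (h : V.ZetaEqRational q Z) (h' : V.ZetaEqRational q Z') : Z = Z' := by
  obtain ⟨r, hr⟩ := h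
  obtain ⟨r', hr'⟩ := h'
  -- The cross difference has infinitely many roots `q⁻ˢ`, taken at real `s` beyond both abscissas.
  have key : Z.num * Z'.denom - Z'.num * Z.denom = 0 := by
    refine Polynomial.eq_zero_of_infinite_isRoot _ (Set.infinite_of_injective_forall_mem
      (f := fun n : ℕ => (q : ℂ) ^ (-(((|r| + |r'| + 1 + n : ℝ)) : ℂ))) (fun m n hmn => ?_)
      fun n => ?_)
    · have h1 := congrArg (‖·‖) hmn
      simp only [Complex.norm_natCast_cpow_of_pos (by omega : 0 < q)] at h1
      simp only [Complex.neg_re, Complex.ofReal_re] at h1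
      have h2 := (Real.rpow_right_inj (by exact_mod_cast (by omega : 0 < q))
        (by exact_mod_cast hq.ne')).1 h1
      have : (m : ℝ) = n := by linarith
      exact_mod_cast this
    · set s : ℂ := ((|r| + |r'| + 1 + n : ℝ) : ℂ) with hs
      have hre : s.re = |r| + |r'| + 1 + n := by rw [hs, Complex.ofReal_re]
      have hn : (0 : ℝ) ≤ n := Nat.cast_nonneg n
      have h1 := (hr s (by rw [hre]; linarith [le_abs_self r, abs_nonneg r'])).2
      have h2 := (hr' s (by rw [hre]; linarith [le_abs_self r', abs_nonneg r])).2
      rw [Set.mem_ofPred_eq, Polynomial.IsRoot.def, Polynomial.eval_sub, Polynomial.eval_mul,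
        Polynomial.eval_mul, ← h1, ← h2]
      ring
  rw [← RatFunc.num_div_denom Z, RatFunc.num_div_denom Z, ← RatFunc.num_div_denom Z',
    ← RatFunc.num_mul_eq_mul_denom_iff (RatFunc.denom_ne_zero Z')]
  exact sub_eq_zero.1 key

end Rational

/-! ### Power series rings as test rings -/

section Ring

open PowerSeries

lemma isAdicComplete_powerSeries (F : Type u) [Field F] :
    IsAdicComplete (maximalIdeal F⟦X⟧) F⟦X⟧ := by
  rw [PowerSeries.maximalIdeal_eq_span_X]
  infer_instance

lemma card_residueField_powerSeries (F : Type u) [Field F] :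
    Nat.card (ResidueField F⟦X⟧) = Nat.card F :=
  Nat.card_congr residueFieldOfPowerSeries.toEquiv

lemma exists_field_natCard_eq_pow (k : Type*) [Field k] [Finite k] {f : ℕ} (hf : 1 ≤ f) :
    ∃ (F : Type u) (_ : Field F), Nat.card F = Nat.card k ^ f := by
  obtain ⟨p, hp⟩ := CharP.exists k
  have : Fact p.Prime := ⟨CharP.char_is_prime k p⟩
  have : NeZero f := ⟨by omega⟩
  exact ⟨ULift (FiniteField.Extension k p f), inferInstance, by
    rw [Nat.card_ulift, FiniteField.natCard_extension]⟩

end Ring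

/-! ### The functional equation of `W₁ + N W₂` -/

section FunctionalEquation

/-- The numerator of `W₁(q, t) + N W₂(q, t)`. -/
def ellZetaNum {R : Type*} [CommRing R] (q N t : R) : R :=
  (1 + (q + 1) * (t ^ 4 + t ^ 5) + q * t ^ 9) * (1 - q * t ^ 3) +
    N * ((1 - t) * t ^ 3 * (1 + q * t ^ 5))

/-- The denominator of `W₁(q, t) + N W₂(q, t)`. -/
def ellZetaDen {R : Type*} [CommRing R] (q t : R) : R :=
  (1 - t) * (1 - q * t) * (1 - q ^ 2 * t) * (1 - q ^ 2 * t ^ 4) * (1 - q ^ 2 * t ^ 5) *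
    (1 - t ^ 6) * (1 - q * t ^ 3)

lemma map_ellZetaNum {R S : Type*} [CommRing R] [CommRing S] (φ : R →+* S) (q N t : R) :
    φ (ellZetaNum q N t) = ellZetaNum (φ q) (φ N) (φ t) := by
  simp [ellZetaNum]

lemma map_ellZetaDen {R S : Type*} [CommRing R] [CommRing S] (φ : R →+* S) (q t : R) :
    φ (ellZetaDen q t) = ellZetaDen (φ q) (φ t) := by
  simp [ellZetaDen]

lemma ellZetaDen_ne_zero {R : Type*} [CommRing R] [IsDomain R] {q t : R}
    (h : ∀ a b : ℕ, a ≤ 2 → b ≠ 0 → 1 - q ^ a * t ^ b ≠ 0) : ellZetaDen q t ≠ 0 := by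
  have e1 := h 0 1 (by norm_num) one_ne_zero
  have e2 := h 1 1 (by norm_num) one_ne_zero
  have e3 := h 2 1 (by norm_num) one_ne_zero
  have e4 := h 2 4 (by norm_num) (by norm_num)
  have e5 := h 2 5 (by norm_num) (by norm_num)
  have e6 := h 0 6 (by norm_num) (by norm_num)
  have e7 := h 1 3 (by norm_num) (by norm_num)
  simp only [pow_zero, one_mul, pow_one] at e1 e2 e3 e6 e7
  simp only [ellZetaDen, ne_eq, mul_eq_zero, e1, e2, e3, e4, e5, e6, e7, or_self,
    not_false_eq_true]

variable {K : Type*} [Field K]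

lemma W₁_add_mul_W₂ {q t : K} (h : 1 - q * t ^ 3 ≠ 0) (N : K) :
    W₁ q t + N * W₂ q t = ellZetaNum q N t / ellZetaDen q t := by
  rw [W₁, W₂, ellZetaNum, ellZetaDen, ← mul_div_mul_right _ _ h, ← mul_div_assoc,
    mul_right_comm _ (1 - q * t ^ 3) (1 - t ^ 6), ← add_div]

lemma one_sub_inv_pow_mul {q t : K} (hq : q ≠ 0) (ht : t ≠ 0) (a b : ℕ) :
    1 - q⁻¹ ^ a * t⁻¹ ^ b = -(1 - q ^ a * t ^ b) / (q ^ a * t ^ b) := by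
  rw [inv_pow, inv_pow]
  field_simp
  ring

/-- Each of the seven factors `1 - qᵃtᵇ` contributes a sign and `qᵃtᵇ`. -/
lemma ellZetaDen_inv {q t : K} (hq : q ≠ 0) (ht : t ≠ 0) :
    ellZetaDen q⁻¹ t⁻¹ = -ellZetaDen q t / (q ^ 8 * t ^ 21) := by
  have h := one_sub_inv_pow_mul hq ht
  have e1 := h 0 1
  have e2 := h 1 1
  have e3 := h 2 1
  have e4 := h 2 4
  have e5 := h 2 5
  have e6 := h 0 6
  have e7 := h 1 3
  simp only [pow_zero, one_mul, pow_one] at e1 e2 e3 e6 e7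
  rw [ellZetaDen, e1, e2, e3, e4, e5, e6, e7, ellZetaDen]
  field_simp

/-- The parts with and without `N` acquire the same factor exactly because `N` becomes `N / q`.
Division by the factor of the denominator leaves `q⁶ t⁹`. -/
lemma ellZetaNum_inv {q t : K} (hq : q ≠ 0) (ht : t ≠ 0) (N : K) :
    ellZetaNum q⁻¹ (N / q) t⁻¹ = -ellZetaNum q N t / (q ^ 2 * t ^ 12) := by
  rw [ellZetaNum, ellZetaNum]
  field_simp
  ring

/-- The functional equation, with `N / q` as the value of `N` after inversion. -/
lemma functionalEquation {q t : K} (hq : q ≠ 0) (ht : t ≠ 0) (h : 1 - q * t ^ 3 ≠ 0) (N : K) :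
    W₁ q⁻¹ t⁻¹ + N / q * W₂ q⁻¹ t⁻¹ = q ^ 6 * t ^ 9 * (W₁ q t + N * W₂ q t) := by
  have h' : 1 - q⁻¹ * t⁻¹ ^ 3 ≠ 0 := by
    have := one_sub_inv_pow_mul hq ht 1 3
    rw [pow_one, pow_one] at this
    rw [this]
    exact div_ne_zero (neg_ne_zero.2 h) (mul_ne_zero hq (pow_ne_zero _ ht))
  rw [W₁_add_mul_W₂ h, W₁_add_mul_W₂ h', ellZetaNum_inv hq ht, ellZetaDen_inv hq ht]
  rcases eq_or_ne (ellZetaDen q t) 0 with h0 | h0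
  · simp [h0]
  · field_simp

lemma one_sub_C_pow_mul_X_pow_ne_zero (c : ℂ) (a : ℕ) {b : ℕ}
    (hb : b ≠ 0) : 1 - RatFunc.C c ^ a * RatFunc.X ^ b ≠ 0 := by
  have h : (1 - Polynomial.C c ^ a * Polynomial.X ^ b : Polynomial ℂ) ≠ 0 := fun h => by
    have := congrArg (Polynomial.eval 0) h
    simp [hb] at this
  have h2 := (map_ne_zero_iff _ (IsFractionRing.injective (Polynomial ℂ) (RatFunc ℂ))).2 h
  simpa using h2

lemma ellZetaDen_C_X_ne_zero (c : ℂ) : ellZetaDen (RatFunc.C c) RatFunc.X ≠ 0 :=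
  ellZetaDen_ne_zero fun a _ _ hb => one_sub_C_pow_mul_X_pow_ne_zero c a hb

lemma one_sub_C_mul_X_pow_ne_zero (c : ℂ) : 1 - RatFunc.C c * RatFunc.X ^ 3 ≠ 0 := by
  simpa using one_sub_C_pow_mul_X_pow_ne_zero c 1 (b := 3) (by norm_num)

end FunctionalEquation

/-! ### The explicit Denef-type formula -/

section Formula

open Polynomial

/-- The formula `1 · W₁ + (1 + q - α - β) · W₂`. -/
def ellDenef (q α β : ℂˣ) : DenefFormula where
  n := 2
  eig := ![.single 1 1, .single 1 1 + .single q 1 - .single α 1 - .single β 1]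
  num := ![1 + (C X + 1) * (X ^ 4 + X ^ 5) + C X * X ^ 9, (1 - X) * X ^ 3 * (1 + C X * X ^ 5)]
  den := ![(1 - X) * (1 - C X * X) * (1 - C X ^ 2 * X) * (1 - C X ^ 2 * X ^ 4) *
      (1 - C X ^ 2 * X ^ 5) * (1 - X ^ 6),
    (1 - X) * (1 - C X * X) * (1 - C X ^ 2 * X) * (1 - C X ^ 2 * X ^ 4) *
      (1 - C X ^ 2 * X ^ 5) * (1 - C X * X ^ 3) * (1 - X ^ 6)]

lemma powerSum_add (m m' : ℂˣ →₀ ℤ) (f : ℤ) :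
    powerSum (m + m') f = powerSum m f + powerSum m' f :=
  Finsupp.sum_add_index' (by simp) (by intros; push_cast; ring)

lemma powerSum_sub (m m' : ℂˣ →₀ ℤ) (f : ℤ) :
    powerSum (m - m') f = powerSum m f - powerSum m' f :=
  Finsupp.sum_sub_index (by intros; push_cast; ring)

lemma powerSum_single (l : ℂˣ) (f : ℤ) : powerSum (.single l 1) f = (l : ℂ) ^ f := by
  simp [powerSum]

lemma value_ellDenef (q : ℕ) (u α β : ℂˣ) (f : ℤ) (b : RatFunc ℂ) :
    (ellDenef u α β).value q f b = W₁ (RatFunc.C ((q : ℂ) ^ f)) b +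
      RatFunc.C (1 + (u : ℂ) ^ f - (α : ℂ) ^ f - (β : ℂ) ^ f) *
        W₂ (RatFunc.C ((q : ℂ) ^ f)) b := by
  have h : (ellDenef u α β).value q f b = ∑ i : Fin 2,
      RatFunc.C (powerSum ((ellDenef u α β).eig i) f) *
        (evalXY ((ellDenef u α β).num i) ((q : ℂ) ^ f) b /
          evalXY ((ellDenef u α β).den i) ((q : ℂ) ^ f) b) := rfl
  rw [h, Fin.sum_univ_two]
  simp only [ellDenef, Matrix.cons_val_zero, Matrix.cons_val_one, powerSum_add, powerSum_sub,
    powerSum_single, W₁, W₂]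
  simp [evalXY, eval₂_add, eval₂_sub, eval₂_mul, eval₂_pow]

lemma regular_ellDenef (q : ℕ) (u α β : ℂˣ) : (ellDenef u α β).Regular q := by
  have h : ∀ i : Fin 2, ∀ f : ℤ,
      evalXY ((ellDenef u α β).den i) ((q : ℂ) ^ f) RatFunc.X ≠ 0 := fun i f => by
    have h0 := ellZetaDen_C_X_ne_zero ((q : ℂ) ^ f)
    fin_cases i
    · refine left_ne_zero_of_mul (b := 1 - RatFunc.C ((q : ℂ) ^ f) * RatFunc.X ^ 3) ?_
      convert h0 using 1
      simp [ellDenef, evalXY, eval₂_sub, eval₂_mul, eval₂_pow, ellZetaDen]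
    · rw [ellZetaDen, mul_right_comm _ (1 - RatFunc.X ^ 6)] at h0
      convert h0 using 1
      simp [ellDenef, evalXY, eval₂_sub, eval₂_mul, eval₂_pow]
  exact fun i f _ => h i f

end Formula

/-! ### Assembly -/

section Main

/-- `q^f = |k|` vanishes in `k`, so a Bézout relation makes `2D` invertible there. -/
lemma residue_ne_zero_of_isCoprime {k : Type*} [Field k] {D : ℤ} {q f : ℕ}
    (hcop : IsCoprime (q : ℤ) (2 * D)) (hk : Nat.card k = q ^ f) (hq : q ≠ 0) :
    (2 : k) ≠ 0 ∧ (D : k) ≠ 0 := by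
  have : Finite k := Nat.finite_of_card_ne_zero (hk ▸ pow_ne_zero _ hq)
  have h0 : (q : k) ^ f = 0 := by
    have := Fintype.ofFinite k
    rw [← Nat.cast_pow, ← hk, Nat.card_eq_fintype_card, Nat.cast_card_eq_zero]
  obtain ⟨a, b, hab⟩ := hcop.pow_left (m := f)
  have h1 := congrArg (Int.cast : ℤ → k) hab
  push_cast at h1
  rw [h0, mul_zero, zero_add] at h1
  constructor <;> intro h <;> simp [h] at h1

variable {O : Type u} [CommRing O] [IsDomain O] [IsDiscreteValuationRing O]

lemma zetaEqRational_ellRep [Finite (ResidueField O)] {D : ℤ} (h2 : (2 : ResidueField O) ≠ 0)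
    (hD : (D : ResidueField O) ≠ 0) {q : ℕ} (hq : Nat.card (ResidueField O) = q) :
    ((ellRep D).baseChange O).ZetaEqRational q
      (W₁ (RatFunc.C (q : ℂ)) RatFunc.X +
        RatFunc.C (ellCard D (ResidueField O) : ℂ) * W₂ (RatFunc.C (q : ℂ)) RatFunc.X) := by
  refine ⟨6, fun s hs => ?_⟩
  have hN := ellZeros_add_ellCard h2 hD
  rw [hq] at hN
  have h := lSeriesHasSum_zetaCoeff h2 hD hq.symm hN hs
  have hq1 : 1 < q := hq ▸ Finite.one_lt_card
  have ht := pow_six_mul_norm_cpow_lt_one hq1 hs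
  refine ⟨h.LSeriesSummable, ?_⟩
  rw [h.LSeries_eq]
  generalize (q : ℂ) ^ (-s) = t at ht
  have hne (a b : ℕ) (ha : a ≤ 2) (hb : b ≠ 0) : 1 - (q : ℂ) ^ a * t ^ b ≠ 0 :=
    one_sub_ne_zero_of_norm_lt_one (norm_natCast_pow_mul_pow_lt_one hq1 ht (by omega) hb)
  have hden : ellZetaDen (q : ℂ) t ≠ 0 := ellZetaDen_ne_zero hne
  have h3 := hne 1 3 (by norm_num) (by norm_num)
  rw [pow_one] at h3
  rw [W₁_add_mul_W₂ h3, W₁_add_mul_W₂ (one_sub_C_mul_X_pow_ne_zero _)]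
  set N : ℂ := (ellCard D (ResidueField O) : ℂ)
  set P := ellZetaNum (Polynomial.C (q : ℂ)) (Polynomial.C N) Polynomial.X
  set R := ellZetaDen (Polynomial.C (q : ℂ)) (Polynomial.X : Polynomial ℂ)
  have hR : R ≠ 0 := fun hR => hden (by
    have := map_ellZetaDen (Polynomial.evalRingHom t) (Polynomial.C (q : ℂ)) Polynomial.X
    rw [show ellZetaDen (Polynomial.C (q : ℂ)) Polynomial.X = 0 from hR, map_zero] at this
    simpa using this.symm)
  -- The reduced numerator and denominator may differ from the explicit ones, so the two fractions
  -- are compared by cross-multiplication before evaluation at `t`.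
  have hZ := (RatFunc.num_mul_eq_mul_denom_iff (x := ellZetaNum (RatFunc.C (q : ℂ))
    (RatFunc.C N) RatFunc.X / ellZetaDen (RatFunc.C (q : ℂ)) RatFunc.X) (p := P) hR).2 (by
      rw [map_ellZetaNum, map_ellZetaDen]
      simp)
  have hev := congrArg (Polynomial.evalRingHom t) hZ
  rw [map_mul, map_mul, map_ellZetaNum, map_ellZetaDen] at hev
  simp only [Polynomial.coe_evalRingHom, Polynomial.eval_C, Polynomial.eval_X] at hev
  rw [div_mul_eq_mul_div, div_eq_iff hden, hev]

end Main

end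

theorem proposition3p11 {O : Type u} [CommRing O] [IsDomain O] [IsDiscreteValuationRing O]
    [IsAdicComplete (IsLocalRing.maximalIdeal O) O] [Finite (IsLocalRing.ResidueField O)]
    (D : ℤ) (hD : D ≠ 0) (q : ℕ) (hq : Nat.card (IsLocalRing.ResidueField O) = q)
    (hcop : IsCoprime (q : ℤ) (2 * D)) :
    -- all the numbers of subrepresentations are finite
    (∀ m : ℕ, (((ellRep D).baseChange O).subrepsOfIndex m).Finite) ∧
    -- the explicit formula, on the half-plane `Re s > rk V = 6` (with absolute convergence)
    (∀ s : ℂ, 6 < s.re →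
      LSeriesHasSum ((ellRep D).baseChange O).zetaCoeff s
        (W₁ (q : ℂ) ((q : ℂ) ^ (-s)) +
          (ellCard D (IsLocalRing.ResidueField O) : ℂ) * W₂ (q : ℂ) ((q : ℂ) ^ (-s)))) ∧
    -- the functional equation: the result of the operation `q → q⁻¹` exists, is unique, and
    -- equals `q^{6 - 9s} ζ(s)`
    (∃ Z : RatFunc ℂ, ((ellRep D).baseChange O).ZetaEqRational q Z ∧
      ∀ Z' : RatFunc ℂ, IsInversionOfZeta.{0, 0, 0, u} (ellRep D) q Z' ↔
        Z' = RatFunc.C ((q : ℂ) ^ (Nat.choose 3 2 + Nat.choose 3 2)) *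
          RatFunc.X ^ (6 + 3) * Z) := by
  have hq1 : 1 < q := hq ▸ Finite.one_lt_card
  have hq0 : q ≠ 0 := by omega
  have hqc : (q : ℂ) ≠ 0 := by exact_mod_cast hq0
  obtain ⟨h2, hDk⟩ := residue_ne_zero_of_isCoprime (f := 1) hcop (by rw [hq, pow_one]) hq0
  have hN := ellZeros_add_ellCard h2 hDk
  rw [hq] at hN
  refine ⟨fun m => finite_subrepsOfIndex h2 hDk hq.symm hN m,
    fun s hs => lSeriesHasSum_zetaCoeff h2 hDk hq.symm hN hs, _,
    zetaEqRational_ellRep h2 hDk hq, ?_⟩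
  obtain ⟨α, β, hαβ, hE⟩ := exists_ellCard_eq.{u} h2 hDk
  rw [hq] at hαβ hE
  obtain ⟨a, rfl⟩ : ∃ a : ℂˣ, (a : ℂ) = α :=
    ⟨Units.mk0 α (left_ne_zero_of_mul (hαβ ▸ hqc)), rfl⟩
  obtain ⟨b, rfl⟩ : ∃ b : ℂˣ, (b : ℂ) = β :=
    ⟨Units.mk0 β (right_ne_zero_of_mul (hαβ ▸ hqc)), rfl⟩
  obtain ⟨u, hu⟩ : ∃ u : ℂˣ, (u : ℂ) = q := ⟨Units.mk0 q hqc, rfl⟩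
  have hform (f : ℕ) (hf : 1 ≤ f) (R : Type u) [CommRing R] [IsDomain R]
      [IsDiscreteValuationRing R] (hR : Nat.card (ResidueField R) = q ^ f) :
      ((ellRep D).baseChange R).ZetaEqRational (q ^ f)
        ((ellDenef u a b).value q f RatFunc.X) := by
    have : Finite (ResidueField R) :=
      Nat.finite_of_card_ne_zero (by rw [hR]; exact pow_ne_zero _ hq0)
    obtain ⟨h2R, hDR⟩ := residue_ne_zero_of_isCoprime hcop hR hq0
    have h := zetaEqRational_ellRep h2R hDR hR
    rw [hE f hf _ hR] at h
    rw [value_ellDenef, zpow_natCast, zpow_natCast, zpow_natCast, zpow_natCast, hu]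
    rw [Nat.cast_pow] at h
    rwa [add_comm 1 ((q : ℂ) ^ f)]
  have hE1 := hE 1 le_rfl (ResidueField O) (by rw [hq, pow_one])
  have hneg : (ellDenef u a b).value q (-1) RatFunc.X⁻¹ =
      RatFunc.C ((q : ℂ) ^ (Nat.choose 3 2 + Nat.choose 3 2)) * RatFunc.X ^ (6 + 3) *
        (W₁ (RatFunc.C (q : ℂ)) RatFunc.X + RatFunc.C (ellCard D (ResidueField O) : ℂ) *
          W₂ (RatFunc.C (q : ℂ)) RatFunc.X) := by
    -- As `αβ = q`, one has `1 + 1/q - 1/α - 1/β = (q + 1 - α - β)/q`.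
    have h3 : (1 + (u : ℂ) ^ (-1 : ℤ) - (a : ℂ) ^ (-1 : ℤ) - (b : ℂ) ^ (-1 : ℤ)) =
        (ellCard D (ResidueField O) : ℂ) / q := by
      rw [hE1, hu, ← hαβ]
      have ha := a.ne_zero
      have hb := b.ne_zero
      simp only [zpow_neg_one, pow_one]
      field_simp
      ring
    have hC : RatFunc.C (q : ℂ) ≠ 0 := (map_ne_zero _).2 hqc
    have h4 := functionalEquation hC RatFunc.X_ne_zero (one_sub_C_mul_X_pow_ne_zero (q : ℂ))
      (RatFunc.C (ellCard D (ResidueField O) : ℂ))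
    rw [value_ellDenef, h3, zpow_neg_one, map_inv₀, map_div₀, h4,
      show Nat.choose 3 2 + Nat.choose 3 2 = 6 by decide, map_pow]
  intro Z'
  constructor
  · rintro ⟨𝓓, hreg, h𝓓, rfl⟩
    rw [← hneg]
    refine DenefFormula.value_neg_one_eq hq0 hreg (regular_ellDenef q u a b) fun f hf => ?_
    -- For each `f`, the ring `F⟦X⟧` with `|F| = q^f` forces the two formulae to agree.
    obtain ⟨F, _, hF⟩ := exists_field_natCard_eq_pow.{u} (ResidueField O) hf
    rw [hq] at hF
    have := isAdicComplete_powerSeries F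
    have hcard : Nat.card (ResidueField (PowerSeries F)) = q ^ f := by
      rw [card_residueField_powerSeries, hF]
    exact (h𝓓 f hf (PowerSeries F) hcard).unique (Nat.one_lt_pow (by omega) hq1)
      (hform f hf (PowerSeries F) hcard)
  · rintro rfl
    exact ⟨ellDenef u a b, regular_ellDenef q u a b, fun f hf R _ _ _ _ hR => hform f hf R hR,
      hneg.symm⟩
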